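/- **Setting.** Consider a stationary $(2+1)$-dimensional black hole with metric $$ds^2=-N(r)^2dt^2+g_{rr}(r)\,dr^2+g_{\theta\theta}(r)\,(d\theta+N^\theta(r)\,dt)^2,\qquad \theta\sim\theta+2\pi ,$$ between a non-extremal event horizon $r=r_+>0$ and a mirror $r=r_{\mathcal M}>r_+$. Assume that $N(r_+)=0$ and $N,g_{rr}>0$ on $(r_+,r_{\mathcal M}]$, that $g_{\theta\theta}>0$ on $[r_+,r_{\mathcal M}]$, and that $N^2$, $g_{\theta\theta}$, $N^\theta$ and $\sqrt{g_{rr}}\,N$ extend smoothly to $[r_+,r_{\mathcal M}]$, the last with a nonzero value at $r_+$. Let $\kappa_+=\lim_{r\to r_+}N'(r)/\sqrt{g_{rr}(r)}>0$ be the surface gravity and $\Omega_{\mathcal H}=-N^\theta(r_+)$ the angular velocity of the horizon. Assume that $\chi=\partial_t+\Omega_{\mathcal H}\partial_\theta$ is timelike on $(r_+,r_{\mathcal M}]$, that is, $g_{\theta\theta}(N^\theta+\Omega_{\mathcal H})^2<N^2$. Let $R$ be the Ricci scalar and $m,\xi\in\mathbb R$. On the complex Riemannian section $$N^2d\tau^2+g_{rr}dr^2+g_{\theta\theta}\big(d\tilde\theta-i(N^\theta+\Omega_{\mathcal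 H})d\tau\big)^2,\qquad \tau\sim\tau+2\pi/\kappa_+,\quad \tilde\theta=\theta-\Omega_{\mathcal H}t,$$ put $\sqrt g=N\sqrt{g_{rr}g_{\theta\theta}}$ and, for $n,k\in\mathbb Z$, consider the radial equation of $(\nabla^2-m^2-\xi R)\Phi=0$, $$\Big[\tfrac1{\sqrt g}\tfrac{d}{dr}\Big(\sqrt g\,g^{rr}\tfrac{d}{dr}\Big)-\tfrac{(\kappa_+n+ik(N^\theta+\Omega_{\mathcal H}))^2}{N^2}-\tfrac{k^2}{g_{\theta\theta}}-m^2-\xi R\Big]\phi=0 .$$ Suppose that for all $n,k$ its Green's function $G_{nk}(r,r')=C_{nk}\,p_{nk}(r_<)\,q_{nk}(r_>)$ exists, where $p_{nk}$ is a solution regular (bounded) at $r_+$, $q_{nk}$ is a solution vanishing at $r_{\mathcal M}$, and $C_{nk}(p_{nk}q_{nk}'-q_{nk}p_{nk}')=-1/(\sqrt g\,g^{rr})$. Put $G^{\rm BH}_{nk}=\frac{\kappa_+}{4\pi^2}G_{nk}(r,r)$. The Green's distribution of the Hartle–Hawking state at coincident radius $r$ is $$G=\sum_{n,k}e^{i\kappa_+n(\tau-\tau')}e^{ik(\tilde\theta-\tilde\theta')}\,G^{\rm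 BH}_{nk}.$$ Let $\gamma>0$, $T_{\mathbb M}>0$, $\Omega_{\mathbb M}\in\mathbb R$, $m_{\mathbb M}\in\mathbb R$ and $\rho=\gamma^{-1}\sqrt{g_{\theta\theta}(r)}$. In rotating Minkowski spacetime $d\tau^2+d\rho^2+\rho^2(d\tilde\theta-i\Omega_{\mathbb M}d\tau)^2$ at temperature $T_{\mathbb M}$, with a mirror at $\rho_{\mathcal M}>\rho$, $|\Omega_{\mathbb M}|\rho_{\mathcal M}<1$, let $G^{\mathbb M}_{nk}=\frac{T_{\mathbb M}}{2\pi}\,C^{\mathbb M}_{nk}\,p^{\mathbb M}_{nk}(\rho)\,q^{\mathbb M}_{nk}(\rho)$. Here $p^{\mathbb M}_{nk}$ (bounded at $\rho=0$) and $q^{\mathbb M}_{nk}$ (vanishing at $\rho_{\mathcal M}$) solve $$\phi''+\tfrac1\rho\phi'-\Big((2\pi T_{\mathbb M}n+ik\Omega_{\mathbb M})^2+m_{\mathbb M}^2+\tfrac{k^2}{\rho^2}\Big)\phi=0,$$ and $C^{\mathbb M}_{nk}(p^{\mathbb M}_{nk}q^{\mathbb M}_{nk}{}'-q^{\mathbb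 M}_{nk}p^{\mathbb M}_{nk}{}')=-1/\rho$. Let $G^{\mathbb M}=\sum_{n,k}e^{2\pi iT_{\mathbb M}n(\tau-\tau')}e^{ik(\tilde\theta-\tilde\theta')}G^{\mathbb M}_{nk}$. For angular separation ($\tau=\tau'$, equal radii, angle $\tilde\theta>0$) the Hadamard singular parts are $G_{\rm Had}=\frac1{4\pi\sqrt{g_{\theta\theta}(r)}\,\tilde\theta}+O(\tilde\theta)$ and $G^{\mathbb M}_{\rm Had}=\frac1{4\pi\rho\,\tilde\theta}+O(\tilde\theta)$. Put $G^{\mathbb M}_{\rm reg}=G^{\mathbb M}-G^{\mathbb M}_{\rm Had}$. **Theorem.** Let $r\in(r_+,r_{\mathcal M})$ and choose $$\gamma=N(r),\qquad T_{\mathbb M}=\frac{\kappa_+}{2\pi},\qquad \Omega_{\mathbb M}=N^\theta(r)+\Omega_{\mathcal H}.$$ Then the double sum is finite in the coincidence limit: $$\sum_{n,k\in\mathbb Z}\big|G^{\rm BH}_{nk}-\gamma^{-1}G^{\mathbb M}_{nk}\big|<\infty,\qquad \lim_{\tilde\theta\to0^+}\sum_ke^{ik\tilde\theta}\sum_n\big[G^{\rm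 BH}_{nk}-\gamma^{-1}G^{\mathbb M}_{nk}\big]=\sum_k\sum_n\big[G^{\rm BH}_{nk}-\gamma^{-1}G^{\mathbb M}_{nk}\big].$$ Moreover, the mode sums $G$ and $G^{\mathbb M}$ are continuous functions away from coincidence (as distributions in $(\tau-\tau',\tilde\theta-\tilde\theta')$), for angular separation $$G-G_{\rm Had}=\sum_ke^{ik\tilde\theta}\sum_n\big[G^{\rm BH}_{nk}-\gamma^{-1}G^{\mathbb M}_{nk}\big]+\gamma^{-1}G^{\mathbb M}_{\rm reg}+O(\tilde\theta),$$ $G^{\mathbb M}_{\rm reg}$ has a finite limit as $\tilde\theta\to0^+$, and therefore the renormalised vacuum polarisation $\langle\Phi^2\rangle=\lim_{\tilde\theta\to0^+}(G-G_{\rm Had})$ exists, is finite, and equals $\sum_k\sum_n[G^{\rm BH}_{nk}-\gamma^{-1}G^{\mathbb M}_{nk}]+\gamma^{-1}\lim_{\tilde\theta\to0^+}G^{\mathbb M}_{\rm reg}$. -/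

import Mathlib

open Filter Topology Set MeasureTheory
open scoped ContDiff

noncomputable section

/-! ### Stationary, axisymmetric metrics in 2+1 dimensions -/

/-- The coefficient functions of a metric
`ds² = -N(r)² dt² + g_rr(r) dr² + g_θθ(r) (dθ + N^θ(r) dt)²`, with `θ ∼ θ + 2π`.
The Wick rotation `t = -iτ` gives its complex Riemannian section
`N² dτ² + g_rr dr² + g_θθ (dθ - i N^θ dτ)²`. -/
structure StationaryMetric where
  /-- the lapse function `N` -/
  lapse : ℝ → ℝ
  /-- the component `g_rr` -/
  grr : ℝ → ℝ
  /-- the component `g_θθ` -/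
  gθθ : ℝ → ℝ
  /-- the shift function `N^θ` -/
  shift : ℝ → ℝ

namespace StationaryMetric

variable (M : StationaryMetric)

/-- `√g`, where `g = N² g_rr g_θθ` is the determinant of the complex Riemannian metric. -/
def sqrtDet (r : ℝ) : ℝ := M.lapse r * √(M.grr r) * √(M.gθθ r)

/-- The (Lorentzian) metric components in the coordinates `(t, r, θ)`. -/
def metric (r : ℝ) : Matrix (Fin 3) (Fin 3) ℝ :=
  !![-(M.lapse r) ^ 2 + M.gθθ r * (M.shift r) ^ 2, 0, M.gθθ r * M.shift r;
     0, M.grr r, 0;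
     M.gθθ r * M.shift r, 0, M.gθθ r]

/-- The coordinate derivative `∂_μ f` of a function `f` that depends on the coordinate `r` only;
the coordinates `(t, r, θ)` are numbered `0, 1, 2`. -/
def coordDeriv (μ : Fin 3) (f : ℝ → ℝ) (r : ℝ) : ℝ := if μ = 1 then deriv f r else 0

/-- The Christoffel symbols `Γ^l_{μν}` of the metric. -/
def christoffel (l μ ν : Fin 3) (r : ℝ) : ℝ :=
  (1 / 2) * ∑ σ, (M.metric r)⁻¹ l σ *
    (coordDeriv μ (fun s => M.metric s σ ν) r + coordDeriv ν (fun s => M.metric s σ μ) r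
      - coordDeriv σ (fun s => M.metric s μ ν) r)

/-- The Ricci tensor `R_{μν}` of the metric. -/
def ricci (μ ν : Fin 3) (r : ℝ) : ℝ :=
  ∑ l, (coordDeriv l (M.christoffel l μ ν) r - coordDeriv ν (M.christoffel l l μ) r
    + ∑ σ, (M.christoffel l l σ r * M.christoffel σ μ ν r
      - M.christoffel l ν σ r * M.christoffel σ μ l r))

/-- The Ricci scalar `R` of the metric (the complex Riemannian section has the same one). -/
def scalarCurvature (r : ℝ) : ℝ := ∑ μ, ∑ ν, (M.metric r)⁻¹ μ ν * M.ricci μ ν r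

/-- `φ` solves, for `a < r < b`, the radial equation
`[ (1/√g) d/dr (√g g^rr d/dr) - (w + i k N^θ)² / N² - k² / g_θθ - U(r) ] φ = 0`,
that is, `e^{iwτ + ikθ} φ(r)` solves `(∇² - U) Φ = 0` on the complex Riemannian section. -/
def IsRadialSolution (U : ℝ → ℝ) (w : ℝ) (k : ℤ) (a b : ℝ) (φ : ℝ → ℂ) : Prop :=
  DifferentiableOn ℝ φ (Ioo a b) ∧
  ∀ r ∈ Ioo a b,
    HasDerivAt (fun s => ((M.sqrtDet s / M.grr s : ℝ) : ℂ) * deriv φ s)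
      ((M.sqrtDet r : ℂ) *
        ((((w : ℂ) + Complex.I * k * (M.shift r : ℂ)) ^ 2 / (M.lapse r : ℂ) ^ 2
          + (k : ℂ) ^ 2 / (M.gθθ r : ℂ) + (U r : ℂ)) * φ r)) r

/-- `G` is the radial Green's function `G(r, r') = C p(r_<) q(r_>)` on `(a, b)`. Here `p` is a
solution of the radial equation that is regular (bounded) at the inner end `a`, `q` is a solution
that satisfies the Dirichlet condition at the outer end `b`, and `C` is fixed by the Wronskian
relation `C (p q' - q p') = -1 / (√g g^rr)`, so that `G` satisfies the radial equation with the
source `-δ(r - r') / √g`. -/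
def IsRadialGreen (U : ℝ → ℝ) (w : ℝ) (k : ℤ) (a b : ℝ) (G : ℝ → ℝ → ℂ) : Prop :=
  ∃ (p q : ℝ → ℂ) (C : ℂ),
    M.IsRadialSolution U w k a b p ∧
    M.IsRadialSolution U w k a b q ∧
    (∃ K : ℝ, ∀ᶠ r in 𝓝[>] a, ‖p r‖ ≤ K) ∧
    Tendsto q (𝓝[<] b) (𝓝 0) ∧
    (∀ r ∈ Ioo a b,
      C * (p r * deriv q r - q r * deriv p r) = -1 / ((M.sqrtDet r / M.grr r : ℝ) : ℂ)) ∧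
    ∀ r ∈ Ioo a b, ∀ r' ∈ Ioo a b, G r r' = C * p (min r r') * q (max r r')

end StationaryMetric

/-- Minkowski spacetime in coordinates that rotate with angular velocity `Ω`:
`ds² = -dt² + dρ² + ρ² (dθ + Ω dt)²`. -/
def rotatingMinkowski (Ω : ℝ) : StationaryMetric where
  lapse := fun _ => 1
  grr := fun _ => 1
  gθθ := fun ρ => ρ ^ 2
  shift := fun _ => Ω

/-- The region between the event horizon `r = rH` and a mirror `r = rM` of a non-extremal
stationary (2+1)-dimensional black hole. -/
structure RotatingBlackHole extends StationaryMetric where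
  /-- the radius of the event horizon -/
  rH : ℝ
  /-- the radius of the mirror -/
  rM : ℝ
  /-- the angular velocity of the horizon -/
  ΩH : ℝ
  /-- the surface gravity of the horizon -/
  κ : ℝ
  rH_pos : 0 < rH
  rH_lt_rM : rH < rM
  lapse_horizon : lapse rH = 0
  lapse_pos : ∀ r ∈ Ioc rH rM, 0 < lapse r
  grr_pos : ∀ r ∈ Ioc rH rM, 0 < grr r
  gθθ_pos : ∀ r ∈ Icc rH rM, 0 < gθθ r
  /-- The metric extends smoothly through the horizon: `N²`, `g_θθ`, `N^θ` and `√g_rr N` are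
  smooth up to `r = rH`, and `√g_rr N` has a finite non-zero value there (so `g^rr = 0` there). -/
  contDiffOn_lapse_sq : ContDiffOn ℝ ∞ (fun r => lapse r ^ 2) (Icc rH rM)
  contDiffOn_gθθ : ContDiffOn ℝ ∞ gθθ (Icc rH rM)
  contDiffOn_shift : ContDiffOn ℝ ∞ shift (Icc rH rM)
  contDiffOn_sqrt_grr_mul_lapse : ∃ f : ℝ → ℝ, ContDiffOn ℝ ∞ f (Icc rH rM) ∧
    (∀ r ∈ Icc rH rM, 0 < f r) ∧ ∀ r ∈ Ioc rH rM, √(grr r) * lapse r = f r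
  /-- The Killing field `χ = ∂_t + ΩH ∂_θ` is null at the horizon, ... -/
  generator_null : shift rH + ΩH = 0
  /-- ... and timelike outside the horizon, up to and including the mirror. -/
  generator_timelike : ∀ r ∈ Ioc rH rM, gθθ r * (shift r + ΩH) ^ 2 < lapse r ^ 2
  κ_pos : 0 < κ
  tendsto_surfaceGravity : Tendsto (fun r => deriv lapse r / √(grr r)) (𝓝[>] rH) (𝓝 κ)

/-- The metric in the co-rotating coordinates `(t, r, θ - ΩH t)`. -/
def RotatingBlackHole.corotating (B : RotatingBlackHole) : StationaryMetric where
  lapse := B.lapse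
  grr := B.grr
  gθθ := B.gθθ
  shift := fun r => B.shift r + B.ΩH

/-! ### Mode sums and Hadamard singular parts at coincident radius -/

/-- The separations `(τ - τ', θ - θ')` that are zero modulo the periods `2π/κ` and `2π`. -/
def coincidenceSet (κ : ℝ) : Set (ℝ × ℝ) :=
  {x | ∃ a b : ℤ, x = (2 * Real.pi * a / κ, 2 * Real.pi * b)}

/-- The mode sum `∑_{n,k} c_{nk} e^{iκnτ + ikθ}` converges, as a distribution on the set of
separations `(τ, θ)` that are not coincident, to the function `F`, which is continuous there
(and so is determined there by the coefficients). -/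
def IsModeSum (κ : ℝ) (c : ℤ → ℤ → ℂ) (F : ℝ × ℝ → ℂ) : Prop :=
  ContinuousOn F (coincidenceSet κ)ᶜ ∧
  ∀ f : ℝ × ℝ → ℂ, ContDiff ℝ ∞ f → HasCompactSupport f → tsupport f ⊆ (coincidenceSet κ)ᶜ →
    HasSum (fun nk : ℤ × ℤ => c nk.1 nk.2 *
        ∫ x, Complex.exp (Complex.I * (κ * nk.1 * x.1 + nk.2 * x.2)) * f x)
      (∫ x, F x * f x)

/-- `H` is a Hadamard singular part for the angular separation `θ > 0`:
`H = 1 / (4 √2 π √σ) + O(θ)` with `σ = g_θθ θ² / 2`. -/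
def IsAngularHadamardPart (gθθ : ℝ) (H : ℝ → ℂ) : Prop :=
  (fun θ => H θ - ((1 / (4 * √2 * Real.pi * √(gθθ * θ ^ 2 / 2)) : ℝ) : ℂ))
    =O[𝓝[>] 0] (fun θ => θ)

end

/-!
The mode-by-mode subtraction works because, for large mode numbers, the radial Green's function on
the diagonal is local. Put `D = √g g^rr d/dr`. The radial equation becomes `D² φ = (V₀ + S) φ`,
where `V₀ = g_θθ (κn + ik(N^θ + Ω_H))² + N² k²` is quadratic in `(n, k)` and `S = N² g_θθ (m² + ξR)`
does not depend on the mode, and then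

  `G_{nk}(r, r) = 1 / (2 √V₀(r)) + O((n² + k²)^{-3/2})`.

With `γ = N(r)`, `ρ = γ⁻¹ √g_θθ(r)`, `2πT = κ` and `Ω = N^θ(r) + Ω_H` the potential `V₀(r)` is
`γ²` times the form `Q(n, k) = ρ² (κn + ikΩ)² + k²` of the Minkowski modes at `ρ`. So the leading
terms of `G^BH_{nk}` and `γ⁻¹ G^M_{nk}` are equal, and what is left is absolutely summable over
`ℤ × ℤ`.

*Asymptotics of the modes.* The timelike condition makes `Re V₀` positive, and for large mode
numbers `Re (V₀ + S) ≥ 0` down to the horizon (`RotatingBlackHole.exists_re_potential_nonneg`).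
This needs two facts about the horizon: `N²` vanishes there to first order only, because the
surface gravity is positive, and the scalar curvature is bounded (`scalarCurvature_eq`). Then
`Re ⟨φ, Dφ⟩` is monotone. It is non-negative for the solution bounded at the inner end, where
`∫ dr / (√g g^rr)` diverges, and non-positive for the solution vanishing at the mirror. Such a
sign condition on the logarithmic derivative `Dφ / φ` keeps a Möbius transform of it bounded, and that
transform relaxes exponentially fast to its WKB value, up to an error of relative size
`(n² + k²)^{-1}` (`norm_snd_sub_le`). The Wronskian relation turns the two logarithmic derivatives into
the Green's function (`norm_green_sub_le`).

*The mode sums as functions.* The coefficients `1 / (2 √Q)` are compared with those of an explicit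
model, `π^{-1/2} ∫_0^1 e^{-u² Q} du`, from which they differ by a Gaussian tail. The mode sum of
the model is an integral over the heat kernel `∑ e^{-tQ} e^{iκnτ + ikθ}`, which Poisson summation
(`heatSum_eq`) turns into a sum over images. Away from coincidence it is bounded uniformly in `t`,
so that the model is continuous there and is the distributional sum of its modes
(`isModeSum_thermalModel`). Near coincidence only the direct image is singular, and its integral
is explicit (`tendsto_thermalModel_sub`): it gives `1 / (4πρθ)`, the Hadamard singularity. The
other images, and the absolutely convergent Fourier series that remain, are continuous there.
-/

noncomputable section

/-! ### Large-parameter asymptotics of Sturm–Liouville solutions -/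

/-- A scalar differential inequality `f' ≤ -m f + K` forces exponential relaxation of `f`. -/
lemma le_exp_add_of_hasDerivAt_le {f f' : ℝ → ℝ} {a b m K : ℝ} (hm : 0 < m) (hK : 0 ≤ K)
    (hab : a ≤ b)
    (hf : ∀ x ∈ Icc a b, HasDerivAt f (f' x) x)
    (hle : ∀ x ∈ Icc a b, f' x ≤ -m * f x + K) :
    f b ≤ f a * Real.exp (-(m * (b - a))) + K / m := by
  have hd : ∀ x ∈ Icc a b, HasDerivAt (fun x => (f x - K / m) * Real.exp (m * x))
      ((f' x) * Real.exp (m * x) + (f x - K / m) * (Real.exp (m * x) * m)) x := by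
    intro x hx
    have h1 : HasDerivAt (fun x => Real.exp (m * x)) (Real.exp (m * x) * m) x := by
      simpa using ((hasDerivAt_id x).const_mul m).exp
    exact ((hf x hx).sub_const _).mul h1
  have hanti : AntitoneOn (fun x => (f x - K / m) * Real.exp (m * x)) (Icc a b) := by
    apply antitoneOn_of_hasDerivWithinAt_nonpos (convex_Icc a b)
      (fun x hx => (hd x hx).continuousAt.continuousWithinAt)
      (fun x hx => (hd x (interior_subset hx)).hasDerivWithinAt)
    intro x hx
    have h1 := hle x (interior_subset hx)
    have h2 : (f x - K / m) * m = m * f x - K := by field_simp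
    have h3 : f' x * Real.exp (m * x) + (f x - K / m) * (Real.exp (m * x) * m)
        = (f' x + m * f x - K) * Real.exp (m * x) := by linear_combination Real.exp (m * x) * h2
    rw [h3]
    exact mul_nonpos_of_nonpos_of_nonneg (by linarith) (Real.exp_pos _).le
  have h := hanti (left_mem_Icc.2 hab) (right_mem_Icc.2 hab) hab
  simp only at h
  have h4 : Real.exp (m * a) = Real.exp (m * b) * Real.exp (-(m * (b - a))) := by
    rw [← Real.exp_add]; ring_nf
  rw [h4] at h
  have h5 : f b - K / m ≤ (f a - K / m) * Real.exp (-(m * (b - a))) := by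
    have := Real.exp_pos (m * b)
    by_contra hc
    push Not at hc
    nlinarith [mul_lt_mul_of_pos_left hc this]
  nlinarith [mul_nonneg (div_nonneg hK hm.le) (Real.exp_pos (-(m * (b - a)))).le]

/-- Bounds, uniform in a large parameter `l`, on the data of the equation `D² φ = (V₀ + S) φ`,
where `D = P d/dx`: `V₁ = D V₀`, `V₂ = D V₁`, the real part of `V₀` is comparable to `l²`, and
`S` is bounded. -/
structure WKBData (c K P₀ P₁ l : ℝ) (I : Set ℝ) (P : ℝ → ℝ) (V₀ V₁ V₂ S : ℝ → ℂ) : Prop where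
  le_P : ∀ x ∈ I, P₀ ≤ P x
  P_le : ∀ x ∈ I, P x ≤ P₁
  deriv_V₀ : ∀ x ∈ I, HasDerivAt V₀ (V₁ x / P x) x
  deriv_V₁ : ∀ x ∈ I, HasDerivAt V₁ (V₂ x / P x) x
  le_re : ∀ x ∈ I, c * l ^ 2 ≤ (V₀ x).re
  norm_V₀ : ∀ x ∈ I, ‖V₀ x‖ ≤ K * l ^ 2
  norm_V₁ : ∀ x ∈ I, ‖V₁ x‖ ≤ K * l ^ 2
  norm_V₂ : ∀ x ∈ I, ‖V₂ x‖ ≤ K * l ^ 2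
  norm_S : ∀ x ∈ I, ‖S x‖ ≤ K

/-- `φ`, with `D φ = ψ`, solves `D² φ = V φ` on `I`, where `D = P d/dx`. -/
structure IsSLSolution (I : Set ℝ) (P : ℝ → ℝ) (V φ ψ : ℝ → ℂ) : Prop where
  deriv_fst : ∀ x ∈ I, HasDerivAt φ (ψ x / P x) x
  deriv_snd : ∀ x ∈ I, HasDerivAt ψ (V x * φ x / P x) x

/-- The principal square root. -/
def csqrt (z : ℂ) : ℂ := z ^ (1 / 2 : ℂ)

lemma csqrt_sq (z : ℂ) : csqrt z ^ 2 = z := by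
  rw [csqrt, one_div]; exact_mod_cast Complex.cpow_nat_inv_pow z (n := 2) (by norm_num)

lemma csqrt_mul_self (z : ℂ) : csqrt z * csqrt z = z := by rw [← sq, csqrt_sq]

lemma csqrt_ne_zero {z : ℂ} (hz : z ≠ 0) : csqrt z ≠ 0 := by
  intro h; apply hz; rw [← csqrt_sq z, h]; norm_num

lemma norm_csqrt_sq (z : ℂ) : ‖csqrt z‖ ^ 2 = ‖z‖ := by rw [← norm_pow, csqrt_sq]

lemma csqrt_re_nonneg (z : ℂ) : 0 ≤ (csqrt z).re := by
  rcases eq_or_ne z 0 with rfl | hz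
  · simp [csqrt]
  · rw [csqrt, Complex.cpow_def_of_ne_zero hz, Complex.exp_re]
    refine mul_nonneg (Real.exp_pos _).le (Real.cos_nonneg_of_mem_Icc ?_)
    have h : (Complex.log z * (1 / 2)).im = z.arg / 2 := by
      simp [Complex.mul_im, Complex.log_im]; ring
    rw [h]
    constructor <;> linarith [Complex.neg_pi_lt_arg z, Complex.arg_le_pi z]

lemma re_le_csqrt_re_sq (z : ℂ) : z.re ≤ (csqrt z).re ^ 2 := by
  have h := congrArg Complex.re (csqrt_sq z)
  rw [sq, Complex.mul_re] at h
  nlinarith [sq_nonneg (csqrt z).im]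

lemma csqrt_re_pos {z : ℂ} (hz : 0 < z.re) : 0 < (csqrt z).re := by
  have h1 := re_le_csqrt_re_sq z
  have h2 := csqrt_re_nonneg z
  rcases h2.eq_or_lt with h | h
  · rw [← h] at h1; norm_num at h1; linarith
  · exact h

lemma csqrt_eq_of_sq_eq {w z : ℂ} (h : w ^ 2 = z) (hw : 0 < w.re) : csqrt z = w := by
  have h1 : (csqrt z - w) * (csqrt z + w) = 0 := by linear_combination csqrt_sq z - h
  rcases mul_eq_zero.1 h1 with h2 | h2
  · exact sub_eq_zero.1 h2
  · have h3 := congrArg Complex.re h2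
    rw [Complex.add_re, Complex.zero_re] at h3
    linarith [csqrt_re_nonneg z]

lemma csqrt_ofReal_sq_mul {c : ℝ} (hc : 0 < c) {z : ℂ} (hz : 0 < z.re) :
    csqrt ((c : ℂ) ^ 2 * z) = c * csqrt z := by
  apply csqrt_eq_of_sq_eq
  · rw [mul_pow, csqrt_sq]
  · rw [Complex.re_ofReal_mul]; exact mul_pos hc (csqrt_re_pos hz)

lemma hasDerivAt_csqrt {V : ℝ → ℂ} {V' : ℂ} {x : ℝ} (h : HasDerivAt V V' x)
    (hx : 0 < (V x).re) : HasDerivAt (fun x => csqrt (V x)) (V' / (2 * csqrt (V x))) x := by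
  have h0 : V x ≠ 0 := by intro h0; simp [h0] at hx
  have h1 := (Complex.hasStrictDerivAt_cpow_const (x := V x) (c := 1 / 2)
    (Or.inl hx)).hasDerivAt.comp x h
  refine h1.congr_deriv ?_
  have h2 : (V x) ^ ((1 / 2 : ℂ) - 1) = 1 / csqrt (V x) := by
    rw [Complex.cpow_sub _ _ h0, Complex.cpow_one, div_eq_div_iff h0 (csqrt_ne_zero h0), one_mul]
    exact csqrt_mul_self _
  rw [h2]
  have := csqrt_ne_zero h0
  field_simp

lemma inner_neg_mul_sub_div (u s e : ℂ) (p : ℝ) :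
    inner ℝ u ((-2 * s * u - e) / p) = (-2 * s.re * ‖u‖ ^ 2 - inner ℝ u e) / p := by
  rw [Complex.inner, Complex.inner, div_mul_eq_mul_div, Complex.div_ofReal_re,
    ← Complex.normSq_eq_norm_sq, Complex.normSq_apply]
  congr 1
  simp [Complex.mul_re]
  ring

/-- Solves `A = u (A + 2 s φ)` for `A` when `u` is small. -/
lemma norm_le_of_eq_mul_add {A u s φ : ℂ} {k c l : ℝ} (hk : 0 ≤ k) (hc : 0 ≤ c) (hl : 1 ≤ l)
    (hA : A = u * (A + 2 * s * φ)) (hs : ‖s‖ ≤ k * l) (hu2 : ‖u‖ ^ 2 ≤ c / l ^ 4)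
    (hcl : 4 * c + 1 ≤ l) : ‖A‖ ≤ 4 * k * √c / l * ‖φ‖ := by
  have hl0 : 0 < l := by linarith
  have hu3 : ‖u‖ ≤ √c / l ^ 2 := by
    refine (sq_le_sq₀ (norm_nonneg _) (by positivity)).1 (hu2.trans (le_of_eq ?_))
    rw [div_pow, Real.sq_sqrt hc]; ring
  have hu4 : ‖u‖ ≤ 1 / 2 := by
    refine (sq_le_sq₀ (norm_nonneg _) (by positivity)).1 (hu2.trans ?_)
    rw [div_le_iff₀ (by positivity)]
    have : l ≤ l ^ 4 := le_self_pow₀ hl (by norm_num)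
    nlinarith
  have h : ‖A‖ ≤ 1 / 2 * ‖A‖ + 2 * (k * l) * (√c / l ^ 2) * ‖φ‖ := by
    calc ‖A‖ = ‖u * A + 2 * s * u * φ‖ := by
          conv_lhs => rw [hA]
          ring_nf
      _ ≤ ‖u‖ * ‖A‖ + 2 * ‖s‖ * ‖u‖ * ‖φ‖ := by
        refine (norm_add_le _ _).trans (le_of_eq ?_)
        simp only [norm_mul, Complex.norm_ofNat]
      _ ≤ _ := by gcongr
  have e : 2 * (k * l) * (√c / l ^ 2) * ‖φ‖ = 2 * k * √c / l * ‖φ‖ := by field_simp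
  have e' : 4 * k * √c / l * ‖φ‖ = 2 * (2 * k * √c / l * ‖φ‖) := by ring
  rw [e] at h
  rw [e']
  linarith

set_option maxHeartbeats 800000 in
/-- The logarithmic derivative `D φ / φ` of a solution growing to the right is, to second order,
`w = √V₀ - D V₀ / (4 V₀)`. With `w' = -√V₀ - D V₀ / (4 V₀)`, the Möbius transform
`u = (Dφ/φ - w) / (Dφ/φ - w')` is bounded because `Re (Dφ/φ) ≥ 0`, and it satisfies
`D u = - 2 √V₀ u + O(1/l)`, so that it relaxes to size `l⁻²` over a fixed distance. -/
theorem norm_snd_sub_le (c K P₀ P₁ δ : ℝ) (hc : 0 < c) (hK : 0 < K) (hP₀ : 0 < P₀) (hP₁ : 0 < P₁)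
    (hδ : 0 < δ) : ∃ C L : ℝ, 0 < C ∧ 1 ≤ L ∧ ∀ l, L ≤ l → ∀ (x₀ : ℝ) (P : ℝ → ℝ)
      (V₀ V₁ V₂ S φ ψ : ℝ → ℂ),
      WKBData c K P₀ P₁ l (Icc (x₀ - δ) x₀) P V₀ V₁ V₂ S →
      IsSLSolution (Icc (x₀ - δ) x₀) P (fun x => V₀ x + S x) φ ψ →
      (∀ x ∈ Icc (x₀ - δ) x₀, φ x ≠ 0) →
      (∀ x ∈ Icc (x₀ - δ) x₀, 0 ≤ (ψ x / φ x).re) →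
      ‖ψ x₀ - (csqrt (V₀ x₀) - V₁ x₀ / (4 * V₀ x₀)) * φ x₀‖ ≤ C / l * ‖φ x₀‖ := by
  set σ := √c with hσdef
  have hσ : 0 < σ := Real.sqrt_pos.2 hc
  have hσ2 : σ ^ 2 = c := Real.sq_sqrt hc.le
  have hK2 : √K ^ 2 = K := Real.sq_sqrt hK.le
  have hsK : 0 < √K := Real.sqrt_pos.2 hK
  set K₁ := K / (4 * c) with hK₁
  have hK₁p : 0 < K₁ := by positivity
  set E := K₁ + 5 * K₁ ^ 2 + K with hE
  have hEp : 0 < E := by positivity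
  set U₀ := 1 + 4 * √K / σ with hU₀
  have hU₀p : 0 < U₀ := by positivity
  set J := E * (1 + U₀) * 2 / σ with hJ
  have hJp : 0 < J := by positivity
  set C₁ := U₀ ^ 2 * 24 * P₁ ^ 4 / (2 * σ * δ) ^ 4 + J ^ 2 * P₁ / (4 * σ ^ 2 * P₀) with hC₁
  have hC₁p : 0 < C₁ := by positivity
  refine ⟨4 * √K * √C₁, max 1 (max (2 * K₁ / σ) (4 * C₁ + 1)), by positivity, le_max_left _ _, ?_⟩
  intro l hl x₀ P V₀ V₁ V₂ S φ ψ hW hS hφ hre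
  have hl1 : 1 ≤ l := (le_max_left _ _).trans hl
  have hl2 : 2 * K₁ / σ ≤ l := (le_max_left _ _).trans ((le_max_right _ _).trans hl)
  have hl3 : 4 * C₁ + 1 ≤ l := (le_max_right _ _).trans ((le_max_right _ _).trans hl)
  have hl0 : 0 < l := by linarith
  set I := Icc (x₀ - δ) x₀ with hI
  have hV₀re : ∀ x ∈ I, 0 < (V₀ x).re := fun x hx => lt_of_lt_of_le (by positivity) (hW.le_re x hx)
  have hV₀n : ∀ x ∈ I, c * l ^ 2 ≤ ‖V₀ x‖ := fun x hx =>
    (hW.le_re x hx).trans (Complex.re_le_norm _)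
  have hV₀0 : ∀ x ∈ I, V₀ x ≠ 0 := fun x hx h => by
    have := hV₀re x hx; simp [h] at this
  set s : ℝ → ℂ := fun x => csqrt (V₀ x) with hs
  have hsre : ∀ x ∈ I, σ * l ≤ (s x).re := fun x hx => by
    refine (sq_le_sq₀ (by positivity) (csqrt_re_nonneg _)).1 ?_
    refine le_trans ?_ (re_le_csqrt_re_sq _)
    rw [mul_pow, hσ2]; exact hW.le_re x hx
  have hsn : ∀ x ∈ I, ‖s x‖ ≤ √K * l := fun x hx => by
    refine (sq_le_sq₀ (norm_nonneg _) (by positivity)).1 ?_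
    rw [norm_csqrt_sq, mul_pow, hK2]; exact hW.norm_V₀ x hx
  have hs0 : ∀ x ∈ I, s x ≠ 0 := fun x hx => csqrt_ne_zero (hV₀0 x hx)
  have hPp : ∀ x ∈ I, 0 < P x := fun x hx => hP₀.trans_le (hW.le_P x hx)
  have hPc : ∀ x ∈ I, (P x : ℂ) ≠ 0 := fun x hx => by exact_mod_cast (hPp x hx).ne'
  set d : ℝ → ℂ := fun x => V₁ x / (4 * V₀ x) with hd
  have hdn : ∀ x ∈ I, ‖d x‖ ≤ K₁ := fun x hx => by
    rw [hd]; simp only [norm_div, norm_mul, Complex.norm_ofNat]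
    rw [div_le_iff₀ (by have := norm_pos_iff.2 (hV₀0 x hx); positivity), hK₁]
    have h1 := hW.norm_V₁ x hx
    have h2 := hV₀n x hx
    calc _ ≤ K * l ^ 2 := h1
      _ = K / (4 * c) * (4 * (c * l ^ 2)) := by field_simp
      _ ≤ _ := by gcongr
  have hs' : ∀ x ∈ I, HasDerivAt s (V₁ x / P x / (2 * s x)) x := fun x hx =>
    hasDerivAt_csqrt (hW.deriv_V₀ x hx) (hV₀re x hx)
  have hd' : ∀ x ∈ I, HasDerivAt d ((V₂ x / (4 * V₀ x) - 4 * d x ^ 2) / P x) x := fun x hx => by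
    have h1 := (hW.deriv_V₁ x hx).div ((hW.deriv_V₀ x hx).const_mul 4)
      (mul_ne_zero (by norm_num) (hV₀0 x hx))
    refine h1.congr_deriv ?_
    have := hV₀0 x hx
    have := hPc x hx
    simp only [hd]
    field_simp
  set ε : ℝ → ℂ := fun x => -(V₂ x / (4 * V₀ x)) + 5 * d x ^ 2 - S x with hε
  have hεn : ∀ x ∈ I, ‖ε x‖ ≤ E := fun x hx => by
    have h1 : ‖V₂ x / (4 * V₀ x)‖ ≤ K₁ := by
      simp only [norm_div, norm_mul, Complex.norm_ofNat]
      rw [div_le_iff₀ (by have := norm_pos_iff.2 (hV₀0 x hx); positivity), hK₁]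
      have h1 := hW.norm_V₂ x hx
      have h2 := hV₀n x hx
      calc _ ≤ K * l ^ 2 := h1
        _ = K / (4 * c) * (4 * (c * l ^ 2)) := by field_simp
        _ ≤ _ := by gcongr
    have h2 : ‖5 * d x ^ 2‖ ≤ 5 * K₁ ^ 2 := by
      rw [norm_mul, norm_pow, Complex.norm_ofNat]; have := hdn x hx; gcongr
    calc ‖ε x‖ ≤ ‖-(V₂ x / (4 * V₀ x)) + 5 * d x ^ 2‖ + ‖S x‖ := norm_sub_le _ _
      _ ≤ ‖-(V₂ x / (4 * V₀ x))‖ + ‖5 * d x ^ 2‖ + ‖S x‖ := by gcongr; exact norm_add_le _ _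
      _ ≤ E := by rw [norm_neg]; linarith [hW.norm_S x hx]
  have hsd : ∀ x ∈ I, V₁ x = 4 * s x ^ 2 * d x := fun x hx => by
    have := hV₀0 x hx
    simp only [hs, hd, csqrt_sq]; field_simp
  set A : ℝ → ℂ := fun x => ψ x - (s x - d x) * φ x with hA
  set B : ℝ → ℂ := fun x => ψ x + (s x + d x) * φ x with hB
  have hV₀s : ∀ x, V₀ x = s x ^ 2 := fun x => (csqrt_sq _).symm
  have hA' : ∀ x ∈ I, HasDerivAt A ((-(s x - d x) * A x - ε x * φ x) / P x) x := fun x hx => by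
    refine ((hS.deriv_snd x hx).sub (((hs' x hx).sub (hd' x hx)).mul
      (hS.deriv_fst x hx))).congr_deriv ?_
    have := hs0 x hx
    have := hPc x hx
    have h3 := hsd x hx
    simp only [hA, hε, h3, hV₀s, Pi.sub_apply]
    field_simp
    ring
  have hB' : ∀ x ∈ I, HasDerivAt B (((s x + d x) * B x - ε x * φ x) / P x) x := fun x hx => by
    refine ((hS.deriv_snd x hx).add (((hs' x hx).add (hd' x hx)).mul
      (hS.deriv_fst x hx))).congr_deriv ?_
    have := hs0 x hx
    have := hPc x hx
    have h3 := hsd x hx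
    simp only [hB, hε, h3, hV₀s, Pi.add_apply]
    field_simp
    ring
  have hBA : ∀ x, B x = A x + 2 * s x * φ x := fun x => by simp only [hA, hB]; ring
  -- `Re (B / φ)` is at least of order `l`
  have hBφ : ∀ x ∈ I, σ * l / 2 * ‖φ x‖ ≤ ‖B x‖ := fun x hx => by
    have hx0 := hφ x hx
    have h1 : B x = (ψ x / φ x + s x + d x) * φ x := by simp only [hB]; field_simp; ring
    rw [h1, norm_mul]
    gcongr
    refine le_trans ?_ (Complex.re_le_norm _)
    rw [Complex.add_re, Complex.add_re]
    have h2 := hre x hx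
    have h3 := hsre x hx
    have h4 : -K₁ ≤ (d x).re := by
      have := Complex.abs_re_le_norm (d x)
      have := neg_abs_le (d x).re
      linarith [hdn x hx]
    rw [div_le_iff₀ hσ] at hl2
    nlinarith
  have hB0 : ∀ x ∈ I, B x ≠ 0 := fun x hx => by
    have h1 := hBφ x hx
    have h2 := norm_pos_iff.2 (hφ x hx)
    exact norm_pos_iff.1 (lt_of_lt_of_le (by positivity) h1)
  have hφB : ∀ x ∈ I, ‖φ x / B x‖ ≤ 2 / (σ * l) := fun x hx => by
    rw [norm_div, div_le_div_iff₀ (norm_pos_iff.2 (hB0 x hx)) (by positivity)]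
    linarith [hBφ x hx]
  set u : ℝ → ℂ := fun x => A x / B x with hu
  have hu1 : ∀ x ∈ I, u x = 1 - 2 * s x * (φ x / B x) := fun x hx => by
    have h1 := hB0 x hx
    have h2 := hBA x
    simp only [hu]; field_simp; rw [h2]; ring
  have hun : ∀ x ∈ I, ‖u x‖ ≤ U₀ := fun x hx => by
    rw [hu1 x hx]
    calc _ ≤ ‖(1 : ℂ)‖ + ‖2 * s x * (φ x / B x)‖ := norm_sub_le _ _
      _ ≤ 1 + 2 * (√K * l) * (2 / (σ * l)) := by
        rw [norm_one, norm_mul, norm_mul, Complex.norm_ofNat]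
        have := hφB x hx
        have := hsn x hx
        gcongr
      _ = U₀ := by rw [hU₀]; field_simp; ring
  have hu' : ∀ x ∈ I, HasDerivAt u ((-2 * s x * u x - ε x * (1 - u x) * (φ x / B x)) / P x) x :=
    fun x hx => by
    refine ((hA' x hx).div (hB' x hx) (hB0 x hx)).congr_deriv ?_
    have := hB0 x hx
    have := hPc x hx
    have h3 : A x = B x - 2 * s x * φ x := by rw [hBA]; ring
    simp only [hu, h3]
    field_simp
    ring
  have hxI : x₀ ∈ I := ⟨by linarith, le_rfl⟩
  have hxI' : x₀ - δ ∈ I := ⟨le_rfl, by linarith⟩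
  have hdiff : ∀ x ∈ I, 2 * inner ℝ (u x)
      ((-2 * s x * u x - ε x * (1 - u x) * (φ x / B x)) / P x) ≤
      -(2 * σ * l / P₁) * ‖u x‖ ^ 2 + J ^ 2 / (2 * σ * P₀ * l ^ 3) := fun x hx => by
    have hP := hPp x hx
    have e2 : |inner ℝ (u x) (ε x * (1 - u x) * (φ x / B x))| ≤ ‖u x‖ * (J / l) := by
      refine (abs_real_inner_le_norm _ _).trans ?_
      gcongr
      rw [norm_mul, norm_mul]
      have h1 : ‖1 - u x‖ ≤ 1 + U₀ :=
        (norm_sub_le _ _).trans (by rw [norm_one]; linarith [hun x hx])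
      calc _ ≤ E * (1 + U₀) * (2 / (σ * l)) := by
            have := hεn x hx
            have := hφB x hx
            gcongr
        _ = J / l := by rw [hJ]; field_simp
    have e3 : ‖u x‖ * (J / l) ≤ σ * l * ‖u x‖ ^ 2 + J ^ 2 / (4 * σ * l ^ 3) := by
      have : σ * l * ‖u x‖ ^ 2 + J ^ 2 / (4 * σ * l ^ 3) - ‖u x‖ * (J / l)
          = (2 * σ * l ^ 2 * ‖u x‖ - J) ^ 2 / (4 * σ * l ^ 3) := by field_simp; ring
      have h2 : 0 ≤ (2 * σ * l ^ 2 * ‖u x‖ - J) ^ 2 / (4 * σ * l ^ 3) := by positivity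
      linarith
    have e4 : -2 * (s x).re * ‖u x‖ ^ 2 - inner ℝ (u x) (ε x * (1 - u x) * (φ x / B x)) ≤
        - (σ * l * ‖u x‖ ^ 2) + J ^ 2 / (4 * σ * l ^ 3) := by
      have h1 := mul_le_mul_of_nonneg_right (hsre x hx) (sq_nonneg ‖u x‖)
      have h2 := neg_abs_le (inner ℝ (u x) (ε x * (1 - u x) * (φ x / B x)))
      linarith
    rw [inner_neg_mul_sub_div]
    calc _ ≤ 2 * ((- (σ * l * ‖u x‖ ^ 2) + J ^ 2 / (4 * σ * l ^ 3)) / P x) := by gcongr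
      _ = -(2 * σ * l / P x) * ‖u x‖ ^ 2 + J ^ 2 / (2 * σ * P x * l ^ 3) := by
        field_simp; ring
      _ ≤ _ := by
        have h1 := hW.le_P x hx
        have h2 := hW.P_le x hx
        gcongr
  have hfin := le_exp_add_of_hasDerivAt_le (m := 2 * σ * l / P₁) (K := J ^ 2 / (2 * σ * P₀ * l ^ 3))
    (by positivity) (by positivity) (show x₀ - δ ≤ x₀ by linarith)
    (fun x hx => (hu' x hx).norm_sq) hdiff
  have hexp : Real.exp (-(2 * σ * l / P₁ * (x₀ - (x₀ - δ)))) ≤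
      24 * P₁ ^ 4 / (2 * σ * δ) ^ 4 / l ^ 4 := by
    have h1 : x₀ - (x₀ - δ) = δ := by ring
    have h2 : (2 * σ * l / P₁ * δ) ^ 4 / 24 ≤ Real.exp (2 * σ * l / P₁ * δ) := by
      have := Real.pow_div_factorial_le_exp (2 * σ * l / P₁ * δ) (by positivity) 4
      simpa [Nat.factorial] using this
    rw [h1, Real.exp_neg]
    calc _ ≤ ((2 * σ * l / P₁ * δ) ^ 4 / 24)⁻¹ := by gcongr
      _ = _ := by field_simp
  have hu2 : ‖u x₀‖ ^ 2 ≤ C₁ / l ^ 4 := by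
    refine hfin.trans ?_
    have h1 : ‖u (x₀ - δ)‖ ^ 2 ≤ U₀ ^ 2 := by have := hun _ hxI'; gcongr
    calc _ ≤ U₀ ^ 2 * (24 * P₁ ^ 4 / (2 * σ * δ) ^ 4 / l ^ 4)
          + J ^ 2 / (2 * σ * P₀ * l ^ 3) / (2 * σ * l / P₁) := by gcongr
      _ = _ := by rw [hC₁]; field_simp; ring
  refine norm_le_of_eq_mul_add hsK.le hC₁p.le hl1 ?_ (hsn _ hxI) hu2 hl3
  have h1 : A x₀ = u x₀ * B x₀ := by have := hB0 _ hxI; simp only [hu]; field_simp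
  rw [hBA] at h1
  exact h1

/-! ### Energy monotonicity and the diagonal Green function -/

namespace IsSLSolution

variable {a b : ℝ} {P : ℝ → ℝ} {V φ ψ : ℝ → ℂ}

lemma mono {I J : Set ℝ} (h : IsSLSolution I P V φ ψ) (hJ : J ⊆ I) : IsSLSolution J P V φ ψ :=
  ⟨fun x hx => h.deriv_fst x (hJ hx), fun x hx => h.deriv_snd x (hJ hx)⟩

/-- Reflection `x ↦ -x` exchanges the two ends of the interval. -/
lemma reflect {I J : Set ℝ} (h : IsSLSolution I P V φ ψ) (hJ : ∀ x ∈ J, -x ∈ I) :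
    IsSLSolution J (fun x => P (-x)) (fun x => V (-x)) (fun x => φ (-x)) (fun x => -ψ (-x)) := by
  constructor
  · intro x hx
    have h1 := (h.deriv_fst _ (hJ x hx)).scomp x (hasDerivAt_neg x)
    refine h1.congr_deriv ?_
    simp [neg_div]
  · intro x hx
    have h1 := ((h.deriv_snd _ (hJ x hx)).scomp x (hasDerivAt_neg x)).neg
    refine h1.congr_deriv ?_
    simp

lemma hasDerivAt_inner {I : Set ℝ} (h : IsSLSolution I P V φ ψ) {x : ℝ} (hx : x ∈ I) :
    HasDerivAt (fun x => inner ℝ (φ x) (ψ x))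
      ((‖ψ x‖ ^ 2 + (V x).re * ‖φ x‖ ^ 2) / P x) x := by
  refine ((h.deriv_fst x hx).inner ℝ (h.deriv_snd x hx)).congr_deriv ?_
  simp only [Complex.inner, ← Complex.normSq_eq_norm_sq, Complex.normSq_apply,
    div_mul_eq_mul_div, Complex.div_ofReal_re, map_div₀, Complex.conj_ofReal]
  rw [mul_div_assoc', Complex.div_ofReal_re, ← add_div]
  congr 1
  simp [Complex.mul_re]
  ring

lemma hasDerivAt_norm_sq {I : Set ℝ} (h : IsSLSolution I P V φ ψ) {x : ℝ} (hx : x ∈ I) :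
    HasDerivAt (fun x => ‖φ x‖ ^ 2) (2 * inner ℝ (φ x) (ψ x) / P x) x := by
  refine (h.deriv_fst x hx).norm_sq.congr_deriv ?_
  simp only [Complex.inner, div_mul_eq_mul_div, Complex.div_ofReal_re]
  ring

lemma monotoneOn_inner (h : IsSLSolution (Ioo a b) P V φ ψ) (hP : ∀ x ∈ Ioo a b, 0 < P x)
    (hV : ∀ x ∈ Ioo a b, 0 ≤ (V x).re) :
    MonotoneOn (fun x => inner ℝ (φ x) (ψ x)) (Ioo a b) := by
  apply monotoneOn_of_hasDerivWithinAt_nonneg (convex_Ioo a b)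
    (fun x hx => (h.hasDerivAt_inner hx).continuousAt.continuousWithinAt)
    (fun x hx => (h.hasDerivAt_inner (interior_subset hx)).hasDerivWithinAt)
  intro x hx
  have h1 := hP x (interior_subset hx)
  have h2 := hV x (interior_subset hx)
  positivity

/-- If `∫ dx / P` diverges at the left end, a solution bounded there has non-decreasing modulus:
otherwise the convexity of `‖φ‖²` with respect to `∫ dx / P` would make it unbounded. -/
lemma inner_nonneg_of_bounded (h : IsSLSolution (Ioo a b) P V φ ψ) (hP : ∀ x ∈ Ioo a b, 0 < P x)
    (hV : ∀ x ∈ Ioo a b, 0 ≤ (V x).re) {k : ℝ} (hPk : ∀ x ∈ Ioo a b, P x ≤ k * (x - a))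
    (hb : ∃ K : ℝ, ∀ᶠ x in 𝓝[>] a, ‖φ x‖ ≤ K) {x₁ : ℝ} (hx₁ : x₁ ∈ Ioo a b) :
    0 ≤ inner ℝ (φ x₁) (ψ x₁) := by
  by_contra hneg
  push Not at hneg
  obtain ⟨K, hK⟩ := hb
  set e := -inner ℝ (φ x₁) (ψ x₁) with he
  have he0 : 0 < e := by linarith
  have hk : 0 < k := by
    have h1 := (hP x₁ hx₁).trans_le (hPk x₁ hx₁)
    exact pos_of_mul_pos_left h1 (by linarith [hx₁.1])
  have hsub : ∀ x ∈ Ioc a x₁, x ∈ Ioo a b := fun x hx => ⟨hx.1, hx.2.trans_lt hx₁.2⟩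
  have hd : ∀ x ∈ Ioc a x₁, HasDerivAt (fun x => ‖φ x‖ ^ 2 + 2 * e / k * Real.log (x - a))
      (2 * inner ℝ (φ x) (ψ x) / P x + 2 * e / k * (1 / (x - a))) x := fun x hx =>
    (h.hasDerivAt_norm_sq (hsub x hx)).add
      ((((hasDerivAt_id x).sub_const a).log (sub_ne_zero.2 hx.1.ne')).const_mul _)
  have hanti : AntitoneOn (fun x => ‖φ x‖ ^ 2 + 2 * e / k * Real.log (x - a)) (Ioc a x₁) := by
    apply antitoneOn_of_hasDerivWithinAt_nonpos (convex_Ioc a x₁)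
      (fun x hx => (hd x hx).continuousAt.continuousWithinAt)
      (fun x hx => (hd x (interior_subset hx)).hasDerivWithinAt)
    intro x hx
    have hx := interior_subset hx
    have h1 : inner ℝ (φ x) (ψ x) ≤ -e := by
      rw [he, neg_neg]; exact h.monotoneOn_inner hP hV (hsub x hx) hx₁ hx.2
    have hP0 := hP x (hsub x hx)
    have hPk0 := hPk x (hsub x hx)
    have hxa : 0 < x - a := sub_pos.2 hx.1
    have h2 : 2 * inner ℝ (φ x) (ψ x) / P x ≤ -(2 * e / P x) := by
      rw [← neg_div]; gcongr; linarith
    have h3 : 2 * e / k * (1 / (x - a)) ≤ 2 * e / P x := by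
      rw [div_mul_div_comm, mul_one]; gcongr
    linarith
  have hlog : Tendsto (fun x => ‖φ x₁‖ ^ 2 + 2 * e / k * Real.log (x₁ - a)
      - 2 * e / k * Real.log (x - a)) (𝓝[>] a) atTop := by
    have h1 : Tendsto (fun x => x - a) (𝓝[>] a) (𝓝[>] 0) := by
      apply tendsto_nhdsWithin_of_tendsto_nhds_of_eventually_within
      · refine tendsto_nhdsWithin_of_tendsto_nhds ?_
        have : Tendsto (fun x => x - a) (𝓝 a) (𝓝 (a - a)) :=
          (continuous_id.sub continuous_const).tendsto a
        rwa [sub_self] at this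
      · filter_upwards [self_mem_nhdsWithin] with x hx using sub_pos.2 (mem_Ioi.1 hx)
    have h2 := (Real.tendsto_log_nhdsGT_zero.comp h1).const_mul_atBot
      (show 0 < 2 * e / k by positivity)
    have h3 := tendsto_neg_atBot_atTop.comp h2
    have h4 := tendsto_atTop_add_const_left _ (‖φ x₁‖ ^ 2 + 2 * e / k * Real.log (x₁ - a)) h3
    refine h4.congr fun x => ?_
    simp only [Function.comp]; ring
  have hIoo : ∀ᶠ x in 𝓝[>] a, x ∈ Ioo a x₁ := Ioo_mem_nhdsGT hx₁.1
  obtain ⟨x, hx1, hx2, hx3⟩ := ((hlog.eventually_gt_atTop (K ^ 2)).and (hK.and hIoo)).exists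
  have h1 := hanti ⟨hx3.1, hx3.2.le⟩ ⟨hx₁.1, le_rfl⟩ hx3.2.le
  simp only at h1
  have h2 : ‖φ x‖ ^ 2 ≤ K ^ 2 := by gcongr
  linarith

/-- A solution that vanishes at the right end has non-increasing modulus. -/
lemma inner_nonpos_of_tendsto_zero (h : IsSLSolution (Ioo a b) P V φ ψ)
    (hP : ∀ x ∈ Ioo a b, 0 < P x) (hV : ∀ x ∈ Ioo a b, 0 ≤ (V x).re)
    (hb : Tendsto φ (𝓝[<] b) (𝓝 0)) {x₁ : ℝ} (hx₁ : x₁ ∈ Ioo a b) :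
    inner ℝ (φ x₁) (ψ x₁) ≤ 0 := by
  by_contra hpos
  push Not at hpos
  have hsub : ∀ x ∈ Ico x₁ b, x ∈ Ioo a b := fun x hx => ⟨hx₁.1.trans_le hx.1, hx.2⟩
  have hmono : MonotoneOn (fun x => ‖φ x‖ ^ 2) (Ico x₁ b) := by
    apply monotoneOn_of_hasDerivWithinAt_nonneg (convex_Ico x₁ b)
      (fun x hx => (h.hasDerivAt_norm_sq (hsub x hx)).continuousAt.continuousWithinAt)
      (fun x hx => (h.hasDerivAt_norm_sq (hsub x (interior_subset hx))).hasDerivWithinAt)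
    intro x hx
    have hx := interior_subset hx
    have h1 := h.monotoneOn_inner hP hV hx₁ (hsub x hx) hx.1
    have h2 := hP x (hsub x hx)
    simp only at h1
    have : 0 ≤ inner ℝ (φ x) (ψ x) := hpos.le.trans h1
    positivity
  have hlim : Tendsto (fun x => ‖φ x‖ ^ 2) (𝓝[<] b) (𝓝 0) := by
    simpa using (hb.norm.pow 2)
  have hev : ∀ᶠ x in 𝓝[<] b, ‖φ x₁‖ ^ 2 ≤ ‖φ x‖ ^ 2 := by
    filter_upwards [Ioo_mem_nhdsLT hx₁.2] with x hx
    exact hmono ⟨le_rfl, hx₁.2⟩ ⟨hx.1.le, hx.2⟩ hx.1.le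
  have h0 : ‖φ x₁‖ ^ 2 ≤ 0 := ge_of_tendsto hlim hev
  have h1 : φ x₁ = 0 := norm_eq_zero.1
    (pow_eq_zero_iff two_ne_zero |>.1 (le_antisymm h0 (sq_nonneg _)))
  simp [h1] at hpos

/-- A non-trivial solution with non-decreasing modulus has no zero: it would vanish identically
to the left of a zero. -/
lemma ne_zero_of_inner_nonneg (h : IsSLSolution (Ioo a b) P V φ ψ)
    (hP : ∀ x ∈ Ioo a b, 0 < P x) (hE : ∀ x ∈ Ioo a b, 0 ≤ inner ℝ (φ x) (ψ x))
    (hne : ∀ x ∈ Ioo a b, φ x ≠ 0 ∨ ψ x ≠ 0) {x₁ : ℝ} (hx₁ : x₁ ∈ Ioo a b) : φ x₁ ≠ 0 := by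
  intro h0
  have hsub : ∀ x ∈ Ioc a x₁, x ∈ Ioo a b := fun x hx => ⟨hx.1, hx.2.trans_lt hx₁.2⟩
  have hmono : MonotoneOn (fun x => ‖φ x‖ ^ 2) (Ioc a x₁) := by
    apply monotoneOn_of_hasDerivWithinAt_nonneg (convex_Ioc a x₁)
      (fun x hx => (h.hasDerivAt_norm_sq (hsub x hx)).continuousAt.continuousWithinAt)
      (fun x hx => (h.hasDerivAt_norm_sq (hsub x (interior_subset hx))).hasDerivWithinAt)
    intro x hx
    have hx := interior_subset hx
    have h1 := hE x (hsub x hx)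
    have h2 := hP x (hsub x hx)
    positivity
  have hz : ∀ x ∈ Ioc a x₁, φ x = 0 := fun x hx => by
    have h1 := hmono hx ⟨hx₁.1, le_rfl⟩ hx.2
    simp only [h0, norm_zero] at h1
    norm_num at h1
    simpa using h1
  obtain ⟨x, hx⟩ := exists_between hx₁.1
  have hx' : x ∈ Ioo a b := hsub x ⟨hx.1, hx.2.le⟩
  have h2 : HasDerivAt φ 0 x := by
    refine (hasDerivAt_const x (0 : ℂ)).congr_of_eventuallyEq ?_
    filter_upwards [Ioo_mem_nhds hx.1 hx.2] with y hy using hz y ⟨hy.1, hy.2.le⟩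
  have h3 := (h.deriv_fst x hx').unique h2
  have h4 : (P x : ℂ) ≠ 0 := by exact_mod_cast (hP x hx').ne'
  have h5 : ψ x = 0 := by simpa [h4] using h3
  rcases hne x hx' with h | h
  · exact h (hz x ⟨hx.1, hx.2.le⟩)
  · exact h h5

end IsSLSolution

lemma re_div_eq_inner_div (z w : ℂ) : (z / w).re = inner ℝ w z / ‖w‖ ^ 2 := by
  rw [Complex.inner, Complex.div_re, ← Complex.normSq_eq_norm_sq]
  simp [Complex.mul_re]; ring

namespace WKBData

variable {c K P₀ P₁ l : ℝ} {P : ℝ → ℝ} {V₀ V₁ V₂ S : ℝ → ℂ}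

lemma mono {I J : Set ℝ} (h : WKBData c K P₀ P₁ l I P V₀ V₁ V₂ S) (hJ : J ⊆ I) :
    WKBData c K P₀ P₁ l J P V₀ V₁ V₂ S where
  le_P x hx := h.le_P x (hJ hx)
  P_le x hx := h.P_le x (hJ hx)
  deriv_V₀ x hx := h.deriv_V₀ x (hJ hx)
  deriv_V₁ x hx := h.deriv_V₁ x (hJ hx)
  le_re x hx := h.le_re x (hJ hx)
  norm_V₀ x hx := h.norm_V₀ x (hJ hx)
  norm_V₁ x hx := h.norm_V₁ x (hJ hx)
  norm_V₂ x hx := h.norm_V₂ x (hJ hx)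
  norm_S x hx := h.norm_S x (hJ hx)

lemma reflect {I J : Set ℝ} (h : WKBData c K P₀ P₁ l I P V₀ V₁ V₂ S) (hJ : ∀ x ∈ J, -x ∈ I) :
    WKBData c K P₀ P₁ l J (fun x => P (-x)) (fun x => V₀ (-x)) (fun x => -V₁ (-x))
      (fun x => V₂ (-x)) (fun x => S (-x)) where
  le_P x hx := h.le_P _ (hJ x hx)
  P_le x hx := h.P_le _ (hJ x hx)
  deriv_V₀ x hx := by
    refine ((h.deriv_V₀ _ (hJ x hx)).scomp x (hasDerivAt_neg x)).congr_deriv ?_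
    simp [neg_div]
  deriv_V₁ x hx := by
    refine ((h.deriv_V₁ _ (hJ x hx)).scomp x (hasDerivAt_neg x)).neg.congr_deriv ?_
    simp
  le_re x hx := h.le_re _ (hJ x hx)
  norm_V₀ x hx := h.norm_V₀ _ (hJ x hx)
  norm_V₁ x hx := by rw [norm_neg]; exact h.norm_V₁ _ (hJ x hx)
  norm_V₂ x hx := h.norm_V₂ _ (hJ x hx)
  norm_S x hx := h.norm_S _ (hJ x hx)

end WKBData

/-- The Green's function on the diagonal is `1 / (2 √V₀)` up to a relative error `O(l⁻²)`: in the
difference of the logarithmic derivatives of the two solutions the terms `D V₀ / (4 V₀)` cancel. -/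
theorem norm_green_sub_le (c K P₀ P₁ δ : ℝ) (hc : 0 < c) (hK : 0 < K) (hP₀ : 0 < P₀) (hP₁ : 0 < P₁)
    (hδ : 0 < δ) : ∃ C L : ℝ, 0 < C ∧ 1 ≤ L ∧ ∀ l, L ≤ l → ∀ (x₀ : ℝ) (P : ℝ → ℝ)
      (V₀ V₁ V₂ S p ψp q ψq : ℝ → ℂ) (C' : ℂ),
      WKBData c K P₀ P₁ l (Icc (x₀ - δ) (x₀ + δ)) P V₀ V₁ V₂ S →
      IsSLSolution (Icc (x₀ - δ) (x₀ + δ)) P (fun x => V₀ x + S x) p ψp →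
      IsSLSolution (Icc (x₀ - δ) (x₀ + δ)) P (fun x => V₀ x + S x) q ψq →
      (∀ x ∈ Icc (x₀ - δ) (x₀ + δ), p x ≠ 0) → (∀ x ∈ Icc (x₀ - δ) (x₀ + δ), q x ≠ 0) →
      (∀ x ∈ Icc (x₀ - δ) (x₀ + δ), 0 ≤ inner ℝ (p x) (ψp x)) →
      (∀ x ∈ Icc (x₀ - δ) (x₀ + δ), inner ℝ (q x) (ψq x) ≤ 0) →
      C' * (p x₀ * ψq x₀ - q x₀ * ψp x₀) = -1 →
      ‖C' * p x₀ * q x₀ - 1 / (2 * csqrt (V₀ x₀))‖ ≤ C / l ^ 3 := by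
  obtain ⟨C, L, hC, hL, H⟩ := norm_snd_sub_le c K P₀ P₁ δ hc hK hP₀ hP₁ hδ
  set σ := √c with hσdef
  have hσ : 0 < σ := Real.sqrt_pos.2 hc
  have hσ2 : σ ^ 2 = c := Real.sq_sqrt hc.le
  refine ⟨C / σ ^ 2, max L (2 * C / σ), by positivity, hL.trans (le_max_left _ _), ?_⟩
  intro l hl x₀ P V₀ V₁ V₂ S p ψp q ψq C' hW hp hq hp0 hq0 hpE hqE hC'
  have hlL : L ≤ l := (le_max_left _ _).trans hl
  have hl2 : 2 * C / σ ≤ l := (le_max_right _ _).trans hl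
  have hl1 : 1 ≤ l := hL.trans hlL
  have hl0 : 0 < l := by linarith
  have hx₀ : x₀ ∈ Icc (x₀ - δ) (x₀ + δ) := ⟨by linarith, by linarith⟩
  have hsub : Icc (x₀ - δ) x₀ ⊆ Icc (x₀ - δ) (x₀ + δ) := Icc_subset_Icc_right (by linarith)
  have hneg : ∀ x ∈ Icc (-x₀ - δ) (-x₀), -x ∈ Icc (x₀ - δ) (x₀ + δ) := fun x hx =>
    ⟨by linarith [hx.2], by linarith [hx.1]⟩
  have h1 := H l hlL x₀ P V₀ V₁ V₂ S p ψp (hW.mono hsub) (hp.mono hsub)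
    (fun x hx => hp0 x (hsub hx)) (fun x hx => by
      rw [re_div_eq_inner_div]; exact div_nonneg (hpE x (hsub hx)) (sq_nonneg _))
  have h2 := H l hlL (-x₀) _ _ _ _ _ _ _ (hW.reflect hneg) (hq.reflect hneg)
    (fun x hx => hq0 _ (hneg x hx)) (fun x hx => by
      rw [re_div_eq_inner_div, inner_neg_right]
      exact div_nonneg (by linarith [hqE _ (hneg x hx)]) (sq_nonneg _))
  simp only [neg_neg] at h2
  set s := csqrt (V₀ x₀) with hs
  set d := V₁ x₀ / (4 * V₀ x₀) with hd
  set g := C' * p x₀ * q x₀ with hg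
  have hV : 0 < (V₀ x₀).re := lt_of_lt_of_le (by positivity) (hW.le_re x₀ hx₀)
  have hsl : σ * l ≤ ‖s‖ := by
    refine le_trans ?_ (Complex.re_le_norm _)
    refine (sq_le_sq₀ (by positivity) (csqrt_re_nonneg _)).1 ?_
    refine le_trans ?_ (re_le_csqrt_re_sq _)
    rw [mul_pow, hσ2]; exact hW.le_re x₀ hx₀
  have hs0 : s ≠ 0 := norm_pos_iff.1 (lt_of_lt_of_le (by positivity) hsl)
  have key : 2 * s * g - 1 = C' * (p x₀ * (-(-ψq x₀ - (s - -d) * q x₀))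
      - q x₀ * (ψp x₀ - (s - d) * p x₀)) := by
    rw [hg]; linear_combination (-1 : ℂ) * hC'
  have hneg_d : -V₁ x₀ / (4 * V₀ x₀) = -d := by rw [hd, neg_div]
  rw [hneg_d] at h2
  have hbound : ‖2 * s * g - 1‖ ≤ 2 * C / l * ‖g‖ := by
    rw [key, mul_sub]
    refine (norm_sub_le _ _).trans ?_
    simp only [norm_mul, norm_neg]
    have e1 : ‖g‖ = ‖C'‖ * ‖p x₀‖ * ‖q x₀‖ := by rw [hg, norm_mul, norm_mul]
    calc _ ≤ ‖C'‖ * (‖p x₀‖ * (C / l * ‖q x₀‖)) + ‖C'‖ * (‖q x₀‖ * (C / l * ‖p x₀‖)) := by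
          gcongr
      _ = _ := by rw [e1]; ring
  have hgn : ‖g‖ ≤ 1 / (σ * l) := by
    have e1 : ‖2 * s * g‖ ≤ 1 + 2 * C / l * ‖g‖ := by
      have := norm_add_le (2 * s * g - 1) 1
      rw [sub_add_cancel, norm_one] at this
      linarith
    have e2 : 2 * (σ * l) * ‖g‖ ≤ ‖2 * s * g‖ := by
      rw [norm_mul (2 * s) g, norm_mul 2 s, Complex.norm_ofNat]; gcongr
    have e3 : 2 * C / l ≤ σ * l := by
      rw [div_le_iff₀ hl0]
      rw [div_le_iff₀ hσ] at hl2
      nlinarith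
    have e4 : 2 * C / l * ‖g‖ ≤ σ * l * ‖g‖ := by gcongr
    rw [le_div_iff₀ (by positivity)]
    linarith
  have e5 : g - 1 / (2 * s) = (2 * s * g - 1) / (2 * s) := by field_simp
  rw [e5, norm_div, norm_mul, Complex.norm_ofNat]
  calc _ ≤ (2 * C / l * (1 / (σ * l))) / (2 * (σ * l)) := by
        gcongr
        exact hbound.trans (by gcongr)
    _ = _ := by field_simp

/-! ### Radial Green functions of a stationary metric -/

namespace StationaryMetric

variable (M : StationaryMetric)

/-- The coefficient `P = √g g^rr` of the radial operator. -/
def radialCoeff (r : ℝ) : ℝ := M.sqrtDet r / M.grr r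

/-- The part of the radial potential that is quadratic in the mode numbers,
`V₀ = g_θθ (κ n + i k N^θ)² + N² k²`, in the normal form `(P d/dr)² φ = (V₀ + N² g_θθ U) φ` of the
radial equation. -/
def modePotential (κ : ℝ) (n k : ℤ) (r : ℝ) : ℂ :=
  M.gθθ r * ((κ * n : ℝ) + Complex.I * k * M.shift r) ^ 2 + M.lapse r ^ 2 * k ^ 2

/-- The part `N² g_θθ U` of the radial potential that does not depend on the mode. -/
def backgroundPotential (U : ℝ → ℝ) (r : ℝ) : ℂ :=
  ((M.lapse r ^ 2 * M.gθθ r * U r : ℝ) : ℂ)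

lemma modePotential_eq (κ : ℝ) (n k : ℤ) (r : ℝ) :
    M.modePotential κ n k r = ((κ ^ 2 * M.gθθ r : ℝ) : ℂ) * (n : ℂ) ^ 2
      + Complex.I * ((2 * κ * M.gθθ r * M.shift r : ℝ) : ℂ) * (n * k)
      + ((M.lapse r ^ 2 - M.gθθ r * M.shift r ^ 2 : ℝ) : ℂ) * (k : ℂ) ^ 2 := by
  simp only [modePotential]
  push_cast
  linear_combination (M.gθθ r * (k * M.shift r) ^ 2 : ℂ) * Complex.I_sq

lemma modePotential_re (κ : ℝ) (n k : ℤ) (r : ℝ) :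
    (M.modePotential κ n k r).re = κ ^ 2 * M.gθθ r * n ^ 2
      + (M.lapse r ^ 2 - M.gθθ r * M.shift r ^ 2) * k ^ 2 := by
  rw [modePotential_eq]
  have h1 : ((n : ℂ) ^ 2) = (((n : ℝ) ^ 2 : ℝ) : ℂ) := by push_cast; rfl
  have h2 : ((k : ℂ) ^ 2) = (((k : ℝ) ^ 2 : ℝ) : ℂ) := by push_cast; rfl
  have h3 : Complex.I * ((2 * κ * M.gθθ r * M.shift r : ℝ) : ℂ) * ((n : ℂ) * k)
      = Complex.I * ((2 * κ * M.gθθ r * M.shift r * ((n : ℝ) * k) : ℝ) : ℂ) := by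
    push_cast; ring
  rw [h1, h2, h3, Complex.add_re, Complex.add_re, Complex.re_ofReal_mul, Complex.re_ofReal_mul,
    Complex.I_mul_re, Complex.ofReal_re, Complex.ofReal_re, Complex.ofReal_im]
  ring

variable {M}

lemma radialCoeff_pos {r : ℝ} (hN : 0 < M.lapse r) (hg : 0 < M.grr r) (hh : 0 < M.gθθ r) :
    0 < M.radialCoeff r := by
  unfold radialCoeff sqrtDet; positivity

/-- The radial equation in the normal form `(P d/dr)² φ = V φ`. -/
lemma IsRadialSolution.isSLSolution {U : ℝ → ℝ} {κ : ℝ} {n k : ℤ} {a b : ℝ} {φ : ℝ → ℂ}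
    (h : M.IsRadialSolution U (κ * n) k a b φ)
    (hN : ∀ r ∈ Ioo a b, 0 < M.lapse r) (hg : ∀ r ∈ Ioo a b, 0 < M.grr r)
    (hh : ∀ r ∈ Ioo a b, 0 < M.gθθ r) :
    IsSLSolution (Ioo a b) M.radialCoeff
      (fun r => M.modePotential κ n k r + M.backgroundPotential U r) φ
      (fun r => (M.radialCoeff r : ℂ) * deriv φ r) := by
  constructor
  · intro r hr
    have hP : (M.radialCoeff r : ℂ) ≠ 0 := by
      exact_mod_cast (radialCoeff_pos (hN r hr) (hg r hr) (hh r hr)).ne'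
    rw [mul_div_cancel_left₀ _ hP]
    exact ((h.1 r hr).differentiableAt (isOpen_Ioo.mem_nhds hr)).hasDerivAt
  · intro r hr
    refine (h.2 r hr).congr_deriv ?_
    have h1 : M.sqrtDet r = M.lapse r ^ 2 * M.gθθ r / M.radialCoeff r := by
      have hN := hN r hr
      have hg' := Real.sq_sqrt (hg r hr).le
      have hh' := Real.sq_sqrt (hh r hr).le
      have h3 := Real.sqrt_pos.2 (hg r hr)
      have h4 := Real.sqrt_pos.2 (hh r hr)
      rw [radialCoeff, sqrtDet]
      rw [← hg', ← hh']
      simp only [Real.sqrt_sq, h3.le, h4.le]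
      field_simp
    have hP : (M.radialCoeff r : ℂ) ≠ 0 := by
      exact_mod_cast (radialCoeff_pos (hN r hr) (hg r hr) (hh r hr)).ne'
    have hNc : (M.lapse r : ℂ) ≠ 0 := by exact_mod_cast (hN r hr).ne'
    have hhc : (M.gθθ r : ℂ) ≠ 0 := by exact_mod_cast (hh r hr).ne'
    rw [h1]
    simp only [modePotential, backgroundPotential]
    push_cast
    field_simp

end StationaryMetric

/-- On an open set, the functions `D f` and `D² f`, where `D = P d/dx`, of a `C²` function `f`. -/
lemma exists_slDeriv {s : Set ℝ} (hs : IsOpen s) {P f : ℝ → ℝ} (hP : ContDiffOn ℝ 2 P s)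
    (hP0 : ∀ x ∈ s, P x ≠ 0) (hf : ContDiffOn ℝ 2 f s) : ∃ f₁ f₂ : ℝ → ℝ,
      (∀ x ∈ s, HasDerivAt f (f₁ x / P x) x) ∧ (∀ x ∈ s, HasDerivAt f₁ (f₂ x / P x) x) ∧
      ContinuousOn f₁ s ∧ ContinuousOn f₂ s := by
  have h1 : ContDiffOn ℝ 1 (deriv f) s := hf.deriv_of_isOpen hs (by norm_num)
  have h2 : ContDiffOn ℝ 1 (fun x => P x * deriv f x) s := (hP.of_le (by norm_num)).mul h1
  have h3 : ContinuousOn (deriv fun x => P x * deriv f x) s :=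
    (h2.deriv_of_isOpen (m := 0) hs (by norm_num)).continuousOn
  refine ⟨fun x => P x * deriv f x, fun x => P x * deriv (fun x => P x * deriv f x) x,
    fun x hx => ?_, fun x hx => ?_, h2.continuousOn, hP.continuousOn.mul h3⟩
  · rw [mul_div_cancel_left₀ _ (hP0 x hx)]
    exact ((hf.differentiableOn (by norm_num) x hx).differentiableAt (hs.mem_nhds hx)).hasDerivAt
  · rw [mul_div_cancel_left₀ _ (hP0 x hx)]
    exact ((h2.differentiableOn (by norm_num) x hx).differentiableAt (hs.mem_nhds hx)).hasDerivAt

/-- The quadratic form `α n² + i β n k + η k²` in the mode numbers. -/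
def modeForm (n k : ℤ) (α β η : ℝ) : ℂ :=
  (α : ℂ) * (n : ℂ) ^ 2 + Complex.I * (β : ℂ) * (n * k) + (η : ℂ) * (k : ℂ) ^ 2

lemma norm_modeForm_le (n k : ℤ) {α β η K : ℝ} (hα : |α| ≤ K) (hβ : |β| ≤ K) (hη : |η| ≤ K) :
    ‖modeForm n k α β η‖ ≤ 2 * K * √((n : ℝ) ^ 2 + k ^ 2) ^ 2 := by
  have hK : 0 ≤ K := (abs_nonneg _).trans hα
  rw [Real.sq_sqrt (by positivity), modeForm]
  refine (norm_add₃_le).trans ?_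
  simp only [norm_mul, norm_pow, Complex.norm_real, Complex.norm_I, Complex.norm_intCast,
    Real.norm_eq_abs, sq_abs, one_mul]
  have h1 : |(n : ℝ)| * |(k : ℝ)| ≤ (n : ℝ) ^ 2 + k ^ 2 := by
    rw [← sq_abs (n : ℝ), ← sq_abs (k : ℝ)]
    nlinarith [sq_nonneg (|(n : ℝ)| - |(k : ℝ)|), sq_nonneg (|(n : ℝ)|), sq_nonneg (|(k : ℝ)|)]
  calc _ ≤ K * (n : ℝ) ^ 2 + K * ((n : ℝ) ^ 2 + k ^ 2) + K * (k : ℝ) ^ 2 := by gcongr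
    _ = _ := by ring

lemma hasDerivAt_modeForm (n k : ℤ) {α β η : ℝ → ℝ} {α' β' η' p x : ℝ}
    (hα : HasDerivAt α (α' / p) x) (hβ : HasDerivAt β (β' / p) x) (hη : HasDerivAt η (η' / p) x) :
    HasDerivAt (fun x => modeForm n k (α x) (β x) (η x)) (modeForm n k α' β' η' / p) x := by
  refine (((hα.ofReal_comp.mul_const _).add
    ((hβ.ofReal_comp.const_mul Complex.I).mul_const _)).add
    (hη.ofReal_comp.mul_const _)).congr_deriv ?_
  simp only [modeForm]; push_cast; ring

lemma exists_bound_of_continuousOn {x y : ℝ} {f : ℝ → ℝ} (hf : ContinuousOn f (Icc x y)) :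
    ∃ K, 0 ≤ K ∧ ∀ z ∈ Icc x y, |f z| ≤ K := by
  obtain ⟨K, hK⟩ := isCompact_Icc.exists_bound_of_continuousOn hf
  exact ⟨max K 0, le_max_right _ _, fun z hz => (hK z hz).trans (le_max_left _ _)⟩

lemma exists_pos_le_of_continuousOn {x y : ℝ} {f : ℝ → ℝ} (hxy : x ≤ y)
    (hf : ContinuousOn f (Icc x y)) (hpos : ∀ z ∈ Icc x y, 0 < f z) :
    ∃ c, 0 < c ∧ ∀ z ∈ Icc x y, c ≤ f z := by
  obtain ⟨z, hz, h⟩ := isCompact_Icc.exists_isMinOn (nonempty_Icc.2 hxy) hf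
  exact ⟨f z, hpos z hz, fun w hw => h hw⟩

namespace StationaryMetric

variable {M : StationaryMetric}

/-- The asymptotics `G_{nk}(r, r) = 1 / (2 √V₀) + O((n² + k²)^{-3/2})` of the radial Green's
functions of a stationary metric whose coordinate `∂_t` is timelike. -/
theorem green_asymptotics {U : ℝ → ℝ} {κ a b : ℝ} (hκ : 0 < κ) {G : ℤ → ℤ → ℝ → ℝ → ℂ}
    (hG : ∀ n k : ℤ, M.IsRadialGreen U (κ * n) k a b (G n k))
    (hN : ∀ r ∈ Ioo a b, 0 < M.lapse r) (hg : ∀ r ∈ Ioo a b, 0 < M.grr r)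
    (hh : ∀ r ∈ Ioo a b, 0 < M.gθθ r)
    (hNs : ContDiffOn ℝ 2 M.lapse (Ioo a b)) (hgs : ContDiffOn ℝ 2 M.grr (Ioo a b))
    (hhs : ContDiffOn ℝ 2 M.gθθ (Ioo a b)) (hωs : ContDiffOn ℝ 2 M.shift (Ioo a b))
    (htl : ∀ r ∈ Ioo a b, M.gθθ r * M.shift r ^ 2 < M.lapse r ^ 2)
    {kP : ℝ} (hPk : ∀ r ∈ Ioo a b, M.radialCoeff r ≤ kP * (r - a))
    (hRe : ∃ R : ℝ, ∀ n k : ℤ, R ≤ (n : ℝ) ^ 2 + k ^ 2 → ∀ r ∈ Ioo a b,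
      0 ≤ (M.modePotential κ n k r + M.backgroundPotential U r).re)
    (hU : ∃ K, ∀ r ∈ Ioo a b, |U r| ≤ K) {r₀ : ℝ} (hr₀ : r₀ ∈ Ioo a b) :
    ∃ C L : ℝ, 0 < C ∧ 1 ≤ L ∧ ∀ n k : ℤ, L ≤ √((n : ℝ) ^ 2 + k ^ 2) →
      ‖G n k r₀ r₀ - 1 / (2 * csqrt (M.modePotential κ n k r₀))‖
        ≤ C / √((n : ℝ) ^ 2 + k ^ 2) ^ 3 := by
  obtain ⟨R, hR⟩ := hRe
  obtain ⟨KU, hKU⟩ := hU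
  have hPpos : ∀ r ∈ Ioo a b, 0 < M.radialCoeff r := fun r hr =>
    radialCoeff_pos (hN r hr) (hg r hr) (hh r hr)
  have hPs : ContDiffOn ℝ 2 M.radialCoeff (Ioo a b) :=
    ((hNs.mul (hgs.sqrt fun r hr => (hg r hr).ne')).mul (hhs.sqrt fun r hr => (hh r hr).ne')).div
      hgs fun r hr => (hg r hr).ne'
  obtain ⟨δ, hδ, hI⟩ : ∃ δ, 0 < δ ∧ Icc (r₀ - δ) (r₀ + δ) ⊆ Ioo a b := by
    obtain ⟨δ, hδ, h⟩ := Metric.nhds_basis_closedBall.mem_iff.1 (isOpen_Ioo.mem_nhds hr₀)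
    exact ⟨δ, hδ, by rwa [← Real.closedBall_eq_Icc]⟩
  have hle : r₀ - δ ≤ r₀ + δ := by linarith
  set α : ℝ → ℝ := fun r => κ ^ 2 * M.gθθ r with hα
  set β : ℝ → ℝ := fun r => 2 * κ * M.gθθ r * M.shift r with hβ
  set η : ℝ → ℝ := fun r => M.lapse r ^ 2 - M.gθθ r * M.shift r ^ 2 with hη
  have hαs : ContDiffOn ℝ 2 α (Ioo a b) := contDiffOn_const.mul hhs
  have hβs : ContDiffOn ℝ 2 β (Ioo a b) := (contDiffOn_const.mul hhs).mul hωs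
  have hηs : ContDiffOn ℝ 2 η (Ioo a b) := (hNs.pow 2).sub (hhs.mul (hωs.pow 2))
  have hP0 : ∀ r ∈ Ioo a b, M.radialCoeff r ≠ 0 := fun r hr => (hPpos r hr).ne'
  obtain ⟨α₁, α₂, hα₁, hα₂, hα₁c, hα₂c⟩ := exists_slDeriv isOpen_Ioo hPs hP0 hαs
  obtain ⟨β₁, β₂, hβ₁, hβ₂, hβ₁c, hβ₂c⟩ := exists_slDeriv isOpen_Ioo hPs hP0 hβs
  obtain ⟨η₁, η₂, hη₁, hη₂, hη₁c, hη₂c⟩ := exists_slDeriv isOpen_Ioo hPs hP0 hηs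
  obtain ⟨Kα, hKα0, hKα⟩ := exists_bound_of_continuousOn (hαs.continuousOn.mono hI)
  obtain ⟨Kβ, hKβ0, hKβ⟩ := exists_bound_of_continuousOn (hβs.continuousOn.mono hI)
  obtain ⟨Kη, hKη0, hKη⟩ := exists_bound_of_continuousOn (hηs.continuousOn.mono hI)
  obtain ⟨Kα₁, hKα₁0, hKα₁⟩ := exists_bound_of_continuousOn (hα₁c.mono hI)
  obtain ⟨Kβ₁, hKβ₁0, hKβ₁⟩ := exists_bound_of_continuousOn (hβ₁c.mono hI)
  obtain ⟨Kη₁, hKη₁0, hKη₁⟩ := exists_bound_of_continuousOn (hη₁c.mono hI)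
  obtain ⟨Kα₂, hKα₂0, hKα₂⟩ := exists_bound_of_continuousOn (hα₂c.mono hI)
  obtain ⟨Kβ₂, hKβ₂0, hKβ₂⟩ := exists_bound_of_continuousOn (hβ₂c.mono hI)
  obtain ⟨Kη₂, hKη₂0, hKη₂⟩ := exists_bound_of_continuousOn (hη₂c.mono hI)
  obtain ⟨KS, hKS0, hKS⟩ := exists_bound_of_continuousOn
    (((hNs.pow 2).mul hhs).continuousOn.mono hI)
  obtain ⟨P₁, hP₁0, hP₁⟩ := exists_bound_of_continuousOn (hPs.continuousOn.mono hI)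
  obtain ⟨P₀, hP₀, hP₀le⟩ := exists_pos_le_of_continuousOn hle (hPs.continuousOn.mono hI)
    fun z hz => hPpos z (hI hz)
  obtain ⟨cα, hcα, hcαle⟩ := exists_pos_le_of_continuousOn hle (hαs.continuousOn.mono hI)
    fun z hz => mul_pos (by positivity) (hh z (hI hz))
  obtain ⟨cη, hcη, hcηle⟩ := exists_pos_le_of_continuousOn hle (hηs.continuousOn.mono hI)
    fun z hz => sub_pos.2 (htl z (hI hz))
  set K₀ := Kα + Kβ + Kη + (Kα₁ + Kβ₁ + Kη₁) + (Kα₂ + Kβ₂ + Kη₂) with hK₀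
  have hKU0 : 0 ≤ KU := (abs_nonneg _).trans (hKU r₀ hr₀)
  set K := 2 * K₀ + KS * KU + 1 with hK
  have hKpos : 0 < K := by positivity
  have hK0le : 2 * K₀ ≤ K := by have : 0 ≤ KS * KU := by positivity
                                linarith
  have hP₁pos : 0 < P₁ := hP₀.trans_le ((hP₀le r₀ ⟨by linarith, by linarith⟩).trans
    ((le_abs_self _).trans (hP₁ r₀ ⟨by linarith, by linarith⟩)))
  obtain ⟨C, L, hC, hL, H⟩ := norm_green_sub_le (min cα cη) K P₀ P₁ δ (lt_min hcα hcη) hKpos hP₀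
    hP₁pos hδ
  refine ⟨C, max L √|R|, hC, hL.trans (le_max_left _ _), ?_⟩
  intro n k hnk
  set l := √((n : ℝ) ^ 2 + k ^ 2) with hl
  have hlsq : l ^ 2 = (n : ℝ) ^ 2 + k ^ 2 := Real.sq_sqrt (by positivity)
  have hRle : R ≤ (n : ℝ) ^ 2 + k ^ 2 := by
    have h1 : |R| ≤ (n : ℝ) ^ 2 + k ^ 2 :=
      (Real.sqrt_le_sqrt_iff (by positivity)).1 ((le_max_right _ _).trans hnk)
    exact (le_abs_self R).trans h1
  obtain ⟨p, q, C', hp, hq, hpb, hqb, hW, hGpq⟩ := hG n k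
  have hp' := hp.isSLSolution hN hg hh
  have hq' := hq.isSLSolution hN hg hh
  have hVre := hR n k hRle
  have hpE : ∀ x ∈ Ioo a b, 0 ≤ inner ℝ (p x) ((M.radialCoeff x : ℂ) * deriv p x) :=
    fun x hx => hp'.inner_nonneg_of_bounded hPpos hVre hPk hpb hx
  have hqE : ∀ x ∈ Ioo a b, inner ℝ (q x) ((M.radialCoeff x : ℂ) * deriv q x) ≤ 0 :=
    fun x hx => hq'.inner_nonpos_of_tendsto_zero hPpos hVre hqb hx
  have hWr : ∀ x ∈ Ioo a b, C' * (p x * ((M.radialCoeff x : ℂ) * deriv q x)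
      - q x * ((M.radialCoeff x : ℂ) * deriv p x)) = -1 := fun x hx => by
    have h1 := hW x hx
    have h2 : (M.radialCoeff x : ℂ) ≠ 0 := by exact_mod_cast hP0 x hx
    change _ = -1 / (M.radialCoeff x : ℂ) at h1
    rw [eq_div_iff h2] at h1
    linear_combination h1
  have hp0 : ∀ x ∈ Ioo a b, p x ≠ 0 := fun x hx =>
    hp'.ne_zero_of_inner_nonneg hPpos hpE (fun y hy => by
      by_contra hc
      push Not at hc
      have := hWr y hy
      rw [hc.1, hc.2] at this
      norm_num at this) hx
  have hnegI : ∀ x ∈ Ioo (-b) (-a), -x ∈ Ioo a b := fun x hx =>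
    ⟨by linarith [hx.2], by linarith [hx.1]⟩
  have hq0 : ∀ x ∈ Ioo a b, q x ≠ 0 := fun x hx => by
    have := (hq'.reflect hnegI).ne_zero_of_inner_nonneg (fun y hy => hPpos _ (hnegI y hy))
      (fun y hy => by rw [inner_neg_right]; linarith [hqE _ (hnegI y hy)])
      (fun y hy => by
        by_contra hc
        push Not at hc
        have h2 := hWr _ (hnegI y hy)
        rw [hc.1, neg_eq_zero.1 hc.2] at h2
        norm_num at h2) (x₁ := -x) ⟨by linarith [hx.2], by linarith [hx.1]⟩
    rwa [neg_neg] at this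
  have hlL : L ≤ l := (le_max_left _ _).trans hnk
  have hl1 : 1 ≤ l := hL.trans hlL
  have hV₀ : M.modePotential κ n k = fun r => modeForm n k (α r) (β r) (η r) := by
    funext r; rw [modePotential_eq]; rfl
  have hdata : WKBData (min cα cη) K P₀ P₁ l (Icc (r₀ - δ) (r₀ + δ)) M.radialCoeff
      (M.modePotential κ n k) (fun r => modeForm n k (α₁ r) (β₁ r) (η₁ r))
      (fun r => modeForm n k (α₂ r) (β₂ r) (η₂ r)) (M.backgroundPotential U) := by
    refine ⟨hP₀le, fun x hx => (le_abs_self _).trans (hP₁ x hx), ?_, ?_, ?_, ?_, ?_, ?_, ?_⟩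
    · intro x hx
      rw [hV₀]
      exact hasDerivAt_modeForm n k (hα₁ x (hI hx)) (hβ₁ x (hI hx)) (hη₁ x (hI hx))
    · intro x hx
      exact hasDerivAt_modeForm n k (hα₂ x (hI hx)) (hβ₂ x (hI hx)) (hη₂ x (hI hx))
    · intro x hx
      rw [modePotential_re, hlsq, mul_add]
      have h1 := hcαle x hx
      have h2 := hcηle x hx
      simp only [hα, hη] at h1 h2
      gcongr
      · exact (min_le_left _ _).trans h1
      · exact (min_le_right _ _).trans h2
    · intro x hx
      rw [hV₀]
      refine (norm_modeForm_le n k (K := K₀) ?_ ?_ ?_).trans ?_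
      · linarith [hKα x hx]
      · linarith [hKβ x hx]
      · linarith [hKη x hx]
      · gcongr
    · intro x hx
      refine (norm_modeForm_le n k (K := K₀) ?_ ?_ ?_).trans ?_
      · linarith [hKα₁ x hx]
      · linarith [hKβ₁ x hx]
      · linarith [hKη₁ x hx]
      · gcongr
    · intro x hx
      refine (norm_modeForm_le n k (K := K₀) ?_ ?_ ?_).trans ?_
      · linarith [hKα₂ x hx]
      · linarith [hKβ₂ x hx]
      · linarith [hKη₂ x hx]
      · gcongr
    · intro x hx
      rw [backgroundPotential, Complex.norm_real, Real.norm_eq_abs, abs_mul]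
      have h1 : |M.lapse x ^ 2 * M.gθθ x| ≤ KS := hKS x hx
      have h2 := hKU x (hI hx)
      calc _ ≤ KS * KU := by gcongr
        _ ≤ K := by have : 0 ≤ K₀ := by positivity
                    linarith
  have hfin := H l hlL r₀ _ _ _ _ _ p _ q _ C' hdata (hp'.mono hI) (hq'.mono hI)
    (fun x hx => hp0 x (hI hx)) (fun x hx => hq0 x (hI hx)) (fun x hx => hpE x (hI hx))
    (fun x hx => hqE x (hI hx)) (hWr r₀ hr₀)
  rw [hGpq r₀ hr₀ r₀ hr₀, min_self, max_self]
  exact hfin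

end StationaryMetric

/-! ### The scalar curvature at a horizon -/

namespace StationaryMetric

/-- Smooth coefficients of a metric with `A = N²` and `f = √g_rr N` on an open set, together with
their derivatives. In terms of `A` and `f` the scalar curvature is regular at a horizon, where `A`
vanishes and `g_rr = f² / A` diverges. -/
structure HorizonCoeffs (M : StationaryMetric) (s : Set ℝ)
    (A f A₁ A₂ f₁ h₁ h₂ ω₁ ω₂ : ℝ → ℝ) : Prop where
  isOpen : IsOpen s
  lapse_sq : ∀ x ∈ s, M.lapse x ^ 2 = A x
  grr_eq : ∀ x ∈ s, M.grr x = f x ^ 2 / A x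
  A_ne : ∀ x ∈ s, A x ≠ 0
  f_ne : ∀ x ∈ s, f x ≠ 0
  h_ne : ∀ x ∈ s, M.gθθ x ≠ 0
  hA : ∀ x ∈ s, HasDerivAt A (A₁ x) x
  hA₁ : ∀ x ∈ s, HasDerivAt A₁ (A₂ x) x
  hf : ∀ x ∈ s, HasDerivAt f (f₁ x) x
  hh : ∀ x ∈ s, HasDerivAt M.gθθ (h₁ x) x
  hh₁ : ∀ x ∈ s, HasDerivAt h₁ (h₂ x) x
  hω : ∀ x ∈ s, HasDerivAt M.shift (ω₁ x) x
  hω₁ : ∀ x ∈ s, HasDerivAt ω₁ (ω₂ x) x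

namespace HorizonCoeffs

variable {M : StationaryMetric} {s : Set ℝ} {A f A₁ A₂ f₁ h₁ h₂ ω₁ ω₂ : ℝ → ℝ}

lemma metric_inv (H : HorizonCoeffs M s A f A₁ A₂ f₁ h₁ h₂ ω₁ ω₂) {x : ℝ} (hx : x ∈ s) :
    (M.metric x)⁻¹ = !![-1 / A x, 0, M.shift x / A x; 0, A x / f x ^ 2, 0;
      M.shift x / A x, 0, 1 / M.gθθ x - M.shift x ^ 2 / A x] := by
  have h1 := H.A_ne x hx
  have h2 := H.f_ne x hx
  have h3 := H.h_ne x hx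
  apply Matrix.inv_eq_right_inv
  rw [metric, H.lapse_sq x hx, H.grr_eq x hx]
  ext i j
  fin_cases i <;> fin_cases j <;> simp [Matrix.mul_apply, Fin.sum_univ_three] <;>
    field_simp <;> ring

lemma deriv_metric (H : HorizonCoeffs M s A f A₁ A₂ f₁ h₁ h₂ ω₁ ω₂) {x : ℝ} (hx : x ∈ s)
    (i j : Fin 3) : deriv (fun y => M.metric y i j) x =
      (!![-A₁ x + h₁ x * M.shift x ^ 2 + 2 * M.gθθ x * M.shift x * ω₁ x, 0,
          h₁ x * M.shift x + M.gθθ x * ω₁ x;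
        0, (2 * f x * f₁ x * A x - f x ^ 2 * A₁ x) / A x ^ 2, 0;
        h₁ x * M.shift x + M.gθθ x * ω₁ x, 0, h₁ x] : Matrix (Fin 3) (Fin 3) ℝ) i j := by
  have hs := H.isOpen.mem_nhds hx
  have h00 : HasDerivAt (fun y => -(M.lapse y) ^ 2 + M.gθθ y * (M.shift y) ^ 2)
      (-A₁ x + h₁ x * M.shift x ^ 2 + 2 * M.gθθ x * M.shift x * ω₁ x) x := by
    have e : HasDerivAt (fun y => -A y + M.gθθ y * (M.shift y) ^ 2)
      (-A₁ x + h₁ x * M.shift x ^ 2 + 2 * M.gθθ x * M.shift x * ω₁ x) x := by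
      refine ((H.hA x hx).neg.add ((H.hh x hx).mul ((H.hω x hx).pow 2))).congr_deriv ?_
      simp; ring
    refine e.congr_of_eventuallyEq ?_
    filter_upwards [hs] with y hy
    rw [H.lapse_sq y hy]
  have h02 : HasDerivAt (fun y => M.gθθ y * M.shift y) (h₁ x * M.shift x + M.gθθ x * ω₁ x) x :=
    (H.hh x hx).mul (H.hω x hx)
  have h11 : HasDerivAt M.grr ((2 * f x * f₁ x * A x - f x ^ 2 * A₁ x) / A x ^ 2) x := by
    have e := ((H.hf x hx).pow 2).div (H.hA x hx) (H.A_ne x hx)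
    refine (e.congr_of_eventuallyEq ?_).congr_deriv ?_
    · filter_upwards [hs] with y hy
      rw [H.grr_eq y hy]; rfl
    · simp
  fin_cases i <;> fin_cases j <;> simp [metric]
  · exact h00.deriv
  · exact h02.deriv
  · exact h11.deriv
  · exact h02.deriv
  · exact (H.hh x hx).deriv

lemma christoffel_zero (H : HorizonCoeffs M s A f A₁ A₂ f₁ h₁ h₂ ω₁ ω₂) {x : ℝ} (hx : x ∈ s)
    (μ ν : Fin 3) : M.christoffel 0 μ ν x =
      (!![0, (A₁ x - M.gθθ x * M.shift x * ω₁ x) / (2 * A x), 0;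
        (A₁ x - M.gθθ x * M.shift x * ω₁ x) / (2 * A x), 0, -(M.gθθ x * ω₁ x) / (2 * A x);
        0, -(M.gθθ x * ω₁ x) / (2 * A x), 0] : Matrix (Fin 3) (Fin 3) ℝ) μ ν := by
  have h1 := H.A_ne x hx
  simp only [christoffel, H.metric_inv hx, coordDeriv, H.deriv_metric hx, Fin.sum_univ_three]
  fin_cases μ <;> fin_cases ν <;> simp <;> field_simp <;> ring

lemma christoffel_one (H : HorizonCoeffs M s A f A₁ A₂ f₁ h₁ h₂ ω₁ ω₂) {x : ℝ} (hx : x ∈ s)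
    (μ ν : Fin 3) : M.christoffel 1 μ ν x =
      (!![A x * (A₁ x - h₁ x * M.shift x ^ 2 - 2 * M.gθθ x * M.shift x * ω₁ x) / (2 * f x ^ 2), 0,
          -(A x * (h₁ x * M.shift x + M.gθθ x * ω₁ x)) / (2 * f x ^ 2);
        0, f₁ x / f x - A₁ x / (2 * A x), 0;
        -(A x * (h₁ x * M.shift x + M.gθθ x * ω₁ x)) / (2 * f x ^ 2), 0,
          -(A x * h₁ x) / (2 * f x ^ 2)] : Matrix (Fin 3) (Fin 3) ℝ) μ ν := by
  have h1 := H.A_ne x hx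
  have h2 := H.f_ne x hx
  simp only [christoffel, H.metric_inv hx, coordDeriv, H.deriv_metric hx, Fin.sum_univ_three]
  fin_cases μ <;> fin_cases ν <;> simp <;> field_simp <;> ring

lemma christoffel_two (H : HorizonCoeffs M s A f A₁ A₂ f₁ h₁ h₂ ω₁ ω₂) {x : ℝ} (hx : x ∈ s)
    (μ ν : Fin 3) : M.christoffel 2 μ ν x =
      (!![0, (M.shift x * h₁ x / M.gθθ x + ω₁ x) / 2
            - M.shift x * (A₁ x - M.gθθ x * M.shift x * ω₁ x) / (2 * A x), 0;
        (M.shift x * h₁ x / M.gθθ x + ω₁ x) / 2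
            - M.shift x * (A₁ x - M.gθθ x * M.shift x * ω₁ x) / (2 * A x), 0,
          h₁ x / (2 * M.gθθ x) + M.shift x * M.gθθ x * ω₁ x / (2 * A x);
        0, h₁ x / (2 * M.gθθ x) + M.shift x * M.gθθ x * ω₁ x / (2 * A x), 0] :
          Matrix (Fin 3) (Fin 3) ℝ) μ ν := by
  have h1 := H.A_ne x hx
  have h3 := H.h_ne x hx
  simp only [christoffel, H.metric_inv hx, coordDeriv, H.deriv_metric hx, Fin.sum_univ_three]
  fin_cases μ <;> fin_cases ν <;> simp <;> field_simp <;> ring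

variable {x : ℝ}

lemma deriv_christoffel_one_zero_zero (H : HorizonCoeffs M s A f A₁ A₂ f₁ h₁ h₂ ω₁ ω₂)
    (hx : x ∈ s) : deriv (M.christoffel 1 0 0) x =
      ((A₁ x * (A₁ x - h₁ x * M.shift x ^ 2 - 2 * M.gθθ x * M.shift x * ω₁ x)
        + A x * (A₂ x - h₂ x * M.shift x ^ 2 - 4 * h₁ x * M.shift x * ω₁ x
          - 2 * M.gθθ x * ω₁ x ^ 2 - 2 * M.gθθ x * M.shift x * ω₂ x)) * f x
        - 2 * A x * (A₁ x - h₁ x * M.shift x ^ 2 - 2 * M.gθθ x * M.shift x * ω₁ x) * f₁ x)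
        / (2 * f x ^ 3) := by
  have hf0 := H.f_ne x hx
  have e := ((H.hA x hx).mul (((H.hA₁ x hx).sub ((H.hh₁ x hx).mul ((H.hω x hx).pow 2))).sub
    ((((H.hh x hx).const_mul 2).mul (H.hω x hx)).mul (H.hω₁ x hx)))).div
    (((H.hf x hx).pow 2).const_mul 2) (by simpa using hf0)
  refine ((e.congr_of_eventuallyEq ?_).congr_deriv ?_).deriv
  · filter_upwards [H.isOpen.mem_nhds hx] with y hy
    rw [H.christoffel_one hy]; simp
  · simp
    field_simp
    ring

lemma deriv_christoffel_one_zero_two (H : HorizonCoeffs M s A f A₁ A₂ f₁ h₁ h₂ ω₁ ω₂)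
    (hx : x ∈ s) : deriv (M.christoffel 1 0 2) x =
      -((A₁ x * (h₁ x * M.shift x + M.gθθ x * ω₁ x)
        + A x * (h₂ x * M.shift x + 2 * h₁ x * ω₁ x + M.gθθ x * ω₂ x)) * f x
        - 2 * A x * (h₁ x * M.shift x + M.gθθ x * ω₁ x) * f₁ x) / (2 * f x ^ 3) := by
  have hf0 := H.f_ne x hx
  have e := ((H.hA x hx).mul (((H.hh₁ x hx).mul (H.hω x hx)).add
    ((H.hh x hx).mul (H.hω₁ x hx)))).neg.div
    (((H.hf x hx).pow 2).const_mul 2) (by simpa using hf0)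
  refine ((e.congr_of_eventuallyEq ?_).congr_deriv ?_).deriv
  · filter_upwards [H.isOpen.mem_nhds hx] with y hy
    rw [H.christoffel_one hy]; simp
  · simp
    field_simp
    ring

lemma deriv_christoffel_one_two_two (H : HorizonCoeffs M s A f A₁ A₂ f₁ h₁ h₂ ω₁ ω₂)
    (hx : x ∈ s) : deriv (M.christoffel 1 2 2) x =
      -((A₁ x * h₁ x + A x * h₂ x) * f x - 2 * A x * h₁ x * f₁ x) / (2 * f x ^ 3) := by
  have hf0 := H.f_ne x hx
  have e := ((H.hA x hx).mul (H.hh₁ x hx)).neg.div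
    (((H.hf x hx).pow 2).const_mul 2) (by simpa using hf0)
  refine ((e.congr_of_eventuallyEq ?_).congr_deriv ?_).deriv
  · filter_upwards [H.isOpen.mem_nhds hx] with y hy
    rw [H.christoffel_one hy]; simp
  · simp
    field_simp
    ring

lemma deriv_christoffel_zero_zero_one (H : HorizonCoeffs M s A f A₁ A₂ f₁ h₁ h₂ ω₁ ω₂)
    (hx : x ∈ s) : deriv (M.christoffel 0 0 1) x =
      ((A₂ x - h₁ x * M.shift x * ω₁ x - M.gθθ x * ω₁ x ^ 2 - M.gθθ x * M.shift x * ω₂ x) * A x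
        - (A₁ x - M.gθθ x * M.shift x * ω₁ x) * A₁ x) / (2 * A x ^ 2) := by
  have hA0 := H.A_ne x hx
  have e := ((H.hA₁ x hx).sub (((H.hh x hx).mul (H.hω x hx)).mul (H.hω₁ x hx))).div
    ((H.hA x hx).const_mul 2) (by simpa using hA0)
  refine ((e.congr_of_eventuallyEq ?_).congr_deriv ?_).deriv
  · filter_upwards [H.isOpen.mem_nhds hx] with y hy
    rw [H.christoffel_zero hy]; simp
  · simp
    field_simp
    ring

lemma deriv_christoffel_two_two_one (H : HorizonCoeffs M s A f A₁ A₂ f₁ h₁ h₂ ω₁ ω₂)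
    (hx : x ∈ s) : deriv (M.christoffel 2 2 1) x =
      (h₂ x * M.gθθ x - h₁ x ^ 2) / (2 * M.gθθ x ^ 2)
        + ((ω₁ x * M.gθθ x * ω₁ x + M.shift x * h₁ x * ω₁ x + M.shift x * M.gθθ x * ω₂ x) * A x
          - M.shift x * M.gθθ x * ω₁ x * A₁ x) / (2 * A x ^ 2) := by
  have hA0 := H.A_ne x hx
  have hh0 := H.h_ne x hx
  have e := ((H.hh₁ x hx).div ((H.hh x hx).const_mul 2) (by simpa using hh0)).add
    ((((H.hω x hx).mul (H.hh x hx)).mul (H.hω₁ x hx)).div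
    ((H.hA x hx).const_mul 2) (by simpa using hA0))
  refine ((e.congr_of_eventuallyEq ?_).congr_deriv ?_).deriv
  · filter_upwards [H.isOpen.mem_nhds hx] with y hy
    rw [H.christoffel_two hy]; simp
  · simp
    field_simp

/-- The scalar curvature in terms of coefficients that are regular at the horizon. -/
theorem scalarCurvature_eq (H : HorizonCoeffs M s A f A₁ A₂ f₁ h₁ h₂ ω₁ ω₂) (hx : x ∈ s) :
    M.scalarCurvature x = -A₂ x / f x ^ 2 + A₁ x * f₁ x / f x ^ 3
      - A x / f x ^ 2 * (h₂ x / M.gθθ x - h₁ x ^ 2 / (2 * M.gθθ x ^ 2))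
      + A x * f₁ x * h₁ x / (f x ^ 3 * M.gθθ x) - A₁ x * h₁ x / (f x ^ 2 * M.gθθ x)
      + M.gθθ x * ω₁ x ^ 2 / (2 * f x ^ 2) := by
  have hA0 := H.A_ne x hx
  have hf0 := H.f_ne x hx
  have hh0 := H.h_ne x hx
  simp only [scalarCurvature, ricci, coordDeriv, Fin.sum_univ_three, H.metric_inv hx,
    H.christoffel_zero hx, H.christoffel_one hx, H.christoffel_two hx]
  have s1 : M.christoffel 1 2 0 = M.christoffel 1 0 2 := by
    funext y; simp only [christoffel, metric, Fin.sum_univ_three, coordDeriv]; simp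
  simp
  rw [s1, H.deriv_christoffel_one_zero_zero hx, H.deriv_christoffel_one_zero_two hx,
    H.deriv_christoffel_one_two_two hx, H.deriv_christoffel_zero_zero_one hx,
    H.deriv_christoffel_two_two_one hx]
  field_simp
  ring

end HorizonCoeffs
end StationaryMetric

/-! ### The radial equation near the horizon of the black hole -/

/-- The first two derivatives of a function smooth on `[a, b]` extend continuously to `[a, b]`. -/
lemma ContDiffOn.exists_hasDerivAt_Icc {f : ℝ → ℝ} {a b : ℝ} (hab : a < b)
    (hf : ContDiffOn ℝ ∞ f (Icc a b)) : ∃ f₁ f₂ : ℝ → ℝ, ContinuousOn f₁ (Icc a b) ∧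
      ContinuousOn f₂ (Icc a b) ∧ (∀ x ∈ Ioo a b, HasDerivAt f (f₁ x) x) ∧
      ∀ x ∈ Ioo a b, HasDerivAt f₁ (f₂ x) x := by
  have hu := uniqueDiffOn_Icc hab
  have h1 : ContDiffOn ℝ ∞ (derivWithin f (Icc a b)) (Icc a b) := hf.derivWithin hu (by simp)
  have h2 : ContDiffOn ℝ ∞ (derivWithin (derivWithin f (Icc a b)) (Icc a b)) (Icc a b) :=
    h1.derivWithin hu (by simp)
  have key : ∀ g : ℝ → ℝ, ContDiffOn ℝ ∞ g (Icc a b) → ∀ x ∈ Ioo a b,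
      HasDerivAt g (derivWithin g (Icc a b) x) x := fun g hg x hx =>
    ((hg.differentiableOn (by simp) x (Ioo_subset_Icc_self hx)).hasDerivWithinAt).hasDerivAt
      (Icc_mem_nhds hx.1 hx.2)
  exact ⟨_, _, h1.continuousOn, h2.continuousOn, key _ hf, key _ h1⟩

/-- A function continuous on `[a, b]` that vanishes at `a` and has a bounded derivative. -/
lemma abs_le_mul_sub_of_hasDerivAt {f f₁ : ℝ → ℝ} {a b K : ℝ} (hf : ContinuousOn f (Icc a b))
    (hd : ∀ x ∈ Ioo a b, HasDerivAt f (f₁ x) x) (hK : ∀ x ∈ Icc a b, |f₁ x| ≤ K) (ha : f a = 0)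
    {x : ℝ} (hx : x ∈ Ioo a b) : |f x| ≤ K * (x - a) := by
  obtain ⟨y, hy, h⟩ := exists_hasDerivAt_eq_slope f f₁ hx.1
    (hf.mono (Icc_subset_Icc_right hx.2.le)) (fun y hy => hd y ⟨hy.1, hy.2.trans hx.2⟩)
  have hxa : 0 < x - a := sub_pos.2 hx.1
  rw [ha, sub_zero, eq_div_iff hxa.ne'] at h
  rw [← h, abs_mul, abs_of_pos hxa]
  exact mul_le_mul_of_nonneg_right (hK y ⟨hy.1.le, (hy.2.trans hx.2).le⟩) hxa.le

namespace RotatingBlackHole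

open StationaryMetric

variable (B : RotatingBlackHole)

lemma grr_eq {f : ℝ → ℝ} (hf : ∀ r ∈ Ioc B.rH B.rM, √(B.grr r) * B.lapse r = f r) :
    ∀ r ∈ Ioc B.rH B.rM, B.grr r = f r ^ 2 / B.lapse r ^ 2 := fun r hr => by
  have h1 := (B.lapse_pos r hr).ne'
  rw [← hf r hr, mul_pow, Real.sq_sqrt (B.grr_pos r hr).le]
  field_simp

/-- The scalar curvature is bounded between the horizon and the mirror. -/
lemma exists_bound_scalarCurvature :
    ∃ K, ∀ r ∈ Ioo B.rH B.rM, |B.corotating.scalarCurvature r| ≤ K := by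
  obtain ⟨f, hfs, hfpos, hf⟩ := B.contDiffOn_sqrt_grr_mul_lapse
  obtain ⟨A₁, A₂, hA₁c, hA₂c, hA₁, hA₂⟩ := B.contDiffOn_lapse_sq.exists_hasDerivAt_Icc B.rH_lt_rM
  obtain ⟨f₁, -, hf₁c, -, hf₁, -⟩ := hfs.exists_hasDerivAt_Icc B.rH_lt_rM
  obtain ⟨h₁, h₂, hh₁c, hh₂c, hh₁, hh₂⟩ := B.contDiffOn_gθθ.exists_hasDerivAt_Icc B.rH_lt_rM
  obtain ⟨ω₁, ω₂, hω₁c, hω₂c, hω₁, hω₂⟩ := B.contDiffOn_shift.exists_hasDerivAt_Icc B.rH_lt_rM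
  have H : HorizonCoeffs B.corotating (Ioo B.rH B.rM) (fun r => B.lapse r ^ 2) f A₁ A₂ f₁ h₁ h₂
      ω₁ ω₂ :=
    { isOpen := isOpen_Ioo
      lapse_sq := fun _ _ => rfl
      grr_eq := fun x hx => B.grr_eq hf x (Ioo_subset_Ioc_self hx)
      A_ne := fun x hx => (pow_pos (B.lapse_pos x (Ioo_subset_Ioc_self hx)) 2).ne'
      f_ne := fun x hx => (hfpos x (Ioo_subset_Icc_self hx)).ne'
      h_ne := fun x hx => (B.gθθ_pos x (Ioo_subset_Icc_self hx)).ne'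
      hA := hA₁
      hA₁ := hA₂
      hf := hf₁
      hh := hh₁
      hh₁ := hh₂
      hω := fun x hx => (hω₁ x hx).add_const _
      hω₁ := hω₂ }
  have hfc := hfs.continuousOn
  have hAc := B.contDiffOn_lapse_sq.continuousOn
  have hhc := B.contDiffOn_gθθ.continuousOn
  have hf0 : ∀ r ∈ Icc B.rH B.rM, f r ≠ 0 := fun r hr => (hfpos r hr).ne'
  have hh0 : ∀ r ∈ Icc B.rH B.rM, B.gθθ r ≠ 0 := fun r hr => (B.gθθ_pos r hr).ne'
  have hc : ContinuousOn (fun x => -A₂ x / f x ^ 2 + A₁ x * f₁ x / f x ^ 3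
      - B.lapse x ^ 2 / f x ^ 2 * (h₂ x / B.gθθ x - h₁ x ^ 2 / (2 * B.gθθ x ^ 2))
      + B.lapse x ^ 2 * f₁ x * h₁ x / (f x ^ 3 * B.gθθ x) - A₁ x * h₁ x / (f x ^ 2 * B.gθθ x)
      + B.gθθ x * ω₁ x ^ 2 / (2 * f x ^ 2)) (Icc B.rH B.rM) := by
    have e2 : ∀ r ∈ Icc B.rH B.rM, f r ^ 2 ≠ 0 := fun r hr => pow_ne_zero _ (hf0 r hr)
    have e3 : ∀ r ∈ Icc B.rH B.rM, f r ^ 3 ≠ 0 := fun r hr => pow_ne_zero _ (hf0 r hr)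
    have e4 : ∀ r ∈ Icc B.rH B.rM, 2 * B.gθθ r ^ 2 ≠ 0 := fun r hr =>
      mul_ne_zero two_ne_zero (pow_ne_zero _ (hh0 r hr))
    have e5 : ∀ r ∈ Icc B.rH B.rM, f r ^ 3 * B.gθθ r ≠ 0 := fun r hr =>
      mul_ne_zero (e3 r hr) (hh0 r hr)
    have e6 : ∀ r ∈ Icc B.rH B.rM, f r ^ 2 * B.gθθ r ≠ 0 := fun r hr =>
      mul_ne_zero (e2 r hr) (hh0 r hr)
    have e7 : ∀ r ∈ Icc B.rH B.rM, 2 * f r ^ 2 ≠ 0 := fun r hr =>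
      mul_ne_zero two_ne_zero (e2 r hr)
    exact (((((hA₂c.neg.div (hfc.pow 2) e2).add ((hA₁c.mul hf₁c).div (hfc.pow 3) e3)).sub
      ((hAc.div (hfc.pow 2) e2).mul ((hh₂c.div hhc hh0).sub
        ((hh₁c.pow 2).div (continuousOn_const.mul (hhc.pow 2)) e4)))).add
      (((hAc.mul hf₁c).mul hh₁c).div ((hfc.pow 3).mul hhc) e5)).sub
      ((hA₁c.mul hh₁c).div ((hfc.pow 2).mul hhc) e6)).add
      ((hhc.mul (hω₁c.pow 2)).div (continuousOn_const.mul (hfc.pow 2)) e7)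
  obtain ⟨K, -, hK⟩ := exists_bound_of_continuousOn hc
  refine ⟨K, fun r hr => ?_⟩
  rw [H.scalarCurvature_eq hr]
  exact hK r (Ioo_subset_Icc_self hr)

/-- The surface gravity gives `N²` a simple zero at the horizon. -/
lemma exists_mul_sub_le_lapse_sq :
    ∃ c > 0, ∃ r₁ ∈ Ioo B.rH B.rM, ∀ r ∈ Ioc B.rH r₁, c * (r - B.rH) ≤ B.lapse r ^ 2 := by
  obtain ⟨f, hfs, hfpos, hf⟩ := B.contDiffOn_sqrt_grr_mul_lapse
  obtain ⟨A₁, A₂, hA₁c, -, hA₁, -⟩ := B.contDiffOn_lapse_sq.exists_hasDerivAt_Icc B.rH_lt_rM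
  have hmem : B.rH ∈ Icc B.rH B.rM := left_mem_Icc.2 B.rH_lt_rM.le
  have hA₁eq : ∀ r ∈ Ioo B.rH B.rM, A₁ r = 2 * f r * (deriv B.lapse r / √(B.grr r)) :=
    fun r hr => by
    have hN := B.lapse_pos r (Ioo_subset_Ioc_self hr)
    have hg := Real.sqrt_pos.2 (B.grr_pos r (Ioo_subset_Ioc_self hr))
    have hd : DifferentiableAt ℝ B.lapse r := by
      have h1 : DifferentiableAt ℝ (fun r => √(B.lapse r ^ 2)) r :=
        (hA₁ r hr).differentiableAt.sqrt (pow_pos hN 2).ne'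
      refine h1.congr_of_eventuallyEq ?_
      filter_upwards [isOpen_Ioo.mem_nhds hr] with y hy
      rw [Real.sqrt_sq (B.lapse_pos y (Ioo_subset_Ioc_self hy)).le]
    have h2 := (hA₁ r hr).unique (hd.hasDerivAt.pow 2)
    rw [h2, ← hf r (Ioo_subset_Ioc_self hr)]
    field_simp
    simp
    ring
  have hIoo : ∀ᶠ r in 𝓝[>] B.rH, r ∈ Ioo B.rH B.rM := Ioo_mem_nhdsGT B.rH_lt_rM
  have hle : 𝓝[>] B.rH ≤ 𝓝[Icc B.rH B.rM] B.rH := by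
    rw [← nhdsWithin_Ioo_eq_nhdsGT B.rH_lt_rM]
    exact nhdsWithin_mono _ Ioo_subset_Icc_self
  have hlim : Tendsto A₁ (𝓝[>] B.rH) (𝓝 (2 * f B.rH * B.κ)) := by
    have h1 : Tendsto f (𝓝[>] B.rH) (𝓝 (f B.rH)) := (hfs.continuousOn _ hmem).mono_left hle
    refine ((h1.const_mul 2).mul B.tendsto_surfaceGravity).congr' ?_
    filter_upwards [hIoo] with r hr
    rw [hA₁eq r hr]
  set c := f B.rH * B.κ with hc
  have hcpos : 0 < c := mul_pos (hfpos _ hmem) B.κ_pos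
  have hev : ∀ᶠ r in 𝓝[>] B.rH, c ≤ A₁ r := by
    have : c < 2 * f B.rH * B.κ := by rw [mul_assoc, ← hc]; linarith
    exact (hlim.eventually_const_lt this).mono fun _ h => h.le
  obtain ⟨r₂, hr₂, hsub⟩ := (mem_nhdsGT_iff_exists_Ioo_subset).1 (hev.and hIoo)
  obtain ⟨r₁, hr₁⟩ := exists_between (show B.rH < r₂ from hr₂)
  have hr₁' := hsub hr₁
  refine ⟨c, hcpos, r₁, hr₁'.2, fun r hr => ?_⟩
  obtain ⟨y, hy, h⟩ := exists_hasDerivAt_eq_slope (fun r => B.lapse r ^ 2) A₁ hr.1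
    (B.contDiffOn_lapse_sq.continuousOn.mono
      (Icc_subset_Icc_right (hr.2.trans hr₁'.2.2.le)))
    (fun y hy => hA₁ y ⟨hy.1, (hy.2.trans_le hr.2).trans hr₁'.2.2⟩)
  have hxa : 0 < r - B.rH := sub_pos.2 hr.1
  simp only [B.lapse_horizon] at h
  rw [eq_div_iff hxa.ne'] at h
  have h3 : c ≤ A₁ y := (hsub ⟨hy.1, (hy.2.trans_le hr.2).trans hr₁.2⟩).1
  nlinarith

/-- The horizon generator is timelike uniformly relative to `N²`: at the horizon
`g_θθ (N^θ + Ω_H)²` vanishes to second order, but `N²` only to first order. -/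
lemma exists_mul_lapse_sq_le : ∃ c > 0, ∀ r ∈ Ioo B.rH B.rM,
    c * B.lapse r ^ 2 ≤ B.lapse r ^ 2 - B.gθθ r * (B.shift r + B.ΩH) ^ 2 := by
  obtain ⟨c, hc, r₁, hr₁, hcle⟩ := B.exists_mul_sub_le_lapse_sq
  obtain ⟨ω₁, -, hω₁c, -, hω₁, -⟩ := B.contDiffOn_shift.exists_hasDerivAt_Icc B.rH_lt_rM
  obtain ⟨Kω, hKω0, hKω⟩ := exists_bound_of_continuousOn hω₁c
  obtain ⟨Kh, hKh0, hKh⟩ := exists_bound_of_continuousOn B.contDiffOn_gθθ.continuousOn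
  obtain ⟨KA, hKA0, hKA⟩ := exists_bound_of_continuousOn B.contDiffOn_lapse_sq.continuousOn
  have hω : ∀ r ∈ Ioo B.rH B.rM, |B.shift r + B.ΩH| ≤ Kω * (r - B.rH) := fun r hr =>
    abs_le_mul_sub_of_hasDerivAt (f := fun r => B.shift r + B.ΩH)
      (B.contDiffOn_shift.continuousOn.add continuousOn_const)
      (fun x hx => (hω₁ x hx).add_const _) hKω B.generator_null hr
  -- up to this radius the ratio of the two is at most `1 / 2`
  set δ := c / (2 * (Kh * Kω ^ 2 + 1)) with hδ
  have hδpos : 0 < δ := by positivity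
  set r₂ := min r₁ (B.rH + δ) with hr₂
  have hr₂H : B.rH < r₂ := lt_min hr₁.1 (by linarith)
  have hr₂M : r₂ < B.rM := (min_le_left _ _).trans_lt hr₁.2
  have hcont : ContinuousOn (fun r => B.lapse r ^ 2 - B.gθθ r * (B.shift r + B.ΩH) ^ 2)
      (Icc r₂ B.rM) :=
    (B.contDiffOn_lapse_sq.continuousOn.sub (B.contDiffOn_gθθ.continuousOn.mul
      ((B.contDiffOn_shift.continuousOn.add continuousOn_const).pow 2))).mono
      (Icc_subset_Icc_left hr₂H.le)
  obtain ⟨c₂, hc₂, hc₂le⟩ := exists_pos_le_of_continuousOn hr₂M.le hcont fun r hr =>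
    sub_pos.2 (B.generator_timelike r ⟨hr₂H.trans_le hr.1, hr.2⟩)
  refine ⟨min (1 / 2) (c₂ / (KA + 1)), lt_min (by norm_num) (by positivity), fun r hr => ?_⟩
  rcases le_total r r₂ with h | h
  · have h1 := hcle r ⟨hr.1, h.trans (min_le_left _ _)⟩
    have h2 := hω r hr
    have h3 : B.gθθ r ≤ Kh := (le_abs_self _).trans (hKh r (Ioo_subset_Icc_self hr))
    have h4 : r - B.rH ≤ δ := by have := h.trans (min_le_right _ _); linarith
    have hxa : 0 < r - B.rH := sub_pos.2 hr.1
    have h5 : (B.shift r + B.ΩH) ^ 2 ≤ (Kω * (r - B.rH)) ^ 2 := by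
      rw [← sq_abs (B.shift r + B.ΩH)]; gcongr
    have h6 : B.gθθ r * (B.shift r + B.ΩH) ^ 2 ≤ c / 2 * (r - B.rH) := by
      calc _ ≤ Kh * (Kω * (r - B.rH)) ^ 2 := by gcongr
        _ = Kh * Kω ^ 2 * (r - B.rH) * (r - B.rH) := by ring
        _ ≤ (Kh * Kω ^ 2 + 1) * δ * (r - B.rH) := by gcongr; linarith
        _ = _ := by rw [hδ]; field_simp
    have h7 : min (1 / 2) (c₂ / (KA + 1)) * B.lapse r ^ 2 ≤ 1 / 2 * B.lapse r ^ 2 := by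
      gcongr; exact min_le_left _ _
    linarith
  · have h1 := hc₂le r ⟨h, hr.2.le⟩
    have h2 : B.lapse r ^ 2 ≤ KA := (le_abs_self _).trans (hKA r (Ioo_subset_Icc_self hr))
    calc _ ≤ c₂ / (KA + 1) * (KA + 1) := by
          gcongr
          · exact min_le_right _ _
          · linarith
      _ = c₂ := by field_simp
      _ ≤ _ := h1

lemma exists_radialCoeff_le :
    ∃ k, ∀ r ∈ Ioo B.rH B.rM, B.corotating.radialCoeff r ≤ k * (r - B.rH) := by
  obtain ⟨f, hfs, hfpos, hf⟩ := B.contDiffOn_sqrt_grr_mul_lapse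
  obtain ⟨A₁, -, hA₁c, -, hA₁, -⟩ := B.contDiffOn_lapse_sq.exists_hasDerivAt_Icc B.rH_lt_rM
  obtain ⟨KA, hKA0, hKA⟩ := exists_bound_of_continuousOn hA₁c
  have hq : ContinuousOn (fun r => √(B.gθθ r) / f r) (Icc B.rH B.rM) :=
    (B.contDiffOn_gθθ.continuousOn.sqrt).div hfs.continuousOn fun r hr => (hfpos r hr).ne'
  obtain ⟨Kq, hKq0, hKq⟩ := exists_bound_of_continuousOn hq
  refine ⟨Kq * KA, fun r hr => ?_⟩
  have h1 : |B.lapse r ^ 2| ≤ KA * (r - B.rH) := abs_le_mul_sub_of_hasDerivAt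
    (f := fun r => B.lapse r ^ 2) B.contDiffOn_lapse_sq.continuousOn hA₁ hKA
    (by simp [B.lapse_horizon]) hr
  have hr' := Ioo_subset_Ioc_self hr
  have hN := B.lapse_pos r hr'
  have hg := B.grr_pos r hr'
  have hsg := Real.sqrt_pos.2 hg
  have h2 : B.corotating.radialCoeff r = √(B.gθθ r) / f r * B.lapse r ^ 2 := by
    rw [← hf r hr']
    change B.lapse r * √(B.grr r) * √(B.gθθ r) / B.grr r = _
    have h3 := Real.sq_sqrt hg.le
    conv_lhs => rw [← h3]
    rw [Real.sqrt_sq hsg.le]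
    field_simp
  rw [h2, mul_assoc]
  have h3 := hKq r (Ioo_subset_Icc_self hr)
  exact mul_le_mul ((le_abs_self _).trans h3) ((le_abs_self _).trans h1) (sq_nonneg _) hKq0

/-- For large mode numbers the radial potential has a non-negative real part all the way down to
the horizon, where it vanishes. -/
lemma exists_re_potential_nonneg {U : ℝ → ℝ} {KU : ℝ} (hKU : ∀ r ∈ Ioo B.rH B.rM, |U r| ≤ KU) :
    ∃ R : ℝ, ∀ n k : ℤ, R ≤ (n : ℝ) ^ 2 + k ^ 2 → ∀ r ∈ Ioo B.rH B.rM,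
      0 ≤ (B.corotating.modePotential B.κ n k r + B.corotating.backgroundPotential U r).re := by
  obtain ⟨c, hc, hcle⟩ := B.exists_mul_lapse_sq_le
  obtain ⟨Kh, hKh0, hKh⟩ := exists_bound_of_continuousOn B.contDiffOn_gθθ.continuousOn
  obtain ⟨ch, hch, hchle⟩ := exists_pos_le_of_continuousOn B.rH_lt_rM.le
    B.contDiffOn_gθθ.continuousOn B.gθθ_pos
  obtain ⟨KA, hKA0, hKA⟩ := exists_bound_of_continuousOn B.contDiffOn_lapse_sq.continuousOn
  have hκ := B.κ_pos
  refine ⟨Kh * KU / c + KA * (Kh * KU) / (B.κ ^ 2 * ch), fun n k hnk r hr => ?_⟩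
  rw [Complex.add_re, modePotential_re, backgroundPotential, Complex.ofReal_re]
  change 0 ≤ B.κ ^ 2 * B.gθθ r * n ^ 2
      + (B.lapse r ^ 2 - B.gθθ r * (B.shift r + B.ΩH) ^ 2) * k ^ 2 + B.lapse r ^ 2 * B.gθθ r * U r
  have h1 := hcle r hr
  have h2 := hchle r (Ioo_subset_Icc_self hr)
  have h3 : B.gθθ r ≤ Kh := (le_abs_self _).trans (hKh r (Ioo_subset_Icc_self hr))
  have h4 : B.lapse r ^ 2 ≤ KA := (le_abs_self _).trans (hKA r (Ioo_subset_Icc_self hr))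
  have h5 := hKU r hr
  have h6 : 0 ≤ KU := (abs_nonneg _).trans h5
  have hh := B.gθθ_pos r (Ioo_subset_Icc_self hr)
  have h7 : -(B.lapse r ^ 2 * (Kh * KU)) ≤ B.lapse r ^ 2 * B.gθθ r * U r := by
    have e1 : |B.gθθ r * U r| ≤ Kh * KU := by rw [abs_mul, abs_of_pos hh]; gcongr
    have e2 := neg_le_of_abs_le e1
    have e3 := sq_nonneg (B.lapse r)
    nlinarith [mul_le_mul_of_nonneg_left e2 e3]
  have h8 : B.κ ^ 2 * ch * n ^ 2 ≤ B.κ ^ 2 * B.gθθ r * n ^ 2 := by gcongr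
  have h9 : c * B.lapse r ^ 2 * k ^ 2 ≤
      (B.lapse r ^ 2 - B.gθθ r * (B.shift r + B.ΩH) ^ 2) * k ^ 2 := by gcongr
  have hN2 := sq_nonneg (B.lapse r)
  have hKK : 0 ≤ Kh * KU := by positivity
  rcases le_total (Kh * KU / c) ((k : ℝ) ^ 2) with h | h
  · rw [div_le_iff₀ hc] at h
    have := mul_le_mul_of_nonneg_left h hN2
    have : 0 ≤ B.κ ^ 2 * ch * (n : ℝ) ^ 2 := by positivity
    nlinarith
  · have e1 : KA * (Kh * KU) / (B.κ ^ 2 * ch) ≤ (n : ℝ) ^ 2 := by linarith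
    rw [div_le_iff₀ (by positivity)] at e1
    have e2 := mul_le_mul_of_nonneg_right h4 hKK
    have : 0 ≤ c * B.lapse r ^ 2 * (k : ℝ) ^ 2 := by positivity
    nlinarith

end RotatingBlackHole

/-! ### Summability over mode numbers -/

lemma summable_one_div_one_add_mul_int_sq {c : ℝ} (hc : 0 < c) :
    Summable fun m : ℤ => 1 / (1 + c * (m : ℝ) ^ 2) := by
  have h := (Real.summable_one_div_int_pow (p := 2)).2 (by norm_num)
  refine (h.mul_left (1 / c)).of_norm_bounded_eventually ?_
  filter_upwards [(finite_singleton (0 : ℤ)).compl_mem_cofinite] with m hm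
  have hm : (m : ℝ) ≠ 0 := by exact_mod_cast (show m ≠ 0 from hm)
  rw [Real.norm_of_nonneg (by positivity), div_mul_div_comm, one_mul]
  gcongr
  linarith

lemma summable_exp_neg_mul_int_sq {c : ℝ} (hc : 0 < c) :
    Summable fun m : ℤ => Real.exp (-(c * (m : ℝ) ^ 2)) := by
  refine (summable_one_div_one_add_mul_int_sq hc).of_nonneg_of_le (fun _ => (Real.exp_pos _).le) ?_
  intro m
  rw [Real.exp_neg, ← one_div]
  gcongr
  linarith [Real.add_one_le_exp (c * (m : ℝ) ^ 2)]

/-- A family on `ℤ × ℤ` that is dominated by a Gaussian is summable. -/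
lemma summable_of_norm_le_gaussian {E : Type*} [NormedAddCommGroup E] [CompleteSpace E]
    {f : ℤ × ℤ → E} {C c : ℝ} (hc : 0 < c)
    (hf : ∀ p : ℤ × ℤ, ‖f p‖ ≤ C * Real.exp (-(c * ((p.1 : ℝ) ^ 2 + (p.2 : ℝ) ^ 2)))) :
    Summable f := by
  have h := (summable_exp_neg_mul_int_sq hc).mul_of_nonneg (summable_exp_neg_mul_int_sq hc)
    (fun _ => (Real.exp_pos _).le) (fun _ => (Real.exp_pos _).le)
  refine (h.mul_left C).of_norm_bounded fun p => (hf p).trans (le_of_eq ?_)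
  rw [← Real.exp_add]
  congr 2; ring

lemma summable_gaussian {c : ℝ} (hc : 0 < c) :
    Summable fun p : ℤ × ℤ => Real.exp (-(c * ((p.1 : ℝ) ^ 2 + (p.2 : ℝ) ^ 2))) :=
  summable_of_norm_le_gaussian (C := 1) hc fun p => by
    rw [Real.norm_of_nonneg (Real.exp_pos _).le, one_mul]

lemma summable_one_div_sqrt_pow_three :
    Summable fun p : ℤ × ℤ => 1 / √((p.1 : ℝ) ^ 2 + (p.2 : ℝ) ^ 2) ^ 3 := by
  have h := EisensteinSeries.summable_one_div_norm_rpow (k := 3) (by norm_num)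
  rw [← (finTwoArrowEquiv ℤ).symm.summable_iff] at h
  refine h.of_nonneg_of_le (fun _ => by positivity) fun p => ?_
  simp only [Function.comp, finTwoArrowEquiv_symm_apply]
  rw [show (-3 : ℝ) = -((3 : ℕ) : ℝ) by norm_num, Real.rpow_neg (norm_nonneg _), Real.rpow_natCast,
    ← one_div]
  rcases eq_or_ne p 0 with rfl | hp
  · simp
  have hpos : 0 < ‖![p.1, p.2]‖ := by
    rw [norm_pos_iff]
    intro h0
    apply hp
    have h1 := congrFun h0 0
    have h2 := congrFun h0 1
    exact Prod.ext h1 h2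
  gcongr
  rw [pi_norm_le_iff_of_nonneg (Real.sqrt_nonneg _)]
  intro i
  fin_cases i
  · simp only [Int.norm_eq_abs]
    exact Real.abs_le_sqrt (by simp; positivity)
  · simp only [Int.norm_eq_abs]
    exact Real.abs_le_sqrt (by simp; positivity)

/-! ### The heat kernel of the thermal cylinder and its two expansions -/

/-- The quadratic form `Q(n, k) = ρ² (κ n + i k Ω)² + k²` in the mode numbers. -/
def modeQ (ρ κ Ω : ℝ) (p : ℤ × ℤ) : ℂ :=
  (ρ : ℂ) ^ 2 * (κ * p.1 + Complex.I * p.2 * Ω) ^ 2 + (p.2 : ℂ) ^ 2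

/-- The mode `e^{iκnτ + ikθ}` as a function of the separation `x = (τ, θ)`. -/
def modeWave (κ : ℝ) (p : ℤ × ℤ) (x : ℝ × ℝ) : ℂ :=
  Complex.exp (Complex.I * (κ * p.1 * x.1 + p.2 * x.2))

/-- The quadratic form dual to `modeQ`: up to the factor `ρ²`, the squared interval
`τ² + ρ² (θ - iΩτ)²` between points at the same radius. -/
def dualQ (ρ Ω : ℝ) (x : ℝ × ℝ) : ℂ :=
  (x.1 : ℂ) ^ 2 / (ρ : ℂ) ^ 2 + (x.2 - Complex.I * Ω * x.1) ^ 2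

/-- The images of the separation `x` under the periods `2π/κ` and `2π`. -/
def imagePoint (κ : ℝ) (p : ℤ × ℤ) (x : ℝ × ℝ) : ℝ × ℝ :=
  (x.1 - 2 * Real.pi * p.1 / κ, x.2 - 2 * Real.pi * p.2)

/-- The heat kernel `∑ e^{-tQ(n,k)} e^{iκnτ + ikθ}`. -/
def heatSum (ρ κ Ω t : ℝ) (x : ℝ × ℝ) : ℂ :=
  ∑' p : ℤ × ℤ, Complex.exp (-t * modeQ ρ κ Ω p) * modeWave κ p x

section

variable {ρ κ Ω : ℝ}

lemma norm_modeWave (κ : ℝ) (p : ℤ × ℤ) (x : ℝ × ℝ) : ‖modeWave κ p x‖ = 1 := by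
  rw [modeWave, mul_comm]
  have : (κ * p.1 * x.1 + p.2 * x.2 : ℂ) = ((κ * p.1 * x.1 + p.2 * x.2 : ℝ) : ℂ) := by
    push_cast; rfl
  rw [this, Complex.norm_exp_ofReal_mul_I]

lemma continuous_modeWave (κ : ℝ) (p : ℤ × ℤ) : Continuous (modeWave κ p) := by
  unfold modeWave; fun_prop

lemma modeQ_re (p : ℤ × ℤ) : (modeQ ρ κ Ω p).re =
    ρ ^ 2 * κ ^ 2 * p.1 ^ 2 + (1 - ρ ^ 2 * Ω ^ 2) * p.2 ^ 2 := by
  simp [modeQ, sq]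
  ring

lemma dualQ_re (x : ℝ × ℝ) : (dualQ ρ Ω x).re = x.1 ^ 2 / ρ ^ 2 + x.2 ^ 2 - Ω ^ 2 * x.1 ^ 2 := by
  have h : (dualQ ρ Ω x) = ((x.1 ^ 2 / ρ ^ 2 + x.2 ^ 2 - Ω ^ 2 * x.1 ^ 2 : ℝ) : ℂ)
      + Complex.I * ((-2 * Ω * x.1 * x.2 : ℝ) : ℂ) := by
    simp only [dualQ]; push_cast
    linear_combination (Ω * x.1 : ℂ) ^ 2 * Complex.I_sq
  rw [h, Complex.add_re, Complex.I_mul_re, Complex.ofReal_re, Complex.ofReal_im]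
  ring

lemma one_sub_sq_pos (hρ : 0 < ρ) (hΩ : |Ω| * ρ < 1) : 0 < 1 - ρ ^ 2 * Ω ^ 2 := by
  have h1 : 0 ≤ |Ω| * ρ := by positivity
  have h2 : (|Ω| * ρ) ^ 2 < 1 := by nlinarith
  rw [mul_pow, sq_abs] at h2
  linarith

lemma exists_le_modeQ_re (hρ : 0 < ρ) (hκ : 0 < κ) (hΩ : |Ω| * ρ < 1) : ∃ c > 0, ∀ p : ℤ × ℤ,
    c * ((p.1 : ℝ) ^ 2 + (p.2 : ℝ) ^ 2) ≤ (modeQ ρ κ Ω p).re := by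
  refine ⟨min (ρ ^ 2 * κ ^ 2) (1 - ρ ^ 2 * Ω ^ 2), lt_min (by positivity) (one_sub_sq_pos hρ hΩ),
    fun p => ?_⟩
  rw [modeQ_re, mul_add]
  gcongr
  · exact min_le_left _ _
  · exact min_le_right _ _

lemma exists_le_dualQ_re (hρ : 0 < ρ) (hΩ : |Ω| * ρ < 1) : ∃ c > 0, ∀ x : ℝ × ℝ,
    c * (x.1 ^ 2 + x.2 ^ 2) ≤ (dualQ ρ Ω x).re := by
  refine ⟨min ((1 - ρ ^ 2 * Ω ^ 2) / ρ ^ 2) 1, lt_min (div_pos (one_sub_sq_pos hρ hΩ)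
    (by positivity)) one_pos, fun x => ?_⟩
  have h : (dualQ ρ Ω x).re = (1 - ρ ^ 2 * Ω ^ 2) / ρ ^ 2 * x.1 ^ 2 + 1 * x.2 ^ 2 := by
    rw [dualQ_re]; field_simp; ring
  rw [h, mul_add]
  gcongr
  · exact min_le_left _ _
  · exact min_le_right _ _

lemma norm_exp_mul_modeWave (t : ℝ) (p : ℤ × ℤ) (x : ℝ × ℝ) :
    ‖Complex.exp (-t * modeQ ρ κ Ω p) * modeWave κ p x‖ = Real.exp (-(t * (modeQ ρ κ Ω p).re)) := by
  rw [norm_mul, norm_modeWave, mul_one, Complex.norm_exp]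
  congr 1
  simp

lemma summable_exp_mul_modeWave (hρ : 0 < ρ) (hκ : 0 < κ) (hΩ : |Ω| * ρ < 1) {t : ℝ} (ht : 0 < t)
    (x : ℝ × ℝ) : Summable fun p => Complex.exp (-t * modeQ ρ κ Ω p) * modeWave κ p x := by
  obtain ⟨c, hc, hle⟩ := exists_le_modeQ_re hρ hκ hΩ
  refine summable_of_norm_le_gaussian (C := 1) (mul_pos ht hc) fun p => ?_
  rw [norm_exp_mul_modeWave, one_mul, mul_assoc]
  have := mul_le_mul_of_nonneg_left (hle p) ht.le
  gcongr

/-- Lattice points far out are far from a bounded set. -/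
lemma sq_image_ge (hκ : 0 < κ) : ∃ c > 0, ∀ (p : ℤ × ℤ) (x : ℝ × ℝ),
    c * ((p.1 : ℝ) ^ 2 + (p.2 : ℝ) ^ 2) ≤
      (imagePoint κ p x).1 ^ 2 + (imagePoint κ p x).2 ^ 2 + (x.1 ^ 2 + x.2 ^ 2) := by
  have hpi := Real.pi_pos
  refine ⟨min ((2 * Real.pi / κ) ^ 2 / 2) ((2 * Real.pi) ^ 2 / 2),
    lt_min (by positivity) (by positivity), fun p x => ?_⟩
  have h1 : (2 * Real.pi / κ) ^ 2 / 2 * (p.1 : ℝ) ^ 2 ≤ (imagePoint κ p x).1 ^ 2 + x.1 ^ 2 := by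
    have e : (imagePoint κ p x).1 = x.1 - 2 * Real.pi / κ * p.1 := by simp only [imagePoint]; ring
    rw [e]
    nlinarith [sq_nonneg (2 * x.1 - 2 * Real.pi / κ * p.1)]
  have h2 : (2 * Real.pi) ^ 2 / 2 * (p.2 : ℝ) ^ 2 ≤ (imagePoint κ p x).2 ^ 2 + x.2 ^ 2 := by
    simp only [imagePoint]
    nlinarith [sq_nonneg (2 * x.2 - 2 * Real.pi * p.2)]
  have h3 : min ((2 * Real.pi / κ) ^ 2 / 2) ((2 * Real.pi) ^ 2 / 2) * (p.1 : ℝ) ^ 2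
      ≤ (2 * Real.pi / κ) ^ 2 / 2 * (p.1 : ℝ) ^ 2 := by gcongr; exact min_le_left _ _
  have h4 : min ((2 * Real.pi / κ) ^ 2 / 2) ((2 * Real.pi) ^ 2 / 2) * (p.2 : ℝ) ^ 2
      ≤ (2 * Real.pi) ^ 2 / 2 * (p.2 : ℝ) ^ 2 := by gcongr; exact min_le_right _ _
  linarith

lemma summable_exp_dualQ (hρ : 0 < ρ) (hκ : 0 < κ) (hΩ : |Ω| * ρ < 1) {t : ℝ} (ht : 0 < t)
    (x : ℝ × ℝ) : Summable fun p => Complex.exp (-dualQ ρ Ω (imagePoint κ p x) / (4 * t)) := by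
  obtain ⟨c, hc, hle⟩ := exists_le_dualQ_re hρ hΩ
  obtain ⟨c', hc', hle'⟩ := sq_image_ge hκ
  refine summable_of_norm_le_gaussian (C := Real.exp (c / (4 * t) * (x.1 ^ 2 + x.2 ^ 2)))
    (c := c / (4 * t) * c') (by positivity) fun p => ?_
  have e : (-dualQ ρ Ω (imagePoint κ p x) / (4 * t) : ℂ).re =
      -((dualQ ρ Ω (imagePoint κ p x)).re / (4 * t)) := by
    have : (4 * t : ℂ) = ((4 * t : ℝ) : ℂ) := by push_cast; rfl
    rw [this, Complex.div_ofReal_re, Complex.neg_re, neg_div]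
  rw [Complex.norm_exp, e, ← Real.exp_add]
  gcongr
  have h1 := hle (imagePoint κ p x)
  have h2 := mul_le_mul_of_nonneg_left (hle' p x) (show 0 ≤ c / (4 * t) by positivity)
  have h3 : c / (4 * t) * ((imagePoint κ p x).1 ^ 2 + (imagePoint κ p x).2 ^ 2)
      ≤ (dualQ ρ Ω (imagePoint κ p x)).re / (4 * t) := by
    rw [div_mul_eq_mul_div]; gcongr
  linarith

lemma one_div_ofReal_cpow_half {a : ℝ} (ha : 0 < a) :
    1 / (a : ℂ) ^ (1 / 2 : ℂ) = ((1 / √a : ℝ) : ℂ) := by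
  rw [Real.sqrt_eq_rpow, Complex.ofReal_div, Complex.ofReal_cpow ha.le]
  push_cast; rfl

/-- Poisson summation in both mode numbers: the heat kernel is a sum over images. -/
theorem heatSum_eq (hρ : 0 < ρ) (hκ : 0 < κ) (hΩ : |Ω| * ρ < 1) {t : ℝ} (ht : 0 < t)
    (x : ℝ × ℝ) : heatSum ρ κ Ω t x = ((Real.pi / (t * ρ * κ) : ℝ) : ℂ) *
      ∑' p : ℤ × ℤ, Complex.exp (-dualQ ρ Ω (imagePoint κ p x) / (4 * t)) := by
  have hpi := Real.pi_pos
  have hpic : (Real.pi : ℂ) ≠ 0 := by exact_mod_cast hpi.ne'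
  have htc : (t : ℂ) ≠ 0 := by exact_mod_cast ht.ne'
  have hρc : (ρ : ℂ) ≠ 0 := by exact_mod_cast hρ.ne'
  have hκc : (κ : ℂ) ≠ 0 := by exact_mod_cast hκ.ne'
  -- the sum over the images in `τ` and over `k`
  set M : ℤ × ℤ → ℂ := fun q => Complex.exp (-((x.1 - 2 * Real.pi * q.1 / κ : ℝ) : ℂ) ^ 2
    / (4 * t * ρ ^ 2) - t * q.2 ^ 2
    + q.2 * (Ω * ((x.1 - 2 * Real.pi * q.1 / κ : ℝ) : ℂ) + Complex.I * x.2)) with hM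
  have hMsum : Summable M := by
    obtain ⟨c', hc', hle'⟩ := sq_image_ge hκ
    set w := 1 - |Ω| * ρ with hw
    have hw0 : 0 < w := by linarith
    set b := min (w / (4 * t * ρ ^ 2) * (2 * Real.pi / κ) ^ 2 / 2) (w * t) with hb
    refine summable_of_norm_le_gaussian (C := Real.exp (w / (4 * t * ρ ^ 2) * x.1 ^ 2)) (c := b)
      (lt_min (by positivity) (by positivity)) fun p => ?_
    set y := x.1 - 2 * Real.pi * p.1 / κ with hy
    have e : (-(y : ℂ) ^ 2 / (4 * t * ρ ^ 2) - t * p.2 ^ 2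
        + p.2 * (Ω * (y : ℂ) + Complex.I * x.2)) =
        ((-y ^ 2 / (4 * t * ρ ^ 2) - t * p.2 ^ 2 + p.2 * (Ω * y) : ℝ) : ℂ)
          + Complex.I * ((p.2 * x.2 : ℝ) : ℂ) := by push_cast; ring
    simp only [hM]
    rw [Complex.norm_exp, e, Complex.add_re, Complex.I_mul_re, Complex.ofReal_re, Complex.ofReal_im,
      neg_zero, add_zero, ← Real.exp_add]
    refine Real.exp_le_exp.2 ?_
    have h1 : p.2 * (Ω * y) ≤ |Ω| * ρ * (y ^ 2 / (4 * t * ρ ^ 2) + t * p.2 ^ 2) := by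
      have h2 : p.2 * (Ω * y) ≤ |Ω| * (|(p.2 : ℝ)| * |y|) := by
        refine (le_abs_self _).trans (le_of_eq ?_)
        rw [abs_mul, abs_mul]; ring
      have h3 : |(p.2 : ℝ)| * |y| ≤ ρ * (y ^ 2 / (4 * t * ρ ^ 2) + t * p.2 ^ 2) := by
        have h4 : ρ * (y ^ 2 / (4 * t * ρ ^ 2) + t * p.2 ^ 2) - |(p.2 : ℝ)| * |y| =
            (|y| - 2 * t * ρ * |(p.2 : ℝ)|) ^ 2 / (4 * t * ρ) := by
          rw [← sq_abs y, ← sq_abs (p.2 : ℝ)]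
          field_simp
          ring
        have h5 : 0 ≤ (|y| - 2 * t * ρ * |(p.2 : ℝ)|) ^ 2 / (4 * t * ρ) := by positivity
        linarith
      calc _ ≤ _ := h2
        _ ≤ |Ω| * (ρ * (y ^ 2 / (4 * t * ρ ^ 2) + t * p.2 ^ 2)) := by gcongr
        _ = _ := by ring
    have h2 : b * ((p.1 : ℝ) ^ 2 + (p.2 : ℝ) ^ 2) ≤
        w / (4 * t * ρ ^ 2) * (y ^ 2 + x.1 ^ 2) + w * t * p.2 ^ 2 := by
      have h3 : b * (p.1 : ℝ) ^ 2 ≤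
          w / (4 * t * ρ ^ 2) * (2 * Real.pi / κ) ^ 2 / 2 * (p.1 : ℝ) ^ 2 := by
        gcongr; exact min_le_left _ _
      have h4 : b * (p.2 : ℝ) ^ 2 ≤ w * t * (p.2 : ℝ) ^ 2 := by gcongr; exact min_le_right _ _
      have h5 : (2 * Real.pi / κ) ^ 2 / 2 * (p.1 : ℝ) ^ 2 ≤ y ^ 2 + x.1 ^ 2 := by
        have e : y = x.1 - 2 * Real.pi / κ * p.1 := by rw [hy]; ring
        rw [e]
        nlinarith [sq_nonneg (2 * x.1 - 2 * Real.pi / κ * p.1)]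
      have h6 := mul_le_mul_of_nonneg_left h5 (show 0 ≤ w / (4 * t * ρ ^ 2) by positivity)
      linarith
    have h3 : -y ^ 2 / (4 * t * ρ ^ 2) - t * p.2 ^ 2
        + |Ω| * ρ * (y ^ 2 / (4 * t * ρ ^ 2) + t * p.2 ^ 2) =
        -(w / (4 * t * ρ ^ 2) * y ^ 2 + w * t * p.2 ^ 2) := by rw [hw]; ring
    linarith
  have hsum := summable_exp_mul_modeWave hρ hκ hΩ ht x
  have hstep1 : ∀ k : ℤ, ∑' n : ℤ, Complex.exp (-t * modeQ ρ κ Ω (n, k)) * modeWave κ (n, k) x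
      = ((1 / √(t * ρ ^ 2 * κ ^ 2 / Real.pi) : ℝ) : ℂ) * ∑' a : ℤ, M (a, k) := fun k => by
    have ha : 0 < t * ρ ^ 2 * κ ^ 2 / Real.pi := by positivity
    have hP := Complex.tsum_exp_neg_quadratic
      (a := ((t * ρ ^ 2 * κ ^ 2 / Real.pi : ℝ) : ℂ)) (by rw [Complex.ofReal_re]; exact ha)
      (Complex.I * κ * (x.1 - 2 * t * ρ ^ 2 * Ω * k) / (2 * Real.pi))
    rw [one_div_ofReal_cpow_half ha] at hP
    have e1 : ∀ n : ℤ, Complex.exp (-t * modeQ ρ κ Ω (n, k)) * modeWave κ (n, k) x =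
        Complex.exp (-(t * k ^ 2) + t * ρ ^ 2 * Ω ^ 2 * k ^ 2 + Complex.I * k * x.2) *
        Complex.exp (-Real.pi * ((t * ρ ^ 2 * κ ^ 2 / Real.pi : ℝ) : ℂ) * n ^ 2 + 2 * Real.pi *
          (Complex.I * κ * (x.1 - 2 * t * ρ ^ 2 * Ω * k) / (2 * Real.pi)) * n) := fun n => by
      rw [modeWave, ← Complex.exp_add, ← Complex.exp_add]
      congr 1
      simp only [modeQ]
      push_cast
      field_simp
      linear_combination (-(t * ρ ^ 2 * (k * Ω) ^ 2) : ℂ) * Complex.I_sq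
    have e2 : ∀ a : ℤ, M (a, k) =
        Complex.exp (-(t * k ^ 2) + t * ρ ^ 2 * Ω ^ 2 * k ^ 2 + Complex.I * k * x.2) *
        Complex.exp (-Real.pi / ((t * ρ ^ 2 * κ ^ 2 / Real.pi : ℝ) : ℂ) * (a + Complex.I *
          (Complex.I * κ * (x.1 - 2 * t * ρ ^ 2 * Ω * k) / (2 * Real.pi))) ^ 2) := fun a => by
      rw [← Complex.exp_add]
      simp only [hM]
      congr 1
      have e3 : (a + Complex.I *
          (Complex.I * κ * (x.1 - 2 * t * ρ ^ 2 * Ω * k) / (2 * Real.pi)) : ℂ)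
          = a - κ * (x.1 - 2 * t * ρ ^ 2 * Ω * k) / (2 * Real.pi) := by
        linear_combination (κ * (x.1 - 2 * t * ρ ^ 2 * Ω * k) / (2 * Real.pi) : ℂ) * Complex.I_sq
      rw [e3]
      push_cast
      field_simp
      ring
    simp_rw [e1, e2]
    rw [tsum_mul_left, tsum_mul_left, hP]
    ring
  have hstep2 : ∀ a : ℤ, ∑' k : ℤ, M (a, k) = ((1 / √(t / Real.pi) : ℝ) : ℂ) *
      ∑' b : ℤ, Complex.exp (-dualQ ρ Ω (imagePoint κ (a, b) x) / (4 * t)) := fun a => by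
    have ha : 0 < t / Real.pi := by positivity
    set y := x.1 - 2 * Real.pi * a / κ with hy
    have hP := Complex.tsum_exp_neg_quadratic
      (a := ((t / Real.pi : ℝ) : ℂ)) (by rw [Complex.ofReal_re]; exact ha)
      ((Ω * y + Complex.I * x.2) / (2 * Real.pi))
    rw [one_div_ofReal_cpow_half ha] at hP
    have e1 : ∀ k : ℤ, M (a, k) = Complex.exp (-(y : ℂ) ^ 2 / (4 * t * ρ ^ 2)) *
        Complex.exp (-Real.pi * ((t / Real.pi : ℝ) : ℂ) * k ^ 2 + 2 * Real.pi *
          ((Ω * y + Complex.I * x.2) / (2 * Real.pi)) * k) := fun k => by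
      have hMy : M (a, k) = Complex.exp (-(y : ℂ) ^ 2 / (4 * t * ρ ^ 2) - t * k ^ 2
          + k * (Ω * y + Complex.I * x.2)) := rfl
      rw [hMy, ← Complex.exp_add]
      congr 1
      push_cast
      field_simp
      ring
    have e2 : ∀ b : ℤ, Complex.exp (-dualQ ρ Ω (imagePoint κ (a, b) x) / (4 * t)) =
        Complex.exp (-(y : ℂ) ^ 2 / (4 * t * ρ ^ 2)) *
        Complex.exp (-Real.pi / ((t / Real.pi : ℝ) : ℂ) * (b + Complex.I *
          ((Ω * y + Complex.I * x.2) / (2 * Real.pi))) ^ 2) := fun b => by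
      rw [← Complex.exp_add]
      congr 1
      have e3 : (b + Complex.I * ((Ω * y + Complex.I * x.2) / (2 * Real.pi)) : ℂ)
          = -((x.2 - 2 * Real.pi * b - Complex.I * Ω * y) / (2 * Real.pi)) := by
        field_simp
        linear_combination (x.2 : ℂ) * Complex.I_sq
      have e4 : dualQ ρ Ω (imagePoint κ (a, b) x) = (y : ℂ) ^ 2 / (ρ : ℂ) ^ 2
          + (((x.2 - 2 * Real.pi * b : ℝ) : ℂ) - Complex.I * Ω * y) ^ 2 := rfl
      rw [e3, e4]
      push_cast
      field_simp
      ring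
    simp_rw [e1, e2]
    rw [tsum_mul_left, tsum_mul_left, hP]
    ring
  have hsum' : Summable fun p : ℤ × ℤ =>
      Complex.exp (-t * modeQ ρ κ Ω p.swap) * modeWave κ p.swap x :=
    (Equiv.prodComm ℤ ℤ).summable_iff.2 hsum
  have hpref : ((1 / √(t * ρ ^ 2 * κ ^ 2 / Real.pi) : ℝ) : ℂ) * ((1 / √(t / Real.pi) : ℝ) : ℂ)
      = ((Real.pi / (t * ρ * κ) : ℝ) : ℂ) := by
    rw [← Complex.ofReal_mul]
    congr 1
    rw [div_mul_div_comm, one_mul, ← Real.sqrt_mul (by positivity)]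
    have : t * ρ ^ 2 * κ ^ 2 / Real.pi * (t / Real.pi) = (t * ρ * κ / Real.pi) ^ 2 := by
      field_simp
    rw [this, Real.sqrt_sq (by positivity), one_div_div]
  calc heatSum ρ κ Ω t x
      = ∑' p : ℤ × ℤ, Complex.exp (-t * modeQ ρ κ Ω p.swap) * modeWave κ p.swap x :=
        ((Equiv.prodComm ℤ ℤ).tsum_eq _).symm
    _ = ∑' k : ℤ, ∑' n : ℤ, Complex.exp (-t * modeQ ρ κ Ω (n, k)) * modeWave κ (n, k) x :=
        hsum'.tsum_prod
    _ = ((1 / √(t * ρ ^ 2 * κ ^ 2 / Real.pi) : ℝ) : ℂ) * ∑' k : ℤ, ∑' a : ℤ, M (a, k) := by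
        simp_rw [hstep1]; rw [tsum_mul_left]
    _ = ((1 / √(t * ρ ^ 2 * κ ^ 2 / Real.pi) : ℝ) : ℂ) * ∑' a : ℤ, ∑' k : ℤ, M (a, k) := by
        rw [Summable.tsum_comm (f := fun a k => M (a, k)) hMsum]
    _ = _ := by
        simp_rw [hstep2]
        rw [tsum_mul_left, ← mul_assoc, hpref, (summable_exp_dualQ hρ hκ hΩ ht x).tsum_prod]

/-! ### The part of the Green function with short heat kernel times -/

/-- The part of the heat kernel that comes from the images in `s`. -/
def imageSum (ρ κ Ω : ℝ) (s : Set (ℤ × ℤ)) (t : ℝ) (x : ℝ × ℝ) : ℂ :=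
  ((Real.pi / (t * ρ * κ) : ℝ) : ℂ) *
    ∑' p : ℤ × ℤ, s.indicator (fun p => Complex.exp (-dualQ ρ Ω (imagePoint κ p x) / (4 * t))) p

lemma heatSum_eq_imageSum (hρ : 0 < ρ) (hκ : 0 < κ) (hΩ : |Ω| * ρ < 1) {t : ℝ} (ht : 0 < t)
    (x : ℝ × ℝ) : heatSum ρ κ Ω t x = imageSum ρ κ Ω univ t x := by
  rw [heatSum_eq hρ hκ hΩ ht, imageSum]; simp only [indicator_univ]

lemma heatSum_eq_add (hρ : 0 < ρ) (hκ : 0 < κ) (hΩ : |Ω| * ρ < 1) {t : ℝ} (ht : 0 < t)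
    (x : ℝ × ℝ) : heatSum ρ κ Ω t x = ((Real.pi / (t * ρ * κ) : ℝ) : ℂ)
      * Complex.exp (-dualQ ρ Ω x / (4 * t)) + imageSum ρ κ Ω {0}ᶜ t x := by
  have hs := summable_exp_dualQ hρ hκ hΩ ht x
  have h0 : imagePoint κ 0 x = x := by simp [imagePoint]
  rw [heatSum_eq hρ hκ hΩ ht, imageSum, ← mul_add]
  congr 1
  rw [hs.tsum_eq_add_tsum_ite 0, h0]
  congr 1
  refine tsum_congr fun p => ?_
  by_cases hp : p = 0 <;> simp [hp]

lemma continuous_heatSum (hρ : 0 < ρ) (hκ : 0 < κ) (hΩ : |Ω| * ρ < 1) {t : ℝ} (ht : 0 < t) :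
    Continuous (heatSum ρ κ Ω t) := by
  refine continuous_tsum (fun p => continuous_const.mul (continuous_modeWave κ p))
    (summable_exp_mul_modeWave hρ hκ hΩ ht 0).norm fun p x => ?_
  rw [norm_exp_mul_modeWave, norm_exp_mul_modeWave]

lemma measurable_heatSum : Measurable fun q : ℝ × ℝ × ℝ => heatSum ρ κ Ω (q.1 ^ 2) q.2 := by
  refine Measurable.tsum fun p => ?_
  have : Continuous fun q : ℝ × ℝ × ℝ =>
      Complex.exp (-((q.1 ^ 2 : ℝ) : ℂ) * modeQ ρ κ Ω p) * modeWave κ p q.2 := by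
    have := (continuous_modeWave κ p).comp (continuous_snd (X := ℝ) (Y := ℝ × ℝ))
    refine Continuous.mul ?_ this
    fun_prop
  exact this.measurable

/-- The images that stay away from zero give a contribution that is bounded uniformly in the heat
kernel time. -/
lemma exists_norm_imageSum_le (hρ : 0 < ρ) (hκ : 0 < κ) (hΩ : |Ω| * ρ < 1) (R : ℝ) {d : ℝ}
    (hd : 0 < d) : ∃ C : ℝ, ∀ (s : Set (ℤ × ℤ)) (x : ℝ × ℝ), x.1 ^ 2 + x.2 ^ 2 ≤ R →
      (∀ p ∈ s, d ≤ (imagePoint κ p x).1 ^ 2 + (imagePoint κ p x).2 ^ 2) →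
      ∀ u ∈ Ioc (0 : ℝ) 1, ‖imageSum ρ κ Ω s (u ^ 2) x‖ ≤ C := by
  obtain ⟨c, hc, hle⟩ := exists_le_dualQ_re hρ hΩ
  obtain ⟨c', hc', hle'⟩ := sq_image_ge hκ
  have hpi := Real.pi_pos
  set g : ℤ × ℤ → ℝ := fun p => Real.exp (-(c * c' / 8 * ((p.1 : ℝ) ^ 2 + (p.2 : ℝ) ^ 2))) with hg
  have hgs : Summable g := summable_gaussian (by positivity)
  refine ⟨Real.pi / (ρ * κ) * (8 / (c * d)) * (Real.exp (c / 8 * R) * ∑' p, g p), ?_⟩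
  intro s x hx hs u hu
  have hu0 : 0 < u := hu.1
  set y := 1 / u ^ 2 with hy
  have hy1 : 1 ≤ y := by
    rw [hy, le_div_iff₀ (by positivity)]; nlinarith [hu.2]
  have hterm : ∀ p, ‖s.indicator (fun p => Complex.exp
      (-dualQ ρ Ω (imagePoint κ p x) / (4 * (u ^ 2 : ℝ)))) p‖ ≤
      Real.exp (-(c * d / 8 * y)) * Real.exp (c / 8 * R) * g p := fun p => by
    by_cases hp : p ∈ s
    · rw [indicator_of_mem hp]
      have e : (-dualQ ρ Ω (imagePoint κ p x) / (4 * (u ^ 2 : ℝ)) : ℂ).re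
          = -((dualQ ρ Ω (imagePoint κ p x)).re / 4 * y) := by
        have : (4 * (u ^ 2 : ℝ) : ℂ) = ((4 * u ^ 2 : ℝ) : ℂ) := by push_cast; rfl
        rw [this, Complex.div_ofReal_re, Complex.neg_re, hy]; field_simp
      rw [Complex.norm_exp, e, ← Real.exp_add, hg]
      simp only
      rw [← Real.exp_add]
      refine Real.exp_le_exp.2 ?_
      have h1 := hle (imagePoint κ p x)
      have h2 := hs p hp
      have h3 := hle' p x
      set z := (imagePoint κ p x).1 ^ 2 + (imagePoint κ p x).2 ^ 2 with hz
      have h4 : c * z / 4 * y ≤ (dualQ ρ Ω (imagePoint κ p x)).re / 4 * y := by gcongr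
      have h5 : c * d / 8 * y ≤ c * z / 8 * y := by gcongr
      have h6 : c * z / 8 ≤ c * z / 8 * y := le_mul_of_one_le_right (by positivity) hy1
      have h7 : c / 8 * (c' * ((p.1 : ℝ) ^ 2 + (p.2 : ℝ) ^ 2)) ≤ c / 8 * (z + R) := by
        gcongr; linarith
      linarith
    · rw [indicator_of_notMem hp, norm_zero]
      have := Real.exp_pos (-(c * c' / 8 * ((p.1 : ℝ) ^ 2 + (p.2 : ℝ) ^ 2)))
      positivity
  have hsum : ‖∑' p, s.indicator (fun p => Complex.exp
      (-dualQ ρ Ω (imagePoint κ p x) / (4 * (u ^ 2 : ℝ)))) p‖ ≤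
      Real.exp (-(c * d / 8 * y)) * Real.exp (c / 8 * R) * ∑' p, g p := by
    rw [← tsum_mul_left]
    exact tsum_of_norm_bounded (hgs.mul_left _).hasSum hterm
  have hpre : y * Real.exp (-(c * d / 8 * y)) ≤ 8 / (c * d) := by
    have h1 := Real.add_one_le_exp (c * d / 8 * y)
    rw [Real.exp_neg, ← div_eq_mul_inv, div_le_div_iff₀ (Real.exp_pos _) (by positivity)]
    linarith
  have hG : 0 ≤ ∑' p, g p := tsum_nonneg fun p => (Real.exp_pos _).le
  rw [imageSum, norm_mul, Complex.norm_real, Real.norm_of_nonneg (by positivity)]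
  calc _ ≤ Real.pi / (u ^ 2 * ρ * κ) *
          (Real.exp (-(c * d / 8 * y)) * Real.exp (c / 8 * R) * ∑' p, g p) := by
        gcongr
    _ = Real.pi / (ρ * κ) * (y * Real.exp (-(c * d / 8 * y)))
          * (Real.exp (c / 8 * R) * ∑' p, g p) := by
        rw [hy]; field_simp
    _ ≤ _ := by gcongr

lemma isClosed_coincidenceSet (hκ : 0 < κ) : IsClosed (coincidenceSet κ) := by
  have h := Int.isClosedEmbedding_coe_real.isClosed_range
  have e : coincidenceSet κ = (fun x : ℝ × ℝ => κ * x.1 / (2 * Real.pi)) ⁻¹' range ((↑) : ℤ → ℝ)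
      ∩ (fun x : ℝ × ℝ => x.2 / (2 * Real.pi)) ⁻¹' range ((↑) : ℤ → ℝ) := by
    have hpi := Real.pi_pos
    ext x
    constructor
    · rintro ⟨a, b, rfl⟩
      refine ⟨⟨a, ?_⟩, ⟨b, ?_⟩⟩
      · simp only; field_simp
      · simp only; field_simp
    · rintro ⟨⟨a, ha⟩, ⟨b, hb⟩⟩
      refine ⟨a, b, Prod.ext ?_ ?_⟩
      · simp only at ha ⊢; rw [ha]; field_simp
      · simp only at hb ⊢; rw [hb]; field_simp
  rw [e]
  exact (h.preimage (by fun_prop)).inter (h.preimage (by fun_prop))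

/-- The images of a compact set of non-coincident separations stay away from zero. -/
lemma exists_le_sq_imagePoint (hκ : 0 < κ) {K : Set (ℝ × ℝ)} (hK : IsCompact K)
    (hKs : K ⊆ (coincidenceSet κ)ᶜ) : ∃ d > 0, ∀ x ∈ K, ∀ p : ℤ × ℤ,
      d ≤ (imagePoint κ p x).1 ^ 2 + (imagePoint κ p x).2 ^ 2 := by
  obtain ⟨δ, hδ, hsub⟩ := hK.exists_thickening_subset_open
    (isClosed_coincidenceSet hκ).isOpen_compl hKs
  refine ⟨δ ^ 2, by positivity, fun x hx p => ?_⟩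
  by_contra! hlt
  have hy : (2 * Real.pi * p.1 / κ, 2 * Real.pi * p.2) ∈ coincidenceSet κ := ⟨p.1, p.2, rfl⟩
  refine hsub (Metric.mem_thickening_iff.2 ⟨x, hx, ?_⟩) hy
  rw [dist_comm, Prod.dist_eq, max_lt_iff, Real.dist_eq, Real.dist_eq]
  constructor
  · refine abs_lt_of_sq_lt_sq ?_ hδ.le
    have := sq_nonneg (imagePoint κ p x).2
    simp only [imagePoint] at *; linarith
  · refine abs_lt_of_sq_lt_sq ?_ hδ.le
    have := sq_nonneg (imagePoint κ p x).1
    simp only [imagePoint] at *; linarith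

lemma exists_norm_heatSum_le (hρ : 0 < ρ) (hκ : 0 < κ) (hΩ : |Ω| * ρ < 1) {K : Set (ℝ × ℝ)}
    (hK : IsCompact K) (hKs : K ⊆ (coincidenceSet κ)ᶜ) : ∃ C : ℝ, ∀ x ∈ K, ∀ u ∈ Ioc (0 : ℝ) 1,
      ‖heatSum ρ κ Ω (u ^ 2) x‖ ≤ C := by
  obtain ⟨d, hd, hle⟩ := exists_le_sq_imagePoint hκ hK hKs
  obtain ⟨R, hR⟩ := hK.exists_bound_of_continuousOn
    (f := fun x : ℝ × ℝ => x.1 ^ 2 + x.2 ^ 2) (by fun_prop)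
  obtain ⟨C, hC⟩ := exists_norm_imageSum_le hρ hκ hΩ R hd
  refine ⟨C, fun x hx u hu => ?_⟩
  rw [heatSum_eq_imageSum hρ hκ hΩ (pow_pos hu.1 2)]
  exact hC univ x ((le_abs_self _).trans (hR x hx)) (fun p _ => hle x hx p) u hu

/-- A model for the singular part of the thermal Green's function in Minkowski spacetime: the
integral of the heat kernel over short times `t = u²`. -/
def thermalModel (ρ κ Ω : ℝ) (x : ℝ × ℝ) : ℂ := ∫ u in Ioc (0 : ℝ) 1, heatSum ρ κ Ω (u ^ 2) x

/-- The mode coefficients of `thermalModel`. -/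
def modelCoeff (ρ κ Ω : ℝ) (p : ℤ × ℤ) : ℂ :=
  ∫ u in Ioc (0 : ℝ) 1, Complex.exp (-((u ^ 2 : ℝ) : ℂ) * modeQ ρ κ Ω p)

lemma continuousOn_thermalModel (hρ : 0 < ρ) (hκ : 0 < κ) (hΩ : |Ω| * ρ < 1) :
    ContinuousOn (thermalModel ρ κ Ω) (coincidenceSet κ)ᶜ := by
  intro x hx
  refine ContinuousAt.continuousWithinAt ?_
  obtain ⟨K, hKn, hKs, hK⟩ := local_compact_nhds
    ((isClosed_coincidenceSet hκ).isOpen_compl.mem_nhds hx)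
  obtain ⟨C, hC⟩ := exists_norm_heatSum_le hρ hκ hΩ hK hKs
  refine continuousAt_of_dominated (bound := fun _ => C) ?_ ?_ ?_ ?_
  · refine Eventually.of_forall fun y => ?_
    exact (measurable_heatSum.comp (measurable_id.prodMk measurable_const)).aestronglyMeasurable
  · filter_upwards [hKn] with y hy
    refine (ae_restrict_iff' measurableSet_Ioc).2 (Eventually.of_forall fun u hu => hC y hy u hu)
  · simp
  · refine (ae_restrict_iff' measurableSet_Ioc).2 (Eventually.of_forall fun u hu => ?_)
    exact (continuous_heatSum hρ hκ hΩ (pow_pos hu.1 2)).continuousAt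

/-! ### Decay of the mode coefficients of test functions -/

/-- The coefficient of a test function along a mode. -/
def testCoeff (κ : ℝ) (f : ℝ × ℝ → ℂ) (p : ℤ × ℤ) : ℂ := ∫ x, modeWave κ p x * f x

lemma norm_testCoeff_le (κ : ℝ) (f : ℝ × ℝ → ℂ) (p : ℤ × ℤ) : ‖testCoeff κ f p‖ ≤ ∫ x, ‖f x‖ := by
  refine (norm_integral_le_integral_norm _).trans (le_of_eq ?_)
  congr 1; ext x; rw [norm_mul, norm_modeWave, one_mul]

lemma fderiv_modeWave (κ : ℝ) (p : ℤ × ℤ) (x v : ℝ × ℝ) :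
    fderiv ℝ (modeWave κ p) x v =
      Complex.I * ((κ * p.1 * v.1 + p.2 * v.2 : ℝ) : ℂ) * modeWave κ p x := by
  have h : HasFDerivAt (fun x : ℝ × ℝ => (κ * p.1 * x.1 + p.2 * x.2 : ℝ))
      ((κ * p.1) • ContinuousLinearMap.fst ℝ ℝ ℝ + (p.2 : ℝ) • ContinuousLinearMap.snd ℝ ℝ ℝ) x :=
    (((ContinuousLinearMap.fst ℝ ℝ ℝ).hasFDerivAt).const_mul (κ * p.1)).add
      (((ContinuousLinearMap.snd ℝ ℝ ℝ).hasFDerivAt).const_mul (p.2 : ℝ))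
  have h2 := ((Complex.ofRealCLM.hasFDerivAt.comp x h).const_mul Complex.I).cexp
  have e : modeWave κ p = fun x : ℝ × ℝ =>
      Complex.exp (Complex.I * ((κ * p.1 * x.1 + p.2 * x.2 : ℝ) : ℂ)) := by
    funext y; rw [modeWave]; push_cast; rfl
  have h3 := h2.fderiv
  simp only [Function.comp_def, Complex.ofRealCLM_apply] at h3
  rw [e, h3]
  simp
  ring

lemma differentiable_modeWave (κ : ℝ) (p : ℤ × ℤ) : Differentiable ℝ (modeWave κ p) := by
  unfold modeWave; fun_prop

lemma contDiff_fderiv_apply {f : ℝ × ℝ → ℂ} (hf : ContDiff ℝ ∞ f) (v : ℝ × ℝ) :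
    ContDiff ℝ ∞ fun x => fderiv ℝ f x v :=
  (hf.fderiv_right (by simp)).clm_apply contDiff_const

lemma testCoeff_fderiv (κ : ℝ) {f : ℝ × ℝ → ℂ} (hf : ContDiff ℝ ∞ f) (hc : HasCompactSupport f)
    (p : ℤ × ℤ) (v : ℝ × ℝ) : testCoeff κ (fun x => fderiv ℝ f x v) p =
      -(Complex.I * ((κ * p.1 * v.1 + p.2 * v.2 : ℝ) : ℂ)) * testCoeff κ f p := by
  have hw := continuous_modeWave κ p
  have hf' : Continuous fun x => fderiv ℝ f x v := (contDiff_fderiv_apply hf v).continuous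
  have hc' : HasCompactSupport fun x => fderiv ℝ f x v := hc.fderiv_apply ℝ v
  have h := integral_mul_fderiv_eq_neg_fderiv_mul_of_integrable (μ := volume) (f := modeWave κ p)
    (g := f) (v := v) ?_ ?_ ?_ (fun x _ => differentiable_modeWave κ p x)
    (fun x _ => hf.differentiable (by simp) x)
  · rw [testCoeff, h, testCoeff, ← integral_const_mul, ← integral_neg]
    congr 1; ext x; rw [fderiv_modeWave]; ring
  · simp_rw [fderiv_modeWave]
    exact ((continuous_const.mul hw).mul hf.continuous).integrable_of_hasCompactSupport hc.mul_left
  · exact (hw.mul hf').integrable_of_hasCompactSupport hc'.mul_left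
  · exact (hw.mul hf.continuous).integrable_of_hasCompactSupport hc.mul_left

lemma summable_testCoeff (hκ : 0 < κ) {f : ℝ × ℝ → ℂ} (hf : ContDiff ℝ ∞ f)
    (hc : HasCompactSupport f) : Summable fun p => ‖testCoeff κ f p‖ := by
  -- `(1 - ∂_τ²) (1 - ∂_θ²) f` has the coefficient `(1 + κ² n²) (1 + k²)` times that of `f`
  have key : ∀ (g : ℝ × ℝ → ℂ) (v : ℝ × ℝ), ContDiff ℝ ∞ g → HasCompactSupport g →
      ∃ g' : ℝ × ℝ → ℂ, ContDiff ℝ ∞ g' ∧ HasCompactSupport g' ∧ ∀ p : ℤ × ℤ,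
        testCoeff κ g' p = ((1 + (κ * p.1 * v.1 + p.2 * v.2) ^ 2 : ℝ) : ℂ) * testCoeff κ g p := by
    intro g v hg hgc
    have hg1 := contDiff_fderiv_apply hg v
    have hc1 : HasCompactSupport fun x => fderiv ℝ g x v := hgc.fderiv_apply ℝ v
    have hg2 := contDiff_fderiv_apply hg1 v
    have hc2 : HasCompactSupport fun x => fderiv ℝ (fun x => fderiv ℝ g x v) x v :=
      hc1.fderiv_apply ℝ v
    refine ⟨fun x => g x - fderiv ℝ (fun x => fderiv ℝ g x v) x v, hg.sub hg2, hgc.sub hc2, ?_⟩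
    intro p
    have hw := continuous_modeWave κ p
    have e : testCoeff κ (fun x => g x - fderiv ℝ (fun x => fderiv ℝ g x v) x v) p =
        testCoeff κ g p - testCoeff κ (fun x => fderiv ℝ (fun x => fderiv ℝ g x v) x v) p := by
      simp only [testCoeff, mul_sub]
      exact integral_sub ((hw.mul hg.continuous).integrable_of_hasCompactSupport hgc.mul_left)
        ((hw.mul hg2.continuous).integrable_of_hasCompactSupport hc2.mul_left)
    rw [e, testCoeff_fderiv κ hg1 hc1, testCoeff_fderiv κ hg hgc]
    push_cast
    linear_combination (-(κ * p.1 * v.1 + p.2 * v.2) ^ 2 * testCoeff κ g p : ℂ) * Complex.I_sq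
  obtain ⟨g, hg, hgc, hgt⟩ := key f (1, 0) hf hc
  obtain ⟨h, hh, hhc, hht⟩ := key g (0, 1) hg hgc
  have hs := (summable_one_div_one_add_mul_int_sq (pow_pos hκ 2)).mul_of_nonneg
    (summable_one_div_one_add_mul_int_sq one_pos) (fun _ => by positivity) (fun _ => by positivity)
  refine (hs.mul_left (∫ x, ‖h x‖)).of_nonneg_of_le (fun _ => norm_nonneg _) fun p => ?_
  have h1 := norm_testCoeff_le κ h p
  rw [hht, hgt, norm_mul, norm_mul, Complex.norm_real, Complex.norm_real,
    Real.norm_of_nonneg (by positivity), Real.norm_of_nonneg (by positivity)] at h1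
  rw [div_mul_div_comm, one_mul, mul_one_div, le_div_iff₀ (by positivity)]
  refine le_trans (le_of_eq ?_) h1
  ring

/-! ### Mode sums -/

lemma IsModeSum.hasSum {c : ℤ → ℤ → ℂ} {F : ℝ × ℝ → ℂ} (h : IsModeSum κ c F) {f : ℝ × ℝ → ℂ}
    (hf : ContDiff ℝ ∞ f) (hc : HasCompactSupport f) (hs : tsupport f ⊆ (coincidenceSet κ)ᶜ) :
    HasSum (fun p : ℤ × ℤ => c p.1 p.2 * testCoeff κ f p) (∫ x, F x * f x) := h.2 f hf hc hs

lemma integrable_mul_of_tsupport_subset {F f : ℝ × ℝ → ℂ} {s : Set (ℝ × ℝ)}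
    (hF : ContinuousOn F s) (hf : Continuous f) (hc : HasCompactSupport f) (hs : tsupport f ⊆ s) :
    Integrable fun x => F x * f x := by
  have h := ((hF.mono hs).mul hf.continuousOn).integrableOn_compact (μ := volume) hc.isCompact
  refine (integrableOn_iff_integrable_of_support_subset ?_).1 h
  refine (Function.support_mul_subset_right _ _).trans (subset_tsupport f)

lemma IsModeSum.add {c c' : ℤ → ℤ → ℂ} {F F' : ℝ × ℝ → ℂ} (h : IsModeSum κ c F)
    (h' : IsModeSum κ c' F') : IsModeSum κ (fun n k => c n k + c' n k) (fun x => F x + F' x) := by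
  refine ⟨h.1.add h'.1, fun f hf hc hs => ?_⟩
  have h1 := (h.hasSum hf hc hs).add (h'.hasSum hf hc hs)
  rw [← integral_add (integrable_mul_of_tsupport_subset h.1 hf.continuous hc hs)
    (integrable_mul_of_tsupport_subset h'.1 hf.continuous hc hs)] at h1
  simp only [← add_mul] at h1
  exact h1

lemma IsModeSum.const_mul {c : ℤ → ℤ → ℂ} {F : ℝ × ℝ → ℂ} (h : IsModeSum κ c F) (a : ℂ) :
    IsModeSum κ (fun n k => a * c n k) (fun x => a * F x) := by
  refine ⟨continuousOn_const.mul h.1, fun f hf hc hs => ?_⟩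
  have h1 := (h.hasSum hf hc hs).mul_left a
  rw [← integral_const_mul] at h1
  simp only [← mul_assoc] at h1
  exact h1

lemma continuous_tsum_modeWave {c : ℤ × ℤ → ℂ} (hc : Summable fun p => ‖c p‖) :
    Continuous fun x => ∑' p, c p * modeWave κ p x :=
  continuous_tsum (fun p => continuous_const.mul (continuous_modeWave κ p)) hc fun p x => by
    rw [norm_mul, norm_modeWave, mul_one]

/-- An absolutely convergent Fourier series is the mode sum of its coefficients. -/
lemma hasSum_mul_testCoeff {c : ℤ × ℤ → ℂ} (hc : Summable fun p => ‖c p‖) {f : ℝ × ℝ → ℂ}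
    (hf : Continuous f) (hfc : HasCompactSupport f) :
    HasSum (fun p => c p * testCoeff κ f p) (∫ x, (∑' p, c p * modeWave κ p x) * f x) := by
  have hfi : Integrable f := hf.integrable_of_hasCompactSupport hfc
  have h := hasSum_integral_of_summable_integral_norm (μ := volume)
    (F := fun (p : ℤ × ℤ) (x : ℝ × ℝ) => c p * (modeWave κ p x * f x)) (fun p =>
      (((continuous_modeWave κ p).mul hf).integrable_of_hasCompactSupport hfc.mul_left).const_mul _)
    (by
      simp only [norm_mul, norm_modeWave, one_mul, integral_const_mul]
      exact hc.mul_right _)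
  simp only [integral_const_mul] at h
  have e : ∀ x, ∑' p, c p * (modeWave κ p x * f x) = (∑' p, c p * modeWave κ p x) * f x :=
    fun x => by simp only [← mul_assoc, tsum_mul_right]
  simp only [e] at h
  exact h

lemma isModeSum_of_summable {c : ℤ → ℤ → ℂ} (hc : Summable fun p : ℤ × ℤ => ‖c p.1 p.2‖) :
    IsModeSum κ c (fun x => ∑' p : ℤ × ℤ, c p.1 p.2 * modeWave κ p x) :=
  ⟨(continuous_tsum_modeWave hc).continuousOn, fun _ hf hfc _ =>
    hasSum_mul_testCoeff hc hf.continuous hfc⟩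

lemma norm_exp_neg_mul_modeQ_le_one (hρ : 0 < ρ) (hΩ : |Ω| * ρ < 1) {t : ℝ} (ht : 0 ≤ t)
    (p : ℤ × ℤ) : ‖Complex.exp (-t * modeQ ρ κ Ω p)‖ ≤ 1 := by
  have h1 : 0 ≤ (modeQ ρ κ Ω p).re := by
    rw [modeQ_re]
    have := (one_sub_sq_pos hρ hΩ).le
    positivity
  have h2 : (-(t : ℂ) * modeQ ρ κ Ω p).re = -(t * (modeQ ρ κ Ω p).re) := by simp
  rw [Complex.norm_exp, h2, Real.exp_le_one_iff]
  have := mul_nonneg ht h1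
  linarith

lemma integrable_norm_comp_fst {f : ℝ × ℝ → ℂ} (hf : Integrable f) (μ : Measure ℝ)
    [IsFiniteMeasure μ] (C : ℝ) :
    Integrable (fun q : (ℝ × ℝ) × ℝ => C * ‖f q.1‖) ((volume : Measure (ℝ × ℝ)).prod μ) := by
  have h := hf.norm.comp_fst μ
  exact h.const_mul C

lemma measurable_heatSum_mul {f : ℝ × ℝ → ℂ} (hf : Measurable f) :
    Measurable fun q : (ℝ × ℝ) × ℝ => heatSum ρ κ Ω (q.2 ^ 2) q.1 * f q.1 := by
  have h1 : Measurable fun q : (ℝ × ℝ) × ℝ => heatSum ρ κ Ω (q.2 ^ 2) q.1 :=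
    Measurable.comp (f := fun q : (ℝ × ℝ) × ℝ => (q.2, q.1)) measurable_heatSum
      (measurable_snd.prodMk measurable_fst)
  exact h1.mul (hf.comp measurable_fst)

/-- Away from coincidence the mode sum of the model converges to it as a distribution. -/
theorem isModeSum_thermalModel (hρ : 0 < ρ) (hκ : 0 < κ) (hΩ : |Ω| * ρ < 1) :
    IsModeSum κ (fun n k => modelCoeff ρ κ Ω (n, k)) (thermalModel ρ κ Ω) := by
  refine ⟨continuousOn_thermalModel hρ hκ hΩ, fun f hf hc hs => ?_⟩
  change HasSum (fun p : ℤ × ℤ => modelCoeff ρ κ Ω p * testCoeff κ f p) _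
  have hfs := summable_testCoeff hκ hf hc
  set μ : Measure ℝ := volume.restrict (Ioc (0 : ℝ) 1) with hμ
  obtain ⟨C, hC⟩ := exists_norm_heatSum_le hρ hκ hΩ hc.isCompact hs
  have hfi : Integrable f := hf.continuous.integrable_of_hasCompactSupport hc
  have hint : Integrable (Function.uncurry fun (x : ℝ × ℝ) (u : ℝ) =>
      heatSum ρ κ Ω (u ^ 2) x * f x) (volume.prod μ) := by
    refine (integrable_norm_comp_fst hfi μ C).mono' ?_ ?_
    · exact (measurable_heatSum_mul hf.continuous.measurable).aestronglyMeasurable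
    · have hae : ∀ᵐ q : (ℝ × ℝ) × ℝ ∂(volume.prod μ), q.2 ∈ Ioc (0 : ℝ) 1 :=
        Measure.quasiMeasurePreserving_snd.ae (ae_restrict_mem measurableSet_Ioc)
      filter_upwards [hae] with q hq
      simp only [Function.uncurry, norm_mul]
      by_cases hx : q.1 ∈ tsupport f
      · gcongr
        exact hC q.1 hx q.2 hq
      · rw [image_eq_zero_of_notMem_tsupport hx]; simp
  have e1 : ∫ x, thermalModel ρ κ Ω x * f x =
      ∫ u, ∫ x, heatSum ρ κ Ω (u ^ 2) x * f x ∂volume ∂μ := by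
    rw [← integral_integral_swap hint]
    congr 1; ext x
    rw [thermalModel, integral_mul_const]
  rw [e1]
  have e2 : ∀ u ∈ Ioc (0 : ℝ) 1, HasSum (fun p : ℤ × ℤ =>
      Complex.exp (-((u ^ 2 : ℝ) : ℂ) * modeQ ρ κ Ω p) * testCoeff κ f p)
      (∫ x, heatSum ρ κ Ω (u ^ 2) x * f x) := fun u hu => by
    have h := (summable_exp_mul_modeWave (x := 0) hρ hκ hΩ (pow_pos hu.1 2)).norm
    simp only [norm_mul, norm_modeWave, mul_one] at h
    exact hasSum_mul_testCoeff h hf.continuous hc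
  have hcont : ∀ p : ℤ × ℤ, Continuous fun u : ℝ =>
      Complex.exp (-((u ^ 2 : ℝ) : ℂ) * modeQ ρ κ Ω p) := fun p => by fun_prop
  have h := hasSum_integral_of_dominated_convergence (μ := μ)
    (F := fun (p : ℤ × ℤ) (u : ℝ) =>
      Complex.exp (-((u ^ 2 : ℝ) : ℂ) * modeQ ρ κ Ω p) * testCoeff κ f p)
    (f := fun u => ∫ x, heatSum ρ κ Ω (u ^ 2) x * f x) (fun p _ => ‖testCoeff κ f p‖)
    (fun p => ((hcont p).mul continuous_const).aestronglyMeasurable)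
    (fun p => Eventually.of_forall fun u => by
      rw [norm_mul]
      exact mul_le_of_le_one_left (norm_nonneg _)
        (norm_exp_neg_mul_modeQ_le_one hρ hΩ (sq_nonneg u) p))
    (Eventually.of_forall fun _ => hfs) (integrable_const _)
    ((ae_restrict_iff' measurableSet_Ioc).2 (Eventually.of_forall e2))
  simp only [integral_mul_const] at h
  exact h

/-! ### The singularity of the model -/

/-- The contribution of the direct image, by the substitution `u = 1 / v`. -/
lemma integral_direct_image {θ : ℝ} (hθ : 0 < θ) :
    ∫ u in Ioc (0 : ℝ) 1, 1 / u ^ 2 * Real.exp (-(θ ^ 2 / (4 * u ^ 2))) =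
      √Real.pi / θ - ∫ v in Ioc (0 : ℝ) 1, Real.exp (-(θ ^ 2 / 4) * v ^ 2) := by
  set g : ℝ → ℝ := (Ici (1 : ℝ)).indicator fun v => Real.exp (-(θ ^ 2 / 4) * v ^ 2) with hg
  have h := integral_comp_rpow_Ioi g (p := -1) (by norm_num)
  have hb : 0 < θ ^ 2 / 4 := by positivity
  have hgi : Integrable fun v : ℝ => Real.exp (-(θ ^ 2 / 4) * v ^ 2) := integrable_exp_neg_mul_sq hb
  have e1 : ∫ u in Ioi (0 : ℝ), (|(-1 : ℝ)| * u ^ ((-1 : ℝ) - 1)) • g (u ^ (-1 : ℝ)) =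
      ∫ u in Ioc (0 : ℝ) 1, 1 / u ^ 2 * Real.exp (-(θ ^ 2 / (4 * u ^ 2))) := by
    have e : Ioi (0 : ℝ) ∩ Ioc 0 1 = Ioc 0 1 := inter_eq_right.2 fun u hu => hu.1
    rw [← e, ← setIntegral_indicator measurableSet_Ioc]
    refine setIntegral_congr_fun measurableSet_Ioi fun u hu => ?_
    have hu : 0 < u := hu
    have e2 : u ^ ((-1 : ℝ) - 1) = 1 / u ^ 2 := by
      rw [show (-1 : ℝ) - 1 = -((2 : ℕ) : ℝ) by norm_num, Real.rpow_neg hu.le, Real.rpow_natCast,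
        one_div]
    simp only [e2, abs_neg, abs_one, one_mul, smul_eq_mul, Real.rpow_neg_one, hg]
    by_cases h1 : u ≤ 1
    · have h2 : (1 : ℝ) ≤ u⁻¹ := (one_le_inv₀ hu).2 h1
      rw [indicator_of_mem (mem_Ici.2 h2), indicator_of_mem (show u ∈ Ioc (0 : ℝ) 1 from ⟨hu, h1⟩)]
      congr 2
      field_simp
    · have h2 : ¬ (1 : ℝ) ≤ u⁻¹ := fun h => h1 ((one_le_inv₀ hu).1 h)
      rw [indicator_of_notMem (by simpa using h2), indicator_of_notMem (by simp [h1]), mul_zero]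
  have e2 : ∫ v in Ioi (0 : ℝ), g v = ∫ v in Ioi (1 : ℝ), Real.exp (-(θ ^ 2 / 4) * v ^ 2) := by
    have e : Ioi (0 : ℝ) ∩ Ici 1 = Ici 1 :=
      inter_eq_right.2 fun u hu => lt_of_lt_of_le one_pos (mem_Ici.1 hu)
    rw [hg, setIntegral_indicator measurableSet_Ici, e, integral_Ici_eq_integral_Ioi]
  have e3 : ∫ v in Ioi (0 : ℝ), Real.exp (-(θ ^ 2 / 4) * v ^ 2) = √Real.pi / θ := by
    rw [integral_gaussian_Ioi]
    have : Real.pi / (θ ^ 2 / 4) = Real.pi * (2 / θ) ^ 2 := by field_simp; norm_num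
    rw [this, Real.sqrt_mul Real.pi_pos.le, Real.sqrt_sq (by positivity)]
    ring
  have e4 : ∫ v in Ioi (0 : ℝ), Real.exp (-(θ ^ 2 / 4) * v ^ 2) =
      (∫ v in Ioc (0 : ℝ) 1, Real.exp (-(θ ^ 2 / 4) * v ^ 2))
        + ∫ v in Ioi (1 : ℝ), Real.exp (-(θ ^ 2 / 4) * v ^ 2) := by
    rw [← Ioc_union_Ioi_eq_Ioi zero_le_one]
    exact setIntegral_union (Ioc_disjoint_Ioi le_rfl) measurableSet_Ioi hgi.integrableOn
      hgi.integrableOn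
  rw [← e1, h, e2]
  linarith

lemma tendsto_integral_gaussian_zero :
    Tendsto (fun θ : ℝ => ∫ v in Ioc (0 : ℝ) 1, Real.exp (-(θ ^ 2 / 4) * v ^ 2))
      (𝓝[>] 0) (𝓝 1) := by
  have h : ContinuousAt (fun θ : ℝ => ∫ v in Ioc (0 : ℝ) 1, Real.exp (-(θ ^ 2 / 4) * v ^ 2)) 0 := by
    refine continuousAt_of_dominated (bound := fun _ => 1) ?_ ?_ ?_ ?_
    · exact Eventually.of_forall fun θ => Continuous.aestronglyMeasurable (by fun_prop)
    · refine Eventually.of_forall fun θ => Eventually.of_forall fun v => ?_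
      rw [Real.norm_of_nonneg (Real.exp_pos _).le, Real.exp_le_one_iff]
      have : 0 ≤ θ ^ 2 / 4 * v ^ 2 := by positivity
      linarith
    · exact integrable_const _
    · exact Eventually.of_forall fun v => Continuous.continuousAt (by fun_prop)
  have h2 := h.tendsto.mono_left (nhdsWithin_le_nhds (s := Ioi (0 : ℝ)))
  simpa using h2

/-- Near coincidence the model has the singularity of the direct image and a finite remainder. -/
theorem tendsto_thermalModel_sub (hρ : 0 < ρ) (hκ : 0 < κ) (hΩ : |Ω| * ρ < 1) :
    ∃ L : ℂ, Tendsto (fun θ : ℝ => thermalModel ρ κ Ω (0, θ)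
      - ((Real.pi * √Real.pi / (ρ * κ * θ) : ℝ) : ℂ)) (𝓝[>] 0) (𝓝 L) := by
  have hpi := Real.pi_pos
  -- the nearest image other than the direct one is a full period away
  set d := min ((Real.pi / κ) ^ 2) (Real.pi ^ 2) with hd
  have hdpos : 0 < d := lt_min (by positivity) (by positivity)
  have hfar : ∀ θ : ℝ, |θ| ≤ 1 → ∀ p ∈ ({0}ᶜ : Set (ℤ × ℤ)),
      d ≤ (imagePoint κ p (0, θ)).1 ^ 2 + (imagePoint κ p (0, θ)).2 ^ 2 := by
    intro θ hθ p hp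
    simp only [imagePoint]
    by_cases h1 : p.1 = 0
    · have h2 : p.2 ≠ 0 := fun h2 => hp (Prod.ext h1 h2)
      have h3 : (1 : ℝ) ≤ |(p.2 : ℝ)| := by exact_mod_cast Int.one_le_abs h2
      have h4 : Real.pi ≤ |θ - 2 * Real.pi * p.2| := by
        have h5 : |2 * Real.pi * (p.2 : ℝ)| - |θ| ≤ |θ - 2 * Real.pi * p.2| := by
          rw [abs_sub_comm θ]; exact abs_sub_abs_le_abs_sub _ _
        have h6 : |2 * Real.pi * (p.2 : ℝ)| = 2 * Real.pi * |(p.2 : ℝ)| := by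
          rw [abs_mul, abs_of_pos (by positivity)]
        have h7 := Real.pi_gt_three
        nlinarith
      have h8 : Real.pi ^ 2 ≤ (θ - 2 * Real.pi * p.2) ^ 2 := by
        rw [← sq_abs (θ - 2 * Real.pi * p.2)]; gcongr
      have := min_le_right ((Real.pi / κ) ^ 2) (Real.pi ^ 2)
      have := sq_nonneg (0 - 2 * Real.pi * p.1 / κ)
      linarith
    · have h3 : (1 : ℝ) ≤ (p.1 : ℝ) ^ 2 := by
        have : (1 : ℝ) ≤ |(p.1 : ℝ)| := by exact_mod_cast Int.one_le_abs h1
        rw [← sq_abs]; nlinarith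
      have h4 : (Real.pi / κ) ^ 2 ≤ (0 - 2 * Real.pi * p.1 / κ) ^ 2 := by
        have : (0 - 2 * Real.pi * p.1 / κ) ^ 2 = 4 * (Real.pi / κ) ^ 2 * (p.1 : ℝ) ^ 2 := by ring
        rw [this]
        have : 0 ≤ (Real.pi / κ) ^ 2 := sq_nonneg _
        nlinarith
      have := min_le_left ((Real.pi / κ) ^ 2) (Real.pi ^ 2)
      have := sq_nonneg (θ - 2 * Real.pi * p.2)
      linarith
  obtain ⟨C, hC⟩ := exists_norm_imageSum_le hρ hκ hΩ 1 hdpos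
  have hCθ : ∀ θ : ℝ, |θ| ≤ 1 → ∀ u ∈ Ioc (0 : ℝ) 1,
      ‖imageSum ρ κ Ω {0}ᶜ (u ^ 2) (0, θ)‖ ≤ C := fun θ hθ u hu =>
    hC _ _ (by simp only; rw [← sq_abs θ]; nlinarith [abs_nonneg θ]) (hfar θ hθ) u hu
  set direct : ℝ → ℝ → ℂ := fun θ u => ((Real.pi / (u ^ 2 * ρ * κ) : ℝ) : ℂ)
      * Complex.exp (-dualQ ρ Ω (0, θ) / (4 * (u ^ 2 : ℝ))) with hdirect
  have hrest_eq : ∀ θ : ℝ, ∀ u ∈ Ioc (0 : ℝ) 1, imageSum ρ κ Ω {0}ᶜ (u ^ 2) (0, θ) =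
      heatSum ρ κ Ω (u ^ 2) (0, θ) - direct θ u := fun θ u hu => by
    rw [heatSum_eq_add hρ hκ hΩ (pow_pos hu.1 2)]; simp only [hdirect]; ring
  have hdirect_eq : ∀ θ u : ℝ, direct θ u = ((Real.pi / (ρ * κ) *
      (1 / u ^ 2 * Real.exp (-(θ ^ 2 / (4 * u ^ 2)))) : ℝ) : ℂ) := fun θ u => by
    have e1 : dualQ ρ Ω (0, θ) = ((θ ^ 2 : ℝ) : ℂ) := by simp [dualQ]
    simp only [hdirect]
    rw [e1, show (-((θ ^ 2 : ℝ) : ℂ) / (4 * (u ^ 2 : ℝ))) = ((-(θ ^ 2 / (4 * u ^ 2)) : ℝ) : ℂ) by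
      push_cast; ring, ← Complex.ofReal_exp, ← Complex.ofReal_mul]
    congr 1
    simp only [div_eq_mul_inv, mul_inv]
    ring
  have hmeas : ∀ θ : ℝ, AEStronglyMeasurable (fun u => imageSum ρ κ Ω {0}ᶜ (u ^ 2) (0, θ))
      (volume.restrict (Ioc (0 : ℝ) 1)) := fun θ => by
    have h1 : Measurable fun u : ℝ => heatSum ρ κ Ω (u ^ 2) (0, θ) - direct θ u := by
      refine (measurable_heatSum.comp (measurable_id.prodMk measurable_const)).sub ?_
      rw [show direct θ = _ from funext (hdirect_eq θ)]
      fun_prop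
    refine h1.aestronglyMeasurable.congr ?_
    filter_upwards [ae_restrict_mem measurableSet_Ioc] with u hu using (hrest_eq θ u hu).symm
  have hcont : ContinuousAt (fun θ : ℝ => ∫ u in Ioc (0 : ℝ) 1,
      imageSum ρ κ Ω {0}ᶜ (u ^ 2) (0, θ)) 0 := by
    refine continuousAt_of_dominated (bound := fun _ => C) (Eventually.of_forall hmeas) ?_
      (integrable_const _) ?_
    · have : ∀ᶠ θ : ℝ in 𝓝 0, |θ| ≤ 1 := by
        filter_upwards [Metric.closedBall_mem_nhds (0 : ℝ) one_pos] with θ hθ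
        simpa using hθ
      filter_upwards [this] with θ hθ
      filter_upwards [ae_restrict_mem measurableSet_Ioc] with u hu using hCθ θ hθ u hu
    · filter_upwards [ae_restrict_mem measurableSet_Ioc] with u hu
      have : (fun θ : ℝ => imageSum ρ κ Ω {0}ᶜ (u ^ 2) (0, θ)) =
          fun θ => heatSum ρ κ Ω (u ^ 2) (0, θ) - direct θ u := funext fun θ => hrest_eq θ u hu
      rw [this]
      refine Continuous.continuousAt (Continuous.sub ?_ ?_)
      · exact (continuous_heatSum hρ hκ hΩ (pow_pos hu.1 2)).comp (by fun_prop)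
      · simp_rw [hdirect_eq]; fun_prop
  refine ⟨(∫ u in Ioc (0 : ℝ) 1, imageSum ρ κ Ω {0}ᶜ (u ^ 2) (0, 0))
    - ((Real.pi / (ρ * κ) * 1 : ℝ) : ℂ), ?_⟩
  have hlim := (hcont.tendsto.mono_left (nhdsWithin_le_nhds (s := Ioi (0 : ℝ)))).sub
    ((Complex.continuous_ofReal.tendsto _).comp
      (tendsto_integral_gaussian_zero.const_mul (Real.pi / (ρ * κ))))
  refine hlim.congr' ?_
  filter_upwards [Ioo_mem_nhdsGT one_pos] with θ hθ
  have hθ1 : |θ| ≤ 1 := by rw [abs_of_pos hθ.1]; exact hθ.2.le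
  have hI1 : IntegrableOn (fun u => imageSum ρ κ Ω {0}ᶜ (u ^ 2) (0, θ)) (Ioc (0 : ℝ) 1) :=
    (integrable_const C).mono' (hmeas θ) (by
      filter_upwards [ae_restrict_mem measurableSet_Ioc] with u hu using hCθ θ hθ1 u hu)
  have hI2 : IntegrableOn (fun u => direct θ u) (Ioc (0 : ℝ) 1) := by
    simp_rw [hdirect_eq]
    refine Integrable.ofReal (Integrable.const_mul ?_ _)
    refine (integrable_const (4 / θ ^ 2)).mono' (
      Measurable.aestronglyMeasurable (by fun_prop)) ?_
    filter_upwards [ae_restrict_mem measurableSet_Ioc] with u hu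
    have hu0 := hu.1
    have hθ0 := hθ.1
    rw [Real.norm_of_nonneg (by positivity), Real.exp_neg]
    have h1 : θ ^ 2 / (4 * u ^ 2) ≤ Real.exp (θ ^ 2 / (4 * u ^ 2)) := by
      linarith [Real.add_one_le_exp (θ ^ 2 / (4 * u ^ 2))]
    calc 1 / u ^ 2 * (Real.exp (θ ^ 2 / (4 * u ^ 2)))⁻¹ ≤ 1 / u ^ 2 * (θ ^ 2 / (4 * u ^ 2))⁻¹ := by
          gcongr
      _ = _ := by field_simp
  have e1 : thermalModel ρ κ Ω (0, θ) = (∫ u in Ioc (0 : ℝ) 1, imageSum ρ κ Ω {0}ᶜ (u ^ 2) (0, θ))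
      + ∫ u in Ioc (0 : ℝ) 1, direct θ u := by
    rw [← integral_add hI1 hI2, thermalModel]
    refine setIntegral_congr_fun measurableSet_Ioc fun u hu => ?_
    simp only [hrest_eq θ u hu, sub_add_cancel]
  have e2 : ∫ u in Ioc (0 : ℝ) 1, direct θ u = ((Real.pi / (ρ * κ) * (√Real.pi / θ -
      ∫ v in Ioc (0 : ℝ) 1, Real.exp (-(θ ^ 2 / 4) * v ^ 2)) : ℝ) : ℂ) := by
    simp_rw [hdirect_eq]
    rw [integral_complex_ofReal, integral_const_mul, integral_direct_image hθ.1]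
  rw [e1, e2]
  simp only [Function.comp]
  push_cast
  field_simp
  ring

/-! ### Comparison of the model with the leading asymptotics -/

/-- The coefficients of the model are those of `√π / (2 √Q)`, up to the tail
`∫_1^∞ e^{-u² Q} du`. -/
lemma summable_model_sub (hρ : 0 < ρ) (hκ : 0 < κ) (hΩ : |Ω| * ρ < 1) :
    Summable fun p : ℤ × ℤ => if p = 0 then 0 else
      ‖1 / (2 * csqrt (modeQ ρ κ Ω p)) - ((1 / √Real.pi : ℝ) : ℂ) * modelCoeff ρ κ Ω p‖ := by
  obtain ⟨c, hc, hle⟩ := exists_le_modeQ_re hρ hκ hΩ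
  have hpi := Real.pi_pos
  have hsp := Real.sqrt_pos.2 hpi
  set I := ∫ u in Ioi (1 : ℝ), Real.exp (-(c / 2) * u ^ 2) with hI
  refine summable_of_norm_le_gaussian (C := 1 / √Real.pi * I) (c := c / 2) (by positivity)
    fun p => ?_
  have hI0 : 0 ≤ I := integral_nonneg fun u => (Real.exp_pos _).le
  by_cases hp : p = 0
  · rw [if_pos hp, norm_zero]; positivity
  rw [if_neg hp, norm_norm]
  set Q := modeQ ρ κ Ω p with hQ
  have hp1 : (1 : ℝ) ≤ (p.1 : ℝ) ^ 2 + (p.2 : ℝ) ^ 2 := by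
    have : (1 : ℤ) ≤ p.1 ^ 2 + p.2 ^ 2 := by
      by_contra! h
      have h1 : p.1 = 0 := by nlinarith [sq_nonneg p.1, sq_nonneg p.2]
      have h2 : p.2 = 0 := by nlinarith [sq_nonneg p.1, sq_nonneg p.2]
      exact hp (Prod.ext h1 h2)
    exact_mod_cast this
  have hQc : c * ((p.1 : ℝ) ^ 2 + (p.2 : ℝ) ^ 2) ≤ Q.re := hle p
  have hQ0 : 0 < Q.re := lt_of_lt_of_le (by positivity) hQc
  have hQne : Q ≠ 0 := by intro h; simp [h] at hQ0
  have hcs : csqrt ((Real.pi : ℂ) / Q) = √Real.pi / csqrt Q := by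
    refine csqrt_eq_of_sq_eq ?_ ?_
    · rw [div_pow, csqrt_sq, ← Complex.ofReal_pow, Real.sq_sqrt hpi.le]
    · rw [Complex.div_re]
      simp only [Complex.ofReal_re, Complex.ofReal_im, zero_mul, zero_div, add_zero]
      have := csqrt_re_pos hQ0
      have := Complex.normSq_pos.2 (csqrt_ne_zero hQne)
      positivity
  have hgi := integrable_cexp_neg_mul_sq hQ0
  have hfull := integral_gaussian_complex_Ioi hQ0
  change _ = csqrt ((Real.pi : ℂ) / Q) / 2 at hfull
  rw [hcs, ← Ioc_union_Ioi_eq_Ioi zero_le_one, setIntegral_union (Ioc_disjoint_Ioi le_rfl)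
    measurableSet_Ioi hgi.integrableOn hgi.integrableOn] at hfull
  have hmc : modelCoeff ρ κ Ω p = ∫ u in Ioc (0 : ℝ) 1, Complex.exp (-Q * (u : ℂ) ^ 2) := by
    rw [modelCoeff, ← hQ]; congr 1; ext u; push_cast; ring_nf
  rw [← hmc] at hfull
  have hdiff : 1 / (2 * csqrt Q) - ((1 / √Real.pi : ℝ) : ℂ) * modelCoeff ρ κ Ω p =
      ((1 / √Real.pi : ℝ) : ℂ) * ∫ u in Ioi (1 : ℝ), Complex.exp (-Q * (u : ℂ) ^ 2) := by
    have h1 : ((1 / √Real.pi : ℝ) : ℂ) * √Real.pi = 1 := by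
      rw [← Complex.ofReal_mul, one_div_mul_cancel hsp.ne']; simp
    have h2 : 1 / (2 * csqrt Q) = ((1 / √Real.pi : ℝ) : ℂ) * (√Real.pi / csqrt Q / 2) := by
      rw [← mul_div_assoc, ← mul_div_assoc, h1, div_div, mul_comm (csqrt Q)]
    rw [h2, ← hfull]; ring
  rw [hdiff, norm_mul, Complex.norm_real, Real.norm_of_nonneg (by positivity), mul_assoc]
  gcongr
  refine (norm_integral_le_integral_norm _).trans ?_
  rw [hI, ← integral_mul_const]
  have hgr : Integrable fun u : ℝ => Real.exp (-(c / 2) * u ^ 2) :=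
    integrable_exp_neg_mul_sq (by positivity)
  refine setIntegral_mono_on hgi.norm.integrableOn
    (hgr.mul_const _).integrableOn measurableSet_Ioi ?_
  intro u hu
  have hu : 1 < u := hu
  have e : (-Q * (u : ℂ) ^ 2).re = -(Q.re * u ^ 2) := by
    rw [← Complex.ofReal_pow, Complex.re_mul_ofReal, Complex.neg_re, neg_mul]
  rw [Complex.norm_exp, e, ← Real.exp_add]
  refine Real.exp_le_exp.2 ?_
  set N := (p.1 : ℝ) ^ 2 + (p.2 : ℝ) ^ 2 with hN
  have h1 : c * N * u ^ 2 ≤ Q.re * u ^ 2 := by gcongr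
  have h2 : (1 : ℝ) ≤ u ^ 2 := by nlinarith
  have h3 : u ^ 2 + N ≤ 2 * (N * u ^ 2) := by nlinarith
  nlinarith

end

/-! ### Absolute convergence of the mode-by-mode differences -/

/-- Bounds of order `λ⁻³`, with `λ² = n² + k²`, outside a disc suffice for absolute convergence over
the two-dimensional lattice of modes. -/
lemma summable_norm_of_le_div_pow_three {e : ℤ × ℤ → ℂ} {C L : ℝ}
    (h : ∀ p : ℤ × ℤ, L ≤ √((p.1 : ℝ) ^ 2 + (p.2 : ℝ) ^ 2) →
      ‖e p‖ ≤ C / √((p.1 : ℝ) ^ 2 + (p.2 : ℝ) ^ 2) ^ 3) : Summable fun p => ‖e p‖ := by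
  refine Summable.of_norm_bounded_eventually (summable_one_div_sqrt_pow_three.mul_left C) ?_
  rw [eventually_cofinite]
  refine ((finite_Icc (-⌈L⌉) ⌈L⌉).prod (finite_Icc (-⌈L⌉) ⌈L⌉)).subset fun p hp => ?_
  have hlt : √((p.1 : ℝ) ^ 2 + (p.2 : ℝ) ^ 2) < L := by
    by_contra! hle
    refine hp ?_
    rw [norm_norm, mul_one_div]
    exact h p hle
  have h1 : |(p.1 : ℝ)| ≤ ⌈L⌉ :=
    ((Real.abs_le_sqrt (by nlinarith [sq_nonneg (p.2 : ℝ)])).trans hlt.le).trans (Int.le_ceil L)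
  have h2 : |(p.2 : ℝ)| ≤ ⌈L⌉ :=
    ((Real.abs_le_sqrt (by nlinarith [sq_nonneg (p.1 : ℝ)])).trans hlt.le).trans (Int.le_ceil L)
  exact ⟨abs_le.1 (by exact_mod_cast h1), abs_le.1 (by exact_mod_cast h2)⟩

lemma tsum_angular_eq {c : ℤ → ℤ → ℂ} (hc : Summable fun p : ℤ × ℤ => ‖c p.1 p.2‖) (κ θ : ℝ) :
    ∑' k : ℤ, Complex.exp (Complex.I * k * θ) * ∑' n : ℤ, c n k =
      ∑' p : ℤ × ℤ, c p.1 p.2 * modeWave κ p (0, θ) := by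
  have hs : Summable fun p : ℤ × ℤ => c p.1 p.2 * modeWave κ p (0, θ) :=
    Summable.of_norm (by simpa only [norm_mul, norm_modeWave, mul_one] using hc)
  rw [← (Equiv.prodComm ℤ ℤ).tsum_eq, Summable.tsum_prod (f := fun q : ℤ × ℤ =>
    c ((Equiv.prodComm ℤ ℤ) q).1 ((Equiv.prodComm ℤ ℤ) q).2
      * modeWave κ ((Equiv.prodComm ℤ ℤ) q) (0, θ)) ((Equiv.prodComm ℤ ℤ).summable_iff.2 hs)]
  refine tsum_congr fun k => ?_
  rw [← tsum_mul_left]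
  refine tsum_congr fun n => ?_
  simp only [Equiv.prodComm_apply, Prod.swap_prod_mk, modeWave, Complex.ofReal_zero, mul_zero,
    zero_add, mul_assoc]
  ring

lemma tendsto_tsum_angular {c : ℤ → ℤ → ℂ} (hc : Summable fun p : ℤ × ℤ => ‖c p.1 p.2‖) :
    Tendsto (fun θ : ℝ => ∑' k : ℤ, Complex.exp (Complex.I * k * θ) * ∑' n : ℤ, c n k)
      (𝓝[>] 0) (𝓝 (∑' k : ℤ, ∑' n : ℤ, c n k)) := by
  have h : Continuous fun θ : ℝ =>
      ∑' k : ℤ, Complex.exp (Complex.I * k * θ) * ∑' n : ℤ, c n k := by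
    simp only [tsum_angular_eq hc 1]
    exact (continuous_tsum_modeWave hc).comp (by fun_prop)
  have h0 := (h.tendsto 0).mono_left (nhdsWithin_le_nhds (s := Ioi (0 : ℝ)))
  simpa using h0

/-! ### Thermal modes in rotating Minkowski spacetime -/

lemma rotatingMinkowski_modePotential (ρ κ Ω : ℝ) (p : ℤ × ℤ) :
    (rotatingMinkowski Ω).modePotential κ p.1 p.2 ρ = modeQ ρ κ Ω p := by
  simp [rotatingMinkowski, StationaryMetric.modePotential, modeQ]

/-- Inside the mirror the co-rotating observers of Minkowski spacetime are timelike, so the modes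
have the leading behaviour `1 / (2 √Q)`. -/
theorem rotatingMinkowski_green_asymptotics {κ Ω ρ ρM μ : ℝ} (hκ : 0 < κ) (hρ : 0 < ρ)
    (hρM : ρ < ρM) (hΩM : |Ω| * ρM < 1) {G : ℤ → ℤ → ℝ → ℝ → ℂ}
    (hG : ∀ n k : ℤ, (rotatingMinkowski Ω).IsRadialGreen (fun _ => μ ^ 2) (κ * n) k 0 ρM (G n k)) :
    ∃ C L : ℝ, 0 < C ∧ 1 ≤ L ∧ ∀ n k : ℤ, L ≤ √((n : ℝ) ^ 2 + k ^ 2) →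
      ‖G n k ρ ρ - 1 / (2 * csqrt (modeQ ρ κ Ω (n, k)))‖ ≤ C / √((n : ℝ) ^ 2 + k ^ 2) ^ 3 := by
  have htl : ∀ r ∈ Ioo 0 ρM, r ^ 2 * Ω ^ 2 < 1 := fun r hr => by
    have h1 : |Ω| * r < 1 :=
      (mul_le_mul_of_nonneg_left hr.2.le (abs_nonneg Ω)).trans_lt hΩM
    have h2 : r ^ 2 * Ω ^ 2 = (|Ω| * r) ^ 2 := by rw [mul_pow, sq_abs]; ring
    rw [h2]
    have h3 : 0 ≤ |Ω| * r := mul_nonneg (abs_nonneg Ω) hr.1.le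
    nlinarith
  have h := StationaryMetric.green_asymptotics (M := rotatingMinkowski Ω) hκ hG
    (fun _ _ => one_pos) (fun _ _ => one_pos) (fun r hr => pow_pos hr.1 2)
    contDiffOn_const contDiffOn_const (contDiffOn_id.pow 2) contDiffOn_const
    (fun r hr => by simpa [rotatingMinkowski] using htl r hr) (kP := 1)
    (fun r hr => by
      simp [StationaryMetric.radialCoeff, StationaryMetric.sqrtDet, rotatingMinkowski,
        Real.sqrt_sq hr.1.le])
    ⟨0, fun n k _ r hr => by
      rw [Complex.add_re, StationaryMetric.modePotential_re, StationaryMetric.backgroundPotential,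
        Complex.ofReal_re]
      have := (sub_pos.2 (htl r hr)).le
      simp only [rotatingMinkowski, one_pow]
      positivity⟩
    ⟨|μ ^ 2|, fun _ _ => le_rfl⟩ (r₀ := ρ) ⟨hρ, hρM⟩
  obtain ⟨C, L, hC, hL, hle⟩ := h
  refine ⟨C, L, hC, hL, fun n k hnk => ?_⟩
  rw [← rotatingMinkowski_modePotential]
  exact hle n k hnk

/-! ### Modes of the black hole -/

lemma two_le_smooth : (2 : WithTop ℕ∞) ≤ ∞ := WithTop.coe_le_coe.2 le_top

namespace RotatingBlackHole

variable (B : RotatingBlackHole)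

lemma contDiffOn_lapse : ContDiffOn ℝ 2 B.lapse (Ioo B.rH B.rM) := by
  have h := ((B.contDiffOn_lapse_sq.of_le two_le_smooth).mono
    Ioo_subset_Icc_self).sqrt fun r hr =>
      (pow_pos (B.lapse_pos r (Ioo_subset_Ioc_self hr)) 2).ne'
  refine h.congr fun r hr => ?_
  rw [Real.sqrt_sq (B.lapse_pos r (Ioo_subset_Ioc_self hr)).le]

lemma contDiffOn_grr : ContDiffOn ℝ 2 B.grr (Ioo B.rH B.rM) := by
  obtain ⟨f, hfs, -, hf⟩ := B.contDiffOn_sqrt_grr_mul_lapse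
  have h := (((hfs.of_le two_le_smooth).mono Ioo_subset_Icc_self).pow 2).div
    (B.contDiffOn_lapse.pow 2)
    fun r hr => (pow_pos (B.lapse_pos r (Ioo_subset_Ioc_self hr)) 2).ne'
  exact h.congr fun r hr => B.grr_eq hf r (Ioo_subset_Ioc_self hr)

/-- With the choices `γ = N(r)`, `ρ = γ⁻¹ √g_θθ(r)` and `Ω = N^θ(r) + ΩH`, the leading behaviour of
the modes of the black hole is `γ⁻¹` times that of the modes in Minkowski spacetime. -/
theorem green_asymptotics {m ξ : ℝ} {G : ℤ → ℤ → ℝ → ℝ → ℂ}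
    (hG : ∀ n k : ℤ, B.corotating.IsRadialGreen
      (fun r => m ^ 2 + ξ * B.corotating.scalarCurvature r) (B.κ * n) k B.rH B.rM (G n k))
    {r : ℝ} (hr : r ∈ Ioo B.rH B.rM) :
    ∃ C L : ℝ, 0 < C ∧ 1 ≤ L ∧ ∀ n k : ℤ, L ≤ √((n : ℝ) ^ 2 + k ^ 2) →
      ‖G n k r r - (((B.lapse r)⁻¹ : ℝ) : ℂ) * (1 / (2 * csqrt
        (modeQ ((B.lapse r)⁻¹ * √(B.gθθ r)) B.κ (B.shift r + B.ΩH) (n, k))))‖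
        ≤ C / √((n : ℝ) ^ 2 + k ^ 2) ^ 3 := by
  obtain ⟨K, hK⟩ := B.exists_bound_scalarCurvature
  obtain ⟨kP, hkP⟩ := B.exists_radialCoeff_le
  have hU : ∀ s ∈ Ioo B.rH B.rM,
      |m ^ 2 + ξ * B.corotating.scalarCurvature s| ≤ m ^ 2 + |ξ| * K := fun s hs => by
    refine (abs_add_le _ _).trans ?_
    rw [abs_of_nonneg (sq_nonneg m), abs_mul]
    gcongr
    exact hK s hs
  have htl : ∀ s ∈ Ioo B.rH B.rM, B.gθθ s * (B.shift s + B.ΩH) ^ 2 < B.lapse s ^ 2 :=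
    fun s hs => B.generator_timelike s (Ioo_subset_Ioc_self hs)
  obtain ⟨C, L, hC, hL, hle⟩ := StationaryMetric.green_asymptotics (M := B.corotating) B.κ_pos hG
    (fun s hs => B.lapse_pos s (Ioo_subset_Ioc_self hs))
    (fun s hs => B.grr_pos s (Ioo_subset_Ioc_self hs))
    (fun s hs => B.gθθ_pos s (Ioo_subset_Icc_self hs))
    B.contDiffOn_lapse B.contDiffOn_grr
    ((B.contDiffOn_gθθ.of_le two_le_smooth).mono Ioo_subset_Icc_self)
    (((B.contDiffOn_shift.of_le two_le_smooth).mono Ioo_subset_Icc_self).add contDiffOn_const)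
    htl hkP (B.exists_re_potential_nonneg hU) ⟨_, hU⟩ hr
  refine ⟨C, L, hC, hL, fun n k hnk => ?_⟩
  have hγ := B.lapse_pos r (Ioo_subset_Ioc_self hr)
  have hh := B.gθθ_pos r (Ioo_subset_Icc_self hr)
  set γ := B.lapse r with hγdef
  set ρ := γ⁻¹ * √(B.gθθ r) with hρdef
  set Ω := B.shift r + B.ΩH with hΩdef
  have hρ2 : γ ^ 2 * ρ ^ 2 = B.gθθ r := by
    rw [hρdef, mul_pow, Real.sq_sqrt hh.le]; field_simp
  have hV : B.corotating.modePotential B.κ n k r = (γ : ℂ) ^ 2 * modeQ ρ B.κ Ω (n, k) := by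
    simp only [StationaryMetric.modePotential, corotating, modeQ, ← hγdef, ← hΩdef]
    rw [← hρ2]
    push_cast
    ring
  have hρ0 : 0 < ρ := mul_pos (inv_pos.2 hγ) (Real.sqrt_pos.2 hh)
  have hQ : 0 < (modeQ ρ B.κ Ω (n, k)).re := by
    have h1 : ρ ^ 2 * Ω ^ 2 < 1 := by
      have := htl r hr
      rw [← hρ2] at this
      have h3 : γ ^ 2 * (ρ ^ 2 * Ω ^ 2) < γ ^ 2 * 1 := by linarith
      exact lt_of_mul_lt_mul_left h3 (by positivity)
    have h4 : (1 : ℝ) ≤ (n : ℝ) ^ 2 + k ^ 2 := by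
      rw [← Real.one_le_sqrt]; exact hL.trans hnk
    have hκ := B.κ_pos
    rw [modeQ_re]
    have h5 : 0 < ρ ^ 2 * B.κ ^ 2 := by positivity
    simp only
    rcases eq_or_ne n 0 with rfl | hn
    · have h6 : (0 : ℝ) < (k : ℝ) ^ 2 := by
        simp only [Int.cast_zero, ne_eq, OfNat.ofNat_ne_zero, not_false_eq_true, zero_pow,
          zero_add] at h4
        linarith
      have := mul_pos (sub_pos.2 h1) h6
      positivity
    · have h6 : (0 : ℝ) < (n : ℝ) ^ 2 := by positivity
      have := mul_nonneg (sub_pos.2 h1).le (sq_nonneg (k : ℝ))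
      positivity
  have hs : 1 / (2 * csqrt (B.corotating.modePotential B.κ n k r)) =
      ((γ⁻¹ : ℝ) : ℂ) * (1 / (2 * csqrt (modeQ ρ B.κ Ω (n, k)))) := by
    rw [hV, csqrt_ofReal_sq_mul hγ hQ]
    push_cast
    simp only [one_div, mul_inv]
    ring
  rw [← hs]
  exact hle n k hnk

end RotatingBlackHole

/-! ### Hadamard singular parts -/

lemma hadamard_leading_eq {s θ : ℝ} (hs : 0 < s) (hθ : 0 < θ) :
    1 / (4 * √2 * Real.pi * √(s ^ 2 * θ ^ 2 / 2)) = 1 / (4 * Real.pi * s * θ) := by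
  have h : √2 * √(s ^ 2 * θ ^ 2 / 2) = s * θ := by
    rw [← Real.sqrt_mul (by norm_num), show 2 * (s ^ 2 * θ ^ 2 / 2) = (s * θ) ^ 2 by ring,
      Real.sqrt_sq (by positivity)]
  congr 1
  linear_combination (4 * Real.pi) * h

/-- A Hadamard singular part in terms of the angular separation, for `g_θθ = s²`. -/
lemma IsAngularHadamardPart.isBigO_sub {s : ℝ} (hs : 0 < s) {H : ℝ → ℂ}
    (h : IsAngularHadamardPart (s ^ 2) H) :
    (fun θ => H θ - ((1 / (4 * Real.pi * s * θ) : ℝ) : ℂ)) =O[𝓝[>] 0] (fun θ : ℝ => θ) := by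
  refine Asymptotics.IsBigO.congr' h ?_ EventuallyEq.rfl
  filter_upwards [self_mem_nhdsWithin] with θ hθ
  rw [hadamard_leading_eq hs hθ]

/-- In Minkowski spacetime the mode sum is, up to an absolutely convergent Fourier series, a
multiple of the model, and its singularity is the Hadamard one. -/
theorem exists_isModeSum_minkowski {κ Ω ρ : ℝ} (hκ : 0 < κ) (hρ : 0 < ρ) (hΩ : |Ω| * ρ < 1)
    {g : ℤ → ℤ → ℂ} {C L : ℝ}
    (hg : ∀ n k : ℤ, L ≤ √((n : ℝ) ^ 2 + k ^ 2) →
      ‖g n k - 1 / (2 * csqrt (modeQ ρ κ Ω (n, k)))‖ ≤ C / √((n : ℝ) ^ 2 + k ^ 2) ^ 3) :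
    ∃ F : ℝ × ℝ → ℂ,
      IsModeSum κ (fun n k => ((κ / (4 * Real.pi ^ 2) : ℝ) : ℂ) * g n k) F ∧
      ∃ l : ℂ, Tendsto (fun θ : ℝ => F (0, θ) - ((1 / (4 * Real.pi * ρ * θ) : ℝ) : ℂ))
        (𝓝[>] 0) (𝓝 l) := by
  have hpi := Real.pi_pos
  have hsp := Real.sqrt_pos.2 hpi
  set a : ℂ := ((κ / (4 * Real.pi ^ 2) : ℝ) : ℂ) with ha
  set b : ℂ := ((1 / √Real.pi : ℝ) : ℂ) with hb
  set e : ℤ → ℤ → ℂ := fun n k => g n k - b * modelCoeff ρ κ Ω (n, k) with he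
  have h1 : Summable fun p : ℤ × ℤ => ‖g p.1 p.2 - 1 / (2 * csqrt (modeQ ρ κ Ω p))‖ :=
    summable_norm_of_le_div_pow_three fun p hp => hg p.1 p.2 hp
  have h2 : Summable fun p : ℤ × ℤ =>
      ‖1 / (2 * csqrt (modeQ ρ κ Ω p)) - b * modelCoeff ρ κ Ω p‖ := by
    refine (summable_model_sub hρ hκ hΩ).congr_cofinite ?_
    filter_upwards [eventually_cofinite_ne (0 : ℤ × ℤ)] with p hp
    rw [if_neg hp]
  have h3 : Summable fun p : ℤ × ℤ => ‖e p.1 p.2‖ := by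
    refine (h1.add h2).of_nonneg_of_le (fun _ => norm_nonneg _) fun p => ?_
    refine le_trans (le_of_eq ?_) (norm_add_le _ _)
    simp only [he, sub_add_sub_cancel]
  have hsum := (((isModeSum_thermalModel hρ hκ hΩ).const_mul b).add
    (isModeSum_of_summable h3)).const_mul a
  simp only [he, add_sub_cancel] at hsum
  refine ⟨_, hsum, ?_⟩
  obtain ⟨l, hl⟩ := tendsto_thermalModel_sub hρ hκ hΩ
  have hE : Tendsto (fun θ : ℝ => ∑' p : ℤ × ℤ,
      (g p.1 p.2 - b * modelCoeff ρ κ Ω (p.1, p.2)) * modeWave κ p (0, θ)) (𝓝[>] 0)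
      (𝓝 (∑' p : ℤ × ℤ, (g p.1 p.2 - b * modelCoeff ρ κ Ω (p.1, p.2)) * modeWave κ p (0, 0))) := by
    have hc : Continuous fun θ : ℝ => ∑' p : ℤ × ℤ, e p.1 p.2 * modeWave κ p (0, θ) :=
      (continuous_tsum_modeWave h3).comp (by fun_prop)
    exact (hc.tendsto 0).mono_left nhdsWithin_le_nhds
  refine ⟨_, (((hl.const_mul b).add hE).const_mul a).congr' ?_⟩
  filter_upwards [self_mem_nhdsWithin] with θ hθ
  have hθ : 0 < θ := hθ
  have h4 : a * (b * ((Real.pi * √Real.pi / (ρ * κ * θ) : ℝ) : ℂ)) =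
      ((1 / (4 * Real.pi * ρ * θ) : ℝ) : ℂ) := by
    rw [ha, hb, ← Complex.ofReal_mul, ← Complex.ofReal_mul]
    congr 1
    field_simp
  rw [← h4]
  ring

end

theorem theorem3p1
    (B : RotatingBlackHole) (m ξ : ℝ)
    (G : ℤ → ℤ → ℝ → ℝ → ℂ)
    (hG : ∀ n k : ℤ, B.corotating.IsRadialGreen
      (fun r => m ^ 2 + ξ * B.corotating.scalarCurvature r) (B.κ * n) k B.rH B.rM (G n k))
    (r : ℝ) (hr : r ∈ Set.Ioo B.rH B.rM)
    (γ T Ω : ℝ)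
    (hγ : γ = B.lapse r) (hT : T = B.κ / (2 * Real.pi)) (hΩ : Ω = B.shift r + B.ΩH)
    (mM ρ ρM : ℝ) (hρ : ρ = γ⁻¹ * √(B.gθθ r)) (hρM : ρ < ρM) (hΩM : |Ω| * ρM < 1)
    (GM : ℤ → ℤ → ℝ → ℝ → ℂ)
    (hGM : ∀ n k : ℤ, (rotatingMinkowski Ω).IsRadialGreen
      (fun _ => mM ^ 2) (2 * Real.pi * T * n) k 0 ρM (GM n k))
    (GBHmode GMmode Δ : ℤ → ℤ → ℂ)
    (hGBHmode : ∀ n k : ℤ, GBHmode n k = ((B.κ / (4 * Real.pi ^ 2) : ℝ) : ℂ) * G n k r r)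
    (hGMmode : ∀ n k : ℤ, GMmode n k = ((T / (2 * Real.pi) : ℝ) : ℂ) * GM n k ρ ρ)
    (hΔ : ∀ n k : ℤ, Δ n k = GBHmode n k - ((γ⁻¹ : ℝ) : ℂ) * GMmode n k) :
    -- the double sum converges absolutely and is finite in the coincidence limit
    Summable (fun nk : ℤ × ℤ => ‖Δ nk.1 nk.2‖) ∧
    Filter.Tendsto
      (fun θ : ℝ => ∑' k : ℤ, Complex.exp (Complex.I * k * θ) * ∑' n : ℤ, Δ n k)
      (nhdsWithin 0 (Set.Ioi 0)) (nhds (∑' k : ℤ, ∑' n : ℤ, Δ n k)) ∧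
    -- the vacuum polarisation, as the double sum plus the regular Minkowski term, is finite
    ∃ F FM : ℝ × ℝ → ℂ,
      IsModeSum B.κ GBHmode F ∧ IsModeSum (2 * Real.pi * T) GMmode FM ∧
      ∃ Lreg : ℂ, ∀ H HM : ℝ → ℂ,
        IsAngularHadamardPart (B.gθθ r) H → IsAngularHadamardPart (ρ ^ 2) HM →
        ((fun θ : ℝ => (F (0, θ) - H θ)
            - ((∑' k : ℤ, Complex.exp (Complex.I * k * θ) * ∑' n : ℤ, Δ n k)
              + ((γ⁻¹ : ℝ) : ℂ) * (FM (0, θ) - HM θ)))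
          =O[nhdsWithin 0 (Set.Ioi 0)] (fun θ : ℝ => θ)) ∧
        Filter.Tendsto (fun θ : ℝ => FM (0, θ) - HM θ)
          (nhdsWithin 0 (Set.Ioi 0)) (nhds Lreg) ∧
        Filter.Tendsto (fun θ : ℝ => F (0, θ) - H θ)
          (nhdsWithin 0 (Set.Ioi 0))
          (nhds ((∑' k : ℤ, ∑' n : ℤ, Δ n k) + ((γ⁻¹ : ℝ) : ℂ) * Lreg)) := by
  have hκ := B.κ_pos
  have hγ0 : 0 < γ := hγ ▸ B.lapse_pos r (Ioo_subset_Ioc_self hr)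
  have hs0 : 0 < √(B.gθθ r) := Real.sqrt_pos.2 (B.gθθ_pos r (Ioo_subset_Icc_self hr))
  have hρ0 : 0 < ρ := hρ ▸ mul_pos (inv_pos.2 hγ0) hs0
  have hΩρ : |Ω| * ρ < 1 := (mul_le_mul_of_nonneg_left hρM.le (abs_nonneg Ω)).trans_lt hΩM
  have hTκ : 2 * Real.pi * T = B.κ := by rw [hT]; field_simp
  have hTa : T / (2 * Real.pi) = B.κ / (4 * Real.pi ^ 2) := by rw [hT]; field_simp; norm_num
  simp only [hTκ] at hGM ⊢
  simp only [hTa] at hGMmode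
  obtain ⟨C₁, L₁, hC₁, -, h₁⟩ := B.green_asymptotics hG hr
  rw [← hγ, ← hρ, ← hΩ] at h₁
  obtain ⟨C₂, L₂, hC₂, -, h₂⟩ := rotatingMinkowski_green_asymptotics hκ hρ0 hρM hΩM hGM
  set a : ℝ := B.κ / (4 * Real.pi ^ 2) with ha
  have ha0 : 0 ≤ a := by positivity
  have hΔs : Summable fun p : ℤ × ℤ => ‖Δ p.1 p.2‖ := by
    refine summable_norm_of_le_div_pow_three (C := a * (C₁ + γ⁻¹ * C₂)) (L := max L₁ L₂)
      fun p hp => ?_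
    have e₁ := h₁ p.1 p.2 ((le_max_left _ _).trans hp)
    have e₂ := h₂ p.1 p.2 ((le_max_right _ _).trans hp)
    set w : ℂ := 1 / (2 * csqrt (modeQ ρ B.κ Ω (p.1, p.2)))
    have e : Δ p.1 p.2 = (a : ℂ) * ((G p.1 p.2 r r - ((γ⁻¹ : ℝ) : ℂ) * w)
        - ((γ⁻¹ : ℝ) : ℂ) * (GM p.1 p.2 ρ ρ - w)) := by
      rw [hΔ, hGBHmode, hGMmode]; ring
    rw [e, norm_mul, Complex.norm_real, Real.norm_of_nonneg ha0, mul_div_assoc, add_div,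
      mul_div_assoc]
    refine mul_le_mul_of_nonneg_left ((norm_sub_le _ _).trans (add_le_add e₁ ?_)) ha0
    rw [norm_mul, Complex.norm_real, Real.norm_of_nonneg (inv_pos.2 hγ0).le]
    exact mul_le_mul_of_nonneg_left e₂ (inv_pos.2 hγ0).le
  obtain ⟨FM, hFM, l, hl⟩ := exists_isModeSum_minkowski hκ hρ0 hΩρ h₂
  have hFM' : IsModeSum B.κ GMmode FM := by
    rwa [show GMmode = _ from funext fun n => funext fun k => hGMmode n k]
  have hF : IsModeSum B.κ GBHmode fun x => ((γ⁻¹ : ℝ) : ℂ) * FM x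
      + ∑' p : ℤ × ℤ, Δ p.1 p.2 * modeWave B.κ p x := by
    have h := (hFM'.const_mul ((γ⁻¹ : ℝ) : ℂ)).add (isModeSum_of_summable hΔs)
    simpa only [hΔ, add_sub_cancel] using h
  refine ⟨hΔs, tendsto_tsum_angular hΔs, _, FM, hF, hFM', l, fun H HM hH hHM => ?_⟩
  have hH' : (fun θ => H θ - ((1 / (4 * Real.pi * √(B.gθθ r) * θ) : ℝ) : ℂ))
      =O[𝓝[>] 0] (fun θ : ℝ => θ) := by
    refine IsAngularHadamardPart.isBigO_sub hs0 ?_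
    rwa [Real.sq_sqrt (B.gθθ_pos r (Ioo_subset_Icc_self hr)).le]
  have hHM' := hHM.isBigO_sub hρ0
  have hθ0 : Tendsto (fun θ : ℝ => θ) (𝓝[>] 0) (𝓝 0) := tendsto_id.mono_left nhdsWithin_le_nhds
  have hreg : Tendsto (fun θ : ℝ => FM (0, θ) - HM θ) (𝓝[>] 0) (𝓝 l) := by
    have h := hl.sub (hHM'.trans_tendsto hθ0)
    rw [sub_zero] at h
    refine h.congr fun θ => ?_
    ring
  -- the leading singularities agree: `γ⁻¹ / ρ = 1 / √g_θθ`
  have hlead : ∀ θ : ℝ, ((1 / (4 * Real.pi * √(B.gθθ r) * θ) : ℝ) : ℂ) =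
      ((γ⁻¹ : ℝ) : ℂ) * ((1 / (4 * Real.pi * ρ * θ) : ℝ) : ℂ) := fun θ => by
    rw [← Complex.ofReal_mul, hρ]
    congr 1
    simp only [one_div, mul_inv, inv_inv]
    field_simp
  have hO := (hHM'.const_mul_left ((γ⁻¹ : ℝ) : ℂ)).sub hH'
  have hdiff : (fun θ : ℝ => (((γ⁻¹ : ℝ) : ℂ) * FM (0, θ)
      + ∑' p : ℤ × ℤ, Δ p.1 p.2 * modeWave B.κ p (0, θ) - H θ)
      - ((∑' k : ℤ, Complex.exp (Complex.I * k * θ) * ∑' n : ℤ, Δ n k)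
        + ((γ⁻¹ : ℝ) : ℂ) * (FM (0, θ) - HM θ))) =O[𝓝[>] 0] (fun θ : ℝ => θ) := by
    refine hO.congr_left fun θ => ?_
    rw [tsum_angular_eq hΔs B.κ, hlead]
    ring
  refine ⟨hdiff, hreg, ?_⟩
  have h := (hdiff.trans_tendsto hθ0).add
    ((tendsto_tsum_angular hΔs).add (hreg.const_mul ((γ⁻¹ : ℝ) : ℂ)))
  rw [zero_add] at h
  refine h.congr fun θ => ?_
  ring
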